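/- Let $?:[0,1]\to[0,1]$ be the Minkowski question mark function, $?([0,a_1,a_2,\dots])=2\sum_{i\ge1}(-1)^{i+1}2^{-(a_1+\dots+a_i)}$ (the sum being finite when the regular continued fraction terminates), let $F(x)=?\big(\tfrac{x}{x+1}\big)$ for $x\ge 0$, and let $d_n=\int_0^1\cos(2\pi nx)\,d?(x)$. Write $\mathbb N=\{1,2,\dots\}$, $\mathbb N_0=\{0,1,2,\dots\}$. For $n\in\mathbb N$, $i,j\in\mathbb N_0$ the improper integrals $$I_{n,i,j}=\int_n^\infty\Big[\sum_{K\ge1}2^{-K}(\log K)^i\sin(2\pi Kx)\Big]\frac{(\log x)^j\,dx}{x}=\lim_{R\to\infty}\int_n^R,\qquad J_n=\int_n^\infty\frac{\sin(2\pi x)}{5-4\cos(2\pi x)}\frac{dx}{x}=\lim_{R\to\infty}\int_n^R$$ converge. For $r\in\mathbb N_0$ the series $S_r=\sum_{n\ge1}2^{-n}(\log n)^r$ converges, and $\mathcal A_r\subset\mathbb R$ denotes the $\mathbb Q$-algebra generated by the Taylor coefficients of $\Gamma(s)$ at $s=1$, the Laurent coefficients of $\zeta(s)$ at $s=1$, $\pi$,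 $1/\pi$, $\log\pi$, $\log n$ $(n\in\mathbb N)$, all $I_{n,i,j}$ $(n\in\mathbb N$, $i,j\in\mathbb N_0)$, and $S_r$. Put $H(s)=(2\pi)^{-(s+1)}\Gamma(s+1)\sin\frac{\pi s}{2}$ and, denoting by $[s^r]$ the coefficient of $s^r$ in an expansion at $s=0$, $$\eta_{r,n}=r!\,[s^r]\;\frac{s\,n^{-s}}{2\pi n}\sum_{i,j\ge0}\frac{I_{n,i,j}}{i!\,j!}s^{i+j},\qquad \xi_{r,n}=r!\,[s^r]\;n^{-s-1}H(s)-\eta_{r,n},$$ $$A_r^{0}=\tfrac34S_r+r!\,[s^r]\,H(s)\zeta(s+1),\qquad A_r=A_r^{0}-\sum_{n=1}^\infty\eta_{r,n}.$$ 1. For every odd $r\in\mathbb N$ and every $n\in\mathbb N$ we have $\xi_{r,n},\eta_{r,n},A_r^{0}\in\mathcal A_r$; the series $\sum_n\eta_{r,n}$ and $\sum_n\xi_{r,n}d_n$ converge absolutely; and $$\sum_{n=1}^\infty\xi_{r,n}\,d_n=A_r .$$ 2. For $r=1$: $\xi_{1,n}=\frac1{4n}-\frac1{\pi n}J_n$ and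 $A_1=\frac34S_1-\frac14\log2\pi-\sum_{n\ge1}\frac1{\pi n}J_n$, so that the identity reads $$\frac34\sum_{n=1}^\infty2^{-n}\log n-\frac14\log2\pi-\sum_{n=1}^\infty\frac{d_n}{4n}-\sum_{n=1}^\infty\frac{1-d_n}{\pi n}\int_n^\infty\frac{\sin(2\pi x)}{5-4\cos(2\pi x)}\frac{dx}{x}=0,$$ the last two series over $n$ converging absolutely. 3. For every $s\in\mathbb C$ the integral $\zeta_{\mathcal M}(s)\Gamma(s+1):=\int_0^\infty x^s\,dF(x)$ converges absolutely, and it is an even entire function of $s$. For every odd $r$ its $r$-th derivative at $s=0$ equals $A_r-\sum_n\xi_{r,n}d_n$, and this derivative is $0$. 4. The identities are canonical: they determine the $d_n$. If $G:[0,1]\to\mathbb R$ is continuous and non-decreasing, $G(0)=0$, $G(x)+G(1-x)=1$ on $[0,1]$, and its Fourier–Stieltjes coefficients $e_n=\int_0^1\cos(2\pi nx)\,dG(x)$ satisfy $\sum_{n\ge1}\xi_{r,n}e_n=A_r$ with absolute convergence for every odd $r\in\mathbb N$, then $G={?}$ on $[0,1]$ and $e_n=d_n$ for all $n$. -/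

import Mathlib

open MeasureTheory Filter Topology

noncomputable section

namespace Minkowski

/-! ### The question mark function -/

/-- The Gauss map `x ↦ {1/x}` (with `0 ↦ 0`). -/
def gaussMap (x : ℝ) : ℝ := Int.fract x⁻¹

/-- `cfDigit x j` is the partial quotient `a_{j+1}` of `x = [0, a₁, a₂, …] ∈ (0, 1]`; it is
meaningful as long as the expansion has not terminated, i.e. `gaussMap^[j] x ≠ 0`. -/
def cfDigit (x : ℝ) (j : ℕ) : ℕ := ⌊(gaussMap^[j] x)⁻¹⌋₊

/-- The term `(-1)^i 2^{-(a₁ + ⋯ + a_{i+1})}`; it is `0` once the expansion of `x` has ended. -/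
def questionTerm (x : ℝ) (i : ℕ) : ℝ :=
  if gaussMap^[i] x = 0 then 0
  else (-1) ^ i * (1 / 2) ^ (∑ j ∈ Finset.range (i + 1), cfDigit x j)

/-- The Minkowski question mark function on `[0, 1]`:
`?([0, a₁, a₂, …]) = 2 ∑_{i ≥ 1} (-1)^{i+1} 2^{-(a₁ + ⋯ + a_i)}`. -/
def question (x : ℝ) : ℝ := 2 * ∑' i, questionTerm x i

theorem gaussMap_mem {x : ℝ} : gaussMap x ∈ Set.Icc (0 : ℝ) 1 :=
  ⟨Int.fract_nonneg _, (Int.fract_lt_one _).le⟩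

theorem gaussMap_zero : gaussMap 0 = 0 := by simp [gaussMap]

theorem questionTerm_zero_left (i : ℕ) : questionTerm 0 i = 0 := by
  have : gaussMap^[i] 0 = 0 := Function.iterate_fixed gaussMap_zero i
  simp [questionTerm, this]

theorem question_zero : question 0 = 0 := by simp [question, questionTerm_zero_left]

theorem questionTerm_first {x : ℝ} (hx : x ≠ 0) :
    questionTerm x 0 = (1 / 2) ^ ⌊x⁻¹⌋₊ := by
  simp [questionTerm, cfDigit, hx]

theorem questionTerm_succ (x : ℝ) (i : ℕ) :
    questionTerm x (i + 1) = -((1 / 2) ^ ⌊x⁻¹⌋₊ * questionTerm (gaussMap x) i) := by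
  have h : ∀ j, cfDigit x (j + 1) = cfDigit (gaussMap x) j := fun j => by
    simp [cfDigit, Function.iterate_succ_apply]
  have h0 : cfDigit x 0 = ⌊x⁻¹⌋₊ := by simp [cfDigit]
  unfold questionTerm
  rw [Function.iterate_succ_apply, Finset.sum_range_succ']
  simp only [h, h0]
  split_ifs
  · simp
  · ring

theorem one_le_floor_inv {x : ℝ} (h0 : 0 < x) (h1 : x ≤ 1) : 1 ≤ ⌊x⁻¹⌋₊ := by
  rw [Nat.one_le_floor_iff]
  exact (one_le_inv₀ h0).2 h1

theorem half_pow_floor_le {x : ℝ} (h0 : 0 < x) (h1 : x ≤ 1) :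
    (1 / 2 : ℝ) ^ ⌊x⁻¹⌋₊ ≤ 1 / 2 := by
  simpa using pow_le_pow_of_le_one (by norm_num : (0 : ℝ) ≤ 1 / 2) (by norm_num)
    (one_le_floor_inv h0 h1)

theorem abs_questionTerm_le (i : ℕ) :
    ∀ {x : ℝ}, x ∈ Set.Icc (0 : ℝ) 1 → |questionTerm x i| ≤ (1 / 2) ^ i := by
  induction i with
  | zero =>
    intro x hx
    rcases hx.1.eq_or_lt with h | h
    · simp [← h, questionTerm_zero_left]
    · rw [questionTerm_first h.ne', abs_of_nonneg (by positivity)]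
      linarith [half_pow_floor_le h hx.2]
  | succ k ih =>
    intro x hx
    rcases hx.1.eq_or_lt with h | h
    · rw [← h, questionTerm_zero_left, abs_zero]; positivity
    · rw [questionTerm_succ, abs_neg, abs_mul, abs_of_nonneg (by positivity : (0 : ℝ) ≤ (1 / 2) ^ _),
        pow_succ']
      exact mul_le_mul (half_pow_floor_le h hx.2) (ih gaussMap_mem) (abs_nonneg _) (by norm_num)

theorem summable_questionTerm {x : ℝ} (hx : x ∈ Set.Icc (0 : ℝ) 1) :
    Summable (questionTerm x) :=
  Summable.of_norm_bounded summable_geometric_two (fun i => abs_questionTerm_le i hx)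

/-- Splitting off the first partial quotient. -/
theorem question_rec {x : ℝ} (h0 : 0 < x) (h1 : x ≤ 1) :
    question x = (1 / 2) ^ ⌊x⁻¹⌋₊ * (2 - question (gaussMap x)) := by
  unfold question
  rw [(summable_questionTerm ⟨h0.le, h1⟩).tsum_eq_zero_add, questionTerm_first h0.ne']
  simp_rw [questionTerm_succ]
  rw [tsum_neg, tsum_mul_left]
  ring

theorem question_bounds (k : ℕ) : ∀ {x : ℝ}, x ∈ Set.Icc (0 : ℝ) 1 →
    -(4 * (1 / 2) ^ k) ≤ question x ∧ question x ≤ 1 + 4 * (1 / 2) ^ k := by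
  induction k with
  | zero =>
    intro x hx
    have h : |∑' i, questionTerm x i| ≤ 2 := by
      have := tsum_of_norm_bounded (f := questionTerm x) hasSum_geometric_two
        (fun i => abs_questionTerm_le i hx)
      simpa using this
    have := abs_le.1 h
    unfold question
    constructor <;> linarith
  | succ k ih =>
    intro x hx
    rcases hx.1.eq_or_lt with h | h
    · rw [← h, question_zero]
      constructor
      · have : (0 : ℝ) ≤ 4 * (1 / 2) ^ (k + 1) := by positivity
        linarith
      · positivity
    · rw [question_rec h hx.2, pow_succ]
      obtain ⟨ha, hb⟩ := ih (gaussMap_mem (x := x))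
      have hp : (0 : ℝ) ≤ (1 / 2) ^ ⌊x⁻¹⌋₊ := by positivity
      have hq := half_pow_floor_le h hx.2
      have hc : (0 : ℝ) ≤ (1 / 2) ^ k := by positivity
      constructor <;> nlinarith

theorem question_mem {x : ℝ} (hx : x ∈ Set.Icc (0 : ℝ) 1) : question x ∈ Set.Icc (0 : ℝ) 1 := by
  have hl : Tendsto (fun k : ℕ => 4 * (1 / 2 : ℝ) ^ k) atTop (𝓝 0) := by
    simpa using (tendsto_pow_atTop_nhds_zero_of_lt_one (r := (1 / 2 : ℝ)) (by norm_num)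
      (by norm_num)).const_mul 4
  constructor
  · have := hl.neg
    rw [neg_zero] at this
    exact le_of_tendsto' this fun k => (question_bounds k hx).1
  · have := hl.const_add 1
    rw [add_zero] at this
    exact ge_of_tendsto' this fun k => (question_bounds k hx).2

theorem question_approx_mono (k : ℕ) : ∀ {x y : ℝ}, 0 ≤ x → x ≤ y → y ≤ 1 →
    question x ≤ question y + (1 / 2) ^ k := by
  induction k with
  | zero =>
    intro x y hx hxy hy
    have h1 := (question_mem ⟨hx, hxy.trans hy⟩).2
    have h2 := (question_mem ⟨hx.trans hxy, hy⟩).1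
    simpa using by linarith
  | succ k ih =>
    intro x y hx hxy hy
    have hc : (0 : ℝ) ≤ (1 / 2) ^ (k + 1) := by positivity
    have h2 := (question_mem ⟨hx.trans hxy, hy⟩).1
    rcases hx.eq_or_lt with h | h
    · rw [← h, question_zero]; linarith
    have hy0 : 0 < y := h.trans_le hxy
    have hinv : y⁻¹ ≤ x⁻¹ := inv_anti₀ h hxy
    have hgx := question_mem (gaussMap_mem (x := x))
    have hgy := question_mem (gaussMap_mem (x := y))
    rw [question_rec h (hxy.trans hy), question_rec hy0 hy]
    rcases (Nat.floor_mono hinv).eq_or_lt with he | hlt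
    · have hg : gaussMap y ≤ gaussMap x := by
        have e : ⌊y⁻¹⌋ = ⌊x⁻¹⌋ := by
          rw [← Int.natCast_floor_eq_floor (inv_nonneg.2 hy0.le),
            ← Int.natCast_floor_eq_floor (inv_nonneg.2 h.le), he]
        unfold gaussMap Int.fract
        rw [e]; linarith
      have := ih gaussMap_mem.1 hg (gaussMap_mem (x := x)).2
      rw [he, pow_succ]
      have hp : (0 : ℝ) ≤ (1 / 2) ^ ⌊x⁻¹⌋₊ := by positivity
      have hq := half_pow_floor_le h (hxy.trans hy)
      have hc' : (0 : ℝ) ≤ (1 / 2) ^ k := by positivity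
      nlinarith
    · have hle : (1 / 2 : ℝ) ^ ⌊x⁻¹⌋₊ ≤ (1 / 2) ^ (⌊y⁻¹⌋₊ + 1) :=
        pow_le_pow_of_le_one (by norm_num) (by norm_num) hlt
      rw [pow_succ] at hle
      have hp : (0 : ℝ) ≤ (1 / 2) ^ ⌊x⁻¹⌋₊ := by positivity
      have hp' : (0 : ℝ) ≤ (1 / 2) ^ ⌊y⁻¹⌋₊ := by positivity
      nlinarith [hgx.1, hgx.2, hgy.1, hgy.2]

theorem question_monotoneOn : MonotoneOn question (Set.Icc 0 1) := by
  intro x hx y hy hxy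
  have hl : Tendsto (fun k : ℕ => question y + (1 / 2 : ℝ) ^ k) atTop (𝓝 (question y)) := by
    simpa using (tendsto_pow_atTop_nhds_zero_of_lt_one (r := (1 / 2 : ℝ)) (by norm_num)
      (by norm_num)).const_add (question y)
  exact ge_of_tendsto' hl fun k => question_approx_mono k hx.1 hxy hy.2

/-! ### Stieltjes integrals -/

/-- A function that is monotone on `[0, 1]` becomes monotone on `ℝ` when it is extended by
constants on both sides. -/
theorem monotone_clamp {G : ℝ → ℝ} (hG : MonotoneOn G (Set.Icc 0 1)) :
    Monotone fun x => G (max 0 (min 1 x)) := by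
  intro x y hxy
  refine hG ⟨le_max_left _ _, max_le zero_le_one (min_le_left _ _)⟩
    ⟨le_max_left _ _, max_le zero_le_one (min_le_left _ _)⟩ ?_
  exact max_le_max le_rfl (min_le_min le_rfl hxy)

/-- The Fourier–Stieltjes coefficient `∫₀¹ cos(2πnx) dG(x)` of a function `G` that is monotone on
`[0, 1]`, with respect to the Lebesgue–Stieltjes measure of `G`. -/
def fsCoeff (G : ℝ → ℝ) (hG : MonotoneOn G (Set.Icc 0 1)) (n : ℕ) : ℝ :=
  ∫ x in Set.Icc (0 : ℝ) 1, Real.cos (2 * Real.pi * n * x)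
    ∂(monotone_clamp hG).stieltjesFunction.measure

/-- `d_n = ∫₀¹ cos(2πnx) d?(x)`. -/
def d (n : ℕ) : ℝ := fsCoeff question question_monotoneOn n

/-- The extended question mark function `F(x) = ?(x / (x + 1))` for `x ≥ 0`
(and `F(x) = 0` for `x < 0`). -/
def extQuestion (x : ℝ) : ℝ := question (max x 0 / (max x 0 + 1))

theorem extQuestion_monotone : Monotone extQuestion := by
  have key : ∀ z : ℝ, 0 ≤ z → z / (z + 1) ∈ Set.Icc (0 : ℝ) 1 := fun z hz =>
    ⟨by positivity, (div_le_one (by positivity)).2 (by linarith)⟩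
  intro x y hxy
  have hx : 0 ≤ max x 0 := le_max_right _ _
  have hy : 0 ≤ max y 0 := le_max_right _ _
  refine question_monotoneOn (key _ hx) (key _ hy) ?_
  rw [div_le_div_iff₀ (by positivity) (by positivity)]
  nlinarith [max_le_max hxy (le_refl (0 : ℝ))]

/-- The measure `dF` on `ℝ`. -/
def extMeasure : Measure ℝ := extQuestion_monotone.stieltjesFunction.measure

/-- The function `ζ_M(s) Γ(s + 1) = ∫₀^∞ x^s dF(x)`. -/
def zetaMGamma (s : ℂ) : ℂ := ∫ x in Set.Ioi (0 : ℝ), (x : ℂ) ^ s ∂extMeasure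

/-! ### The constants -/

/-- The `k`-th Taylor coefficient of `Γ(s)` at `s = 1`. -/
def gammaCoeff (k : ℕ) : ℝ := iteratedDeriv k Real.Gamma 1 / k.factorial

/-- The `k`-th Taylor coefficient at `s = 1` of the entire function `(s - 1) ζ(s)` (equal to `1` at
`s = 1`), i.e. the coefficient of `(s - 1)^(k - 1)` in the Laurent expansion of `ζ(s)` at `1`.
These numbers are real. -/
def zetaCoeff (k : ℕ) : ℝ :=
  (iteratedDeriv k (Function.update (fun s : ℂ => (s - 1) * riemannZeta s) 1 1) 1
    / k.factorial).re

/-- `∑_{n ≥ 1} 2^{-n} (log n)^r`. -/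
def logSum (r : ℕ) : ℝ := ∑' n : ℕ, (1 / 2) ^ (n + 1) * Real.log (n + 1) ^ r

/-- `∑_{K ≥ 1} 2^{-K} (log K)^i sin(2πKx)`. -/
def oscKernel (i : ℕ) (x : ℝ) : ℝ :=
  ∑' K : ℕ, (1 / 2) ^ (K + 1) * Real.log (K + 1) ^ i * Real.sin (2 * Real.pi * (K + 1) * x)

/-- `∫_n^R [∑_{K ≥ 1} 2^{-K} (log K)^i sin(2πKx)] (log x)^j dx / x`. -/
def oscPartial (n i j : ℕ) (R : ℝ) : ℝ :=
  ∫ x in (n : ℝ)..R, oscKernel i x * (Real.log x ^ j / x)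

/-- The (conditionally convergent) improper integral
`∫_n^∞ [∑_{K ≥ 1} 2^{-K} (log K)^i sin(2πKx)] (log x)^j dx / x`. -/
def oscIntegral (n i j : ℕ) : ℝ := limUnder atTop (oscPartial n i j)

/-- `∫_n^R sin(2πx) / (5 - 4 cos(2πx)) dx / x`. -/
def relPartial (n : ℕ) (R : ℝ) : ℝ :=
  ∫ x in (n : ℝ)..R, Real.sin (2 * Real.pi * x) / (5 - 4 * Real.cos (2 * Real.pi * x)) * (1 / x)

/-- The (conditionally convergent) improper integral
`∫_n^∞ sin(2πx) / (5 - 4 cos(2πx)) dx / x`. -/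
def relIntegral (n : ℕ) : ℝ := limUnder atTop (relPartial n)

/-- The Taylor series at `s = 0` of `c^s = exp(s log c)`. -/
def powSeries (c : ℝ) : PowerSeries ℝ := PowerSeries.rescale (Real.log c) (PowerSeries.exp ℝ)

/-- The Taylor series at `s = 0` of
`H(s) = (2π)^{-(s+1)} Γ(s+1) sin(πs/2) = -(2π)^{-(s+1)} Γ(s+1) cos(π(s+1)/2)`. -/
def HSeries : PowerSeries ℝ :=
  PowerSeries.C (1 / (2 * Real.pi)) * powSeries (2 * Real.pi)⁻¹ * PowerSeries.mk gammaCoeff *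
    PowerSeries.rescale (Real.pi / 2) (PowerSeries.sin ℝ)

/-- The Taylor series at `s = 0` of `∑_{K ≥ 1} 2^{-K} K^s ∫_n^∞ x^{s-1} sin(2πKx) dx`: the
coefficient of `s^m` is
`∑_{i + j = m} (1 / (i! j!)) ∫_n^∞ [∑_K 2^{-K} (log K)^i sin(2πKx)] (log x)^j dx / x`. -/
def oscSeries (n : ℕ) : PowerSeries ℝ :=
  PowerSeries.mk fun m => ∑ p ∈ Finset.HasAntidiagonal.antidiagonal m,
    oscIntegral n p.1 p.2 / (p.1.factorial * p.2.factorial)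

/-- `r!` times the `r`-th Taylor coefficient at `s = 0` of
`(1 / (2πn)) s n^{-s} ∑_{K ≥ 1} 2^{-K} K^s ∫_n^∞ x^{s-1} sin(2πKx) dx`. -/
def eta (r n : ℕ) : ℝ :=
  r.factorial * PowerSeries.coeff r
    (PowerSeries.C (1 / (2 * Real.pi * n)) * PowerSeries.X * powSeries (n : ℝ)⁻¹ * oscSeries n)

/-- The coefficient `ξ_{r,n}` of `d_n`: the `r`-th derivative at `s = 0` of `n^{-s-1} H(s)`, minus
`eta r n`. -/
def xi (r n : ℕ) : ℝ :=
  r.factorial * PowerSeries.coeff r (PowerSeries.C (1 / (n : ℝ)) * powSeries (n : ℝ)⁻¹ * HSeries)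
    - eta r n

/-- The finite part of `A_r`: `(3/4) ∑ 2^{-n} (log n)^r` plus the `r`-th derivative at `s = 0` of
`H(s) ζ(s + 1)`. -/
def A₀ (r : ℕ) : ℝ :=
  3 / 4 * logSum r +
    r.factorial * PowerSeries.coeff (r + 1) (HSeries * PowerSeries.mk zetaCoeff)

/-- The right-hand side `A_r`. -/
def A (r : ℕ) : ℝ := A₀ r - ∑' n : ℕ, eta r (n + 1)

/-- The `ℚ`-algebra of constants: generated by the coefficients of the expansions of `Γ` and `ζ` at
`1`, by `π`, `1/π`, `log π`, `log n`, the integrals `oscIntegral n i j` (`n ≥ 1`, `i, j ≥ 0`), and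
`∑ 2^{-n} (log n)^r`. -/
def constAlgebra (r : ℕ) : Subalgebra ℚ ℝ :=
  Algebra.adjoin ℚ
    (Set.range gammaCoeff ∪ Set.range zetaCoeff ∪
      {Real.pi, 1 / Real.pi, Real.log Real.pi} ∪
      {x | ∃ n : ℕ, 1 ≤ n ∧ x = Real.log n} ∪
      {x | ∃ n i j : ℕ, 1 ≤ n ∧ x = oscIntegral n i j} ∪
      {logSum r})

end Minkowski

end

open Minkowski

/-!
Let `μ` be the Stieltjes measure on `[0, 1]` of a continuous monotone `G` with `G 0 = 0` and
`G x + G (1 - x) = 1`, let `eₙ` be its cosine coefficients, and let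
`ν = ∑_{K ≥ 0} 2^{-K-1} (μ shifted by K)` (`halfLineMeasure`), a probability measure on `(0, ∞)`.
For `G = ?` this `ν` is `dF`, and the functional equations of `?` say exactly that `ν` is invariant
under `x ↦ 1/x`; conversely, this invariance forces `G = ?` (`eqOn_question_of_inv_invariant`).

The bridge between `ν` and the coefficients is an identity for real `0 < s ≤ 1/2`
(`integral_rpow_halfLineMeasure`):
`∫ x^s dν = (3/4) ∑ 2^{-K} K^s + ∑ₙ ξₙ(s) (1 - eₙ)`, where `ξₙ(s) = n^{-s-1} H(s) - ηₙ(s)`.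
Indeed `∫ x^s dν = ∫ g dμ` with `g(x) = ∑_K 2^{-K-1} (x + K)^s`, and one expands the symmetrisation
of `g` in its cosine series, subtracts the value at `0`, and integrates against `μ`. The Fourier
coefficients of `g` are obtained from two integrations by parts on each `[K, K + 1]` and from
`∫₀^∞ (1 - cos x) x^{s-2} dx = Γ(s) sin(πs/2) / (1 - s)`.

All the functions of `s` that occur have asymptotic expansions as `s → 0+` (`HasExpansion`), whose
coefficients are the numbers `eta`, `xi`, `A` of the statement; this only needs
`∑ |eₙ| (log n)^j / n < ∞` for every `j` (`hasExpansion_integral_rpow`). An expansion of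
`s ↦ ∫ x^s dν` at `0+` forces all moments of `log x` under `ν` to be finite, by Fatou's lemma, and to
be given by the coefficients (`integrable_pow_of_hasExpansion`). Hence
`∫ (log x)^r dν = A r - ∑ₙ ξ_{r,n} eₙ`.

For `G = ?` the summability holds because the modulus of continuity of `?` bounds the mean squares of
the `dₙ` (`sum_sq_fsCoeff_le`), and the odd moments of `log x` vanish by inversion symmetry; this
gives the identities. For a general `G` satisfying all the identities, `ξ_{r,n}` has order
`(log n)^{r-1} / n`, so that absolute convergence yields the summability; then the odd logarithmic
moments vanish. As `ν` has finite moments of every positive order, this makes the law of `log x`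
symmetric (`map_neg_eq_of_odd_moments`), so `ν` is invariant under inversion and `G = ?`.
-/

namespace Minkowski


/-! ### Functional equations and modulus of continuity of the question mark function -/

/-- Lowering the first partial quotient by one doubles the value of `question`. -/
theorem question_div_one_sub {x : ℝ} (h0 : 0 ≤ x) (h1 : x ≤ 1 / 2) :
    question (x / (1 - x)) = 2 * question x := by
  rcases h0.eq_or_lt with h | h
  · simp [← h, question_zero]
  have hx1 : 0 < 1 - x := by linarith
  have hy0 : 0 < x / (1 - x) := by positivity
  have hy1 : x / (1 - x) ≤ 1 := by rw [div_le_one hx1]; linarith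
  have hinv : (x / (1 - x))⁻¹ = x⁻¹ - 1 := by field_simp
  have hg : gaussMap (x / (1 - x)) = gaussMap x := by
    simp only [gaussMap, hinv, Int.fract_sub_one]
  have hf : ⌊x⁻¹⌋₊ = ⌊x⁻¹ - 1⌋₊ + 1 := by
    rw [← Nat.floor_add_one]
    · simp
    · rw [sub_nonneg, one_le_inv₀ h]; linarith
  rw [question_rec hy0 hy1, question_rec h (by linarith), hg, hinv, hf, pow_succ]
  ring

theorem question_one_sub_of_pos {x : ℝ} (h0 : 0 < x) (h1 : x ≤ 1 / 2) :
    question (1 - x) = 1 - question x := by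
  rcases h1.eq_or_lt with h | h
  · have h2 : (2 : ℝ)⁻¹ = 1 - x := by rw [h]; norm_num
    have hf : ⌊(x : ℝ)⁻¹⌋₊ = 2 := by rw [h]; norm_num
    have hg : gaussMap x = 0 := by
      unfold gaussMap; rw [h]; norm_num
    have : 1 - x = x := by linarith
    rw [this, question_rec h0 (by linarith), hf, hg, question_zero]
    norm_num
  have hx1 : 0 < 1 - x := by linarith
  have hinv : (1 - x)⁻¹ = x / (1 - x) + 1 := by field_simp; ring
  have hy0 : 0 ≤ x / (1 - x) := by positivity
  have hy1 : x / (1 - x) < 1 := by rw [div_lt_one hx1]; linarith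
  have hf : ⌊(1 - x)⁻¹⌋₊ = 1 := by
    rw [hinv, Nat.floor_add_one hy0, Nat.floor_eq_zero.2 hy1]
  have hg : gaussMap (1 - x) = x / (1 - x) := by
    rw [gaussMap, hinv, Int.fract_add_one, Int.fract_eq_self.2 ⟨hy0, hy1⟩]
  rw [question_rec hx1 (by linarith), hf, hg, question_div_one_sub h0.le h1]
  ring

theorem question_one : question 1 = 1 := by
  rw [question_rec one_pos le_rfl]
  simp [gaussMap, question_zero]

theorem question_add_question_one_sub {x : ℝ} (hx : x ∈ Set.Icc (0 : ℝ) 1) :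
    question x + question (1 - x) = 1 := by
  rcases le_total x (1 / 2) with h | h
  · rcases hx.1.eq_or_lt with h' | h'
    · simp [← h', question_zero, question_one]
    · rw [question_one_sub_of_pos h' h]; ring
  · rcases hx.2.eq_or_lt with h' | h'
    · simp [h', question_zero, question_one]
    · have := question_one_sub_of_pos (x := 1 - x) (by linarith) (by linarith)
      rw [sub_sub_cancel] at this
      linarith

theorem question_le_of_le_pow (k : ℕ) : ∀ {x : ℝ}, 0 ≤ x → x ≤ (1 / 4) ^ k →
    question x ≤ (1 / 2) ^ k := by
  induction k with
  | zero => intro x h0 h1; simpa using (question_mem ⟨h0, by simpa using h1⟩).2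
  | succ k ih =>
    intro x h0 h1
    have hp : (1 / 4 : ℝ) ^ k ≤ 1 := pow_le_one₀ (by norm_num) (by norm_num)
    rw [pow_succ] at h1
    have hx : x ≤ 1 / 2 := by linarith
    have hx1 : 0 < 1 - x := by linarith
    have := ih (x := x / (1 - x)) (by positivity) (by
      rw [div_le_iff₀ hx1]; nlinarith)
    rw [question_div_one_sub h0 hx] at this
    rw [pow_succ]; linarith

/-- The question mark function is Hölder continuous of exponent `1 / 2`: both branches
`x ↦ x / (1 - x)` and its mirror image expand distances at most fourfold and double the
increments of `question`. -/
theorem question_sub_le (k : ℕ) : ∀ {x y : ℝ}, 0 ≤ x → x ≤ y → y ≤ 1 → y - x ≤ (1 / 4) ^ k →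
    question y - question x ≤ 2 * (1 / 2) ^ k := by
  induction k with
  | zero =>
    intro x y h0 hxy h1 _
    have := (question_mem ⟨h0.trans hxy, h1⟩).2
    have := (question_mem ⟨h0, hxy.trans h1⟩).1
    norm_num; linarith
  | succ k ih =>
    have key : ∀ {x y : ℝ}, 0 ≤ x → x ≤ y → y ≤ 1 / 2 → y - x ≤ (1 / 4) ^ (k + 1) →
        0 ≤ x / (1 - x) ∧ x / (1 - x) ≤ y / (1 - y) ∧ y / (1 - y) ≤ 1 ∧
          y / (1 - y) - x / (1 - x) ≤ (1 / 4) ^ k := by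
      intro x y h0 hxy h1 h
      have hy1 : 0 < 1 - y := by linarith
      have hx1 : 0 < 1 - x := by linarith
      refine ⟨by positivity, ?_, ?_, ?_⟩
      · rw [div_le_div_iff₀ hx1 hy1]; nlinarith
      · rw [div_le_one hy1]; linarith
      · rw [div_sub_div _ _ hy1.ne' hx1.ne', div_le_iff₀ (by positivity)]
        rw [pow_succ] at h
        have hq : (0 : ℝ) ≤ (1 / 4) ^ k := by positivity
        have : (1 : ℝ) / 4 ≤ (1 - y) * (1 - x) := by nlinarith
        nlinarith
    have left : ∀ {x y : ℝ}, 0 ≤ x → x ≤ y → y ≤ 1 / 2 → y - x ≤ (1 / 4) ^ (k + 1) →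
        question y - question x ≤ 2 * (1 / 2) ^ (k + 1) := by
      intro x y h0 hxy h1 h
      obtain ⟨a, b, c, e⟩ := key h0 hxy h1 h
      have := ih a b c e
      rw [question_div_one_sub h0 (by linarith), question_div_one_sub (by linarith) h1] at this
      rw [pow_succ]; linarith
    have half : ∀ {x : ℝ}, 0 ≤ x → x ≤ 1 / 2 → 1 / 2 - x ≤ (1 / 4) ^ (k + 1) →
        question (1 / 2) - question x ≤ (1 / 2) ^ (k + 1) := by
      intro x h0 h1 h
      obtain ⟨a, b, c, e⟩ := key h0 h1 le_rfl h
      have e1 : (1 / 2 : ℝ) / (1 - 1 / 2) = 1 := by norm_num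
      rw [e1] at b c e
      have h2 := question_le_of_le_pow k (x := 1 - x / (1 - x)) (by linarith) e
      have h3 := question_add_question_one_sub (x := x / (1 - x)) ⟨a, b⟩
      have h4 := question_div_one_sub (x := (1 / 2 : ℝ)) (by norm_num) le_rfl
      rw [e1, question_one] at h4
      rw [question_div_one_sub h0 h1] at h3
      rw [pow_succ]; linarith
    intro x y h0 hxy h1 h
    have hsx := question_add_question_one_sub (x := x) ⟨h0, by linarith⟩
    have hsy := question_add_question_one_sub (x := y) ⟨by linarith, h1⟩
    rcases le_total y (1 / 2) with hy | hy
    · exact left h0 hxy hy h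
    rcases le_total x (1 / 2) with hx | hx
    · have a := half h0 hx (by linarith)
      have b := half (x := 1 - y) (by linarith) (by linarith) (by linarith)
      have hs := question_add_question_one_sub (x := 1 / 2) (by constructor <;> norm_num)
      norm_num at hs a b ⊢
      linarith
    · have := left (x := 1 - y) (y := 1 - x) (by linarith) (by linarith) (by linarith)
        (by linarith)
      linarith

theorem question_continuousOn : ContinuousOn question (Set.Icc 0 1) := by
  rw [Metric.continuousOn_iff]
  intro x hx ε hε
  obtain ⟨k, hk⟩ := exists_pow_lt_of_lt_one (show 0 < ε / 2 by linarith)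
    (show (1 / 2 : ℝ) < 1 by norm_num)
  refine ⟨(1 / 4) ^ k, by positivity, fun y hy hd => ?_⟩
  rw [Real.dist_eq] at hd ⊢
  rcases le_total x y with h | h
  · rw [abs_of_nonneg (by linarith)] at hd
    rw [abs_of_nonneg (sub_nonneg.2 (question_monotoneOn hx hy h))]
    linarith [question_sub_le k hx.1 h hy.2 hd.le]
  · rw [abs_sub_comm, abs_of_nonneg (by linarith)] at hd
    rw [abs_sub_comm, abs_of_nonneg (sub_nonneg.2 (question_monotoneOn hy hx h))]
    linarith [question_sub_le k hy.1 h hx.2 hd.le]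

section

/-! ### Symmetric distributions on the unit interval and their extensions to the half line -/

/-- A continuous distribution function on `[0, 1]` that is symmetric about `1 / 2`. -/
structure IsSymmDist (G : ℝ → ℝ) : Prop where
  mono : MonotoneOn G (Set.Icc 0 1)
  cont : ContinuousOn G (Set.Icc 0 1)
  zero : G 0 = 0
  symm : ∀ x ∈ Set.Icc (0 : ℝ) 1, G x + G (1 - x) = 1

theorem isSymmDist_question : IsSymmDist question where
  mono := question_monotoneOn
  cont := question_continuousOn
  zero := question_zero
  symm _ hx := question_add_question_one_sub hx

variable {G : ℝ → ℝ}

theorem IsSymmDist.one (h : IsSymmDist G) : G 1 = 1 := by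
  have := h.symm 0 ⟨le_rfl, zero_le_one⟩
  rw [h.zero, zero_add, sub_zero] at this
  exact this

/-- The function `G`, extended by constants to the real line. -/
def clamped (G : ℝ → ℝ) (x : ℝ) : ℝ := G (max 0 (min 1 x))

theorem clamp_mem (x : ℝ) : max 0 (min 1 x) ∈ Set.Icc (0 : ℝ) 1 :=
  ⟨le_max_left _ _, max_le zero_le_one (min_le_left _ _)⟩

theorem clamped_of_mem {x : ℝ} (hx : x ∈ Set.Icc (0 : ℝ) 1) : clamped G x = G x := by
  rw [clamped, min_eq_right hx.2, max_eq_right hx.1]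

theorem IsSymmDist.clamped_of_nonpos (h : IsSymmDist G) {x : ℝ} (hx : x ≤ 0) :
    clamped G x = 0 := by
  rw [clamped, max_eq_left ((min_le_right _ _).trans hx), h.zero]

theorem IsSymmDist.clamped_of_one_le (h : IsSymmDist G) {x : ℝ} (hx : 1 ≤ x) :
    clamped G x = 1 := by
  rw [clamped, min_eq_left hx, max_eq_right zero_le_one, h.one]

theorem IsSymmDist.continuous_clamped (h : IsSymmDist G) : Continuous (clamped G) :=
  h.cont.comp_continuous (by fun_prop) clamp_mem

theorem IsSymmDist.clamped_add (h : IsSymmDist G) (x : ℝ) :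
    clamped G x + clamped G (1 - x) = 1 := by
  rcases le_total x 0 with h0 | h0
  · rw [h.clamped_of_nonpos h0, h.clamped_of_one_le (by linarith)]; simp
  rcases le_total 1 x with h1 | h1
  · rw [h.clamped_of_one_le h1, h.clamped_of_nonpos (by linarith)]; simp
  · rw [clamped_of_mem ⟨h0, h1⟩, clamped_of_mem ⟨by linarith, by linarith⟩, h.symm x ⟨h0, h1⟩]

theorem IsSymmDist.stieltjes_apply (h : IsSymmDist G) (x : ℝ) :
    (monotone_clamp h.mono).stieltjesFunction x = clamped G x := by
  rw [Monotone.stieltjesFunction_eq]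
  exact h.continuous_clamped.continuousWithinAt.rightLim_eq

/-- The probability measure `dG` on `[0, 1]`, regarded as a measure on the real line. -/
noncomputable def unitMeasure (h : IsSymmDist G) : Measure ℝ :=
  (monotone_clamp h.mono).stieltjesFunction.measure

variable (h : IsSymmDist G)

theorem unitMeasure_Iic (x : ℝ) : unitMeasure h (Set.Iic x) = ENNReal.ofReal (clamped G x) := by
  rw [unitMeasure, StieltjesFunction.measure_Iic (l := 0), h.stieltjes_apply, sub_zero]
  refine tendsto_const_nhds.congr' ?_
  filter_upwards [eventually_le_atBot 0] with y hy
  rw [h.stieltjes_apply, h.clamped_of_nonpos hy]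

theorem unitMeasure_Ioi (x : ℝ) :
    unitMeasure h (Set.Ioi x) = ENNReal.ofReal (1 - clamped G x) := by
  rw [unitMeasure, StieltjesFunction.measure_Ioi (l := 1), h.stieltjes_apply]
  refine tendsto_const_nhds.congr' ?_
  filter_upwards [eventually_ge_atTop 1] with y hy
  rw [h.stieltjes_apply, h.clamped_of_one_le hy]

instance : IsProbabilityMeasure (unitMeasure h) := by
  refine StieltjesFunction.isProbabilityMeasure _ ?_ ?_
  · refine tendsto_const_nhds.congr' ?_
    filter_upwards [eventually_le_atBot 0] with y hy
    rw [h.stieltjes_apply, h.clamped_of_nonpos hy]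
  · refine tendsto_const_nhds.congr' ?_
    filter_upwards [eventually_ge_atTop 1] with y hy
    rw [h.stieltjes_apply, h.clamped_of_one_le hy]

instance : NullSingletonClass (unitMeasure h) where
  measure_singleton x := by
    have e : (⇑(monotone_clamp h.mono).stieltjesFunction) = clamped G :=
      funext h.stieltjes_apply
    rw [unitMeasure, StieltjesFunction.measure_singleton, e,
      h.continuous_clamped.continuousWithinAt.leftLim_eq]
    simp

theorem unitMeasure_Ioc {x y : ℝ} :
    unitMeasure h (Set.Ioc x y) = ENNReal.ofReal (clamped G y - clamped G x) := by
  rw [unitMeasure, StieltjesFunction.measure_Ioc, h.stieltjes_apply, h.stieltjes_apply]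

theorem ae_mem_unitMeasure : ∀ᵐ x ∂unitMeasure h, x ∈ Set.Icc (0 : ℝ) 1 := by
  have h1 : ∀ᵐ x ∂unitMeasure h, x ∉ Set.Iic 0 :=
    measure_eq_zero_iff_ae_notMem.1 (by rw [unitMeasure_Iic, h.clamped_of_nonpos le_rfl]; simp)
  have h2 : ∀ᵐ x ∂unitMeasure h, x ∉ Set.Ioi 1 :=
    measure_eq_zero_iff_ae_notMem.1 (by rw [unitMeasure_Ioi, h.clamped_of_one_le le_rfl]; simp)
  filter_upwards [h1, h2] with x hx hy
  simp only [Set.mem_Iic, not_le, Set.mem_Ioi, not_lt] at hx hy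
  exact ⟨hx.le, hy⟩

theorem ae_pos_unitMeasure : ∀ᵐ x ∂unitMeasure h, 0 < x := by
  have h1 : ∀ᵐ x ∂unitMeasure h, x ∉ Set.Iic 0 :=
    measure_eq_zero_iff_ae_notMem.1 (by rw [unitMeasure_Iic, h.clamped_of_nonpos le_rfl]; simp)
  filter_upwards [h1] with x hx using by simpa using hx

theorem fsCoeff_eq (n : ℕ) :
    fsCoeff G h.mono n = ∫ x, Real.cos (2 * Real.pi * n * x) ∂unitMeasure h := by
  change ∫ x in Set.Icc (0 : ℝ) 1, _ ∂unitMeasure h = _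
  rw [Measure.restrict_eq_self_of_ae_mem (ae_mem_unitMeasure h)]

theorem abs_fsCoeff_le_one (n : ℕ) : |fsCoeff G h.mono n| ≤ 1 := by
  rw [fsCoeff_eq]
  have := norm_integral_le_of_norm_le_const (μ := unitMeasure h) (C := 1)
    (f := fun x => Real.cos (2 * Real.pi * n * x)) (ae_of_all _ fun x => Real.abs_cos_le_one _)
  simpa using this

/-- `dG` is invariant under `x ↦ 1 - x`. -/
theorem map_one_sub_unitMeasure : (unitMeasure h).map (fun x => 1 - x) = unitMeasure h := by
  have : IsProbabilityMeasure ((unitMeasure h).map (fun x => 1 - x)) :=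
    Measure.isProbabilityMeasure_map (by fun_prop)
  refine Measure.ext_of_Iic _ _ fun x => ?_
  rw [Measure.map_apply (by fun_prop) measurableSet_Iic]
  have : (fun x : ℝ => 1 - x) ⁻¹' Set.Iic x = Set.Ici (1 - x) := by
    ext y; simp only [Set.mem_preimage, Set.mem_Iic, Set.mem_Ici]
    constructor <;> intro <;> linarith
  rw [this, unitMeasure_Iic, ← Ioi_ae_eq_Ici.measure_eq, unitMeasure_Ioi]
  congr 1
  linarith [h.clamped_add x]

/-- The extension of `dG` to the half line: the translate of `dG` to `[K, K + 1]` carries the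
mass `2 ^ (-K - 1)`. For `G = ?` this is `dF`. -/
noncomputable def halfLineMeasure : Measure ℝ :=
  Measure.sum fun K : ℕ => ENNReal.ofReal ((1 / 2) ^ (K + 1)) •
    (unitMeasure h).map (fun x : ℝ => x + (K : ℝ))

theorem lintegral_halfLineMeasure {f : ℝ → ENNReal} (hf : Measurable f) :
    ∫⁻ x, f x ∂halfLineMeasure h =
      ∑' K : ℕ, ENNReal.ofReal ((1 / 2) ^ (K + 1)) * ∫⁻ x, f (x + K) ∂unitMeasure h := by
  rw [halfLineMeasure, lintegral_sum_measure]
  congr 1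
  ext K
  rw [lintegral_smul_measure, lintegral_map hf (by fun_prop), smul_eq_mul]

theorem halfLineMeasure_apply {s : Set ℝ} (hs : MeasurableSet s) :
    halfLineMeasure h s =
      ∑' K : ℕ, ENNReal.ofReal ((1 / 2) ^ (K + 1)) *
        unitMeasure h ((fun x => x + (K : ℝ)) ⁻¹' s) := by
  rw [halfLineMeasure, Measure.sum_apply _ hs]
  congr 1
  ext K
  rw [Measure.smul_apply, Measure.map_apply (by fun_prop) hs, smul_eq_mul]

theorem tsum_ofReal_half_pow : ∑' K : ℕ, ENNReal.ofReal ((1 / 2) ^ (K + 1)) = 1 := by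
  rw [← ENNReal.ofReal_tsum_of_nonneg (fun _ => by positivity)]
  · rw [show ∑' K : ℕ, ((1 / 2 : ℝ) ^ (K + 1)) = 1 by
      simp_rw [pow_succ]; rw [tsum_mul_right, tsum_geometric_two]; norm_num]
    simp
  · exact (summable_nat_add_iff 1).2 summable_geometric_two

instance : IsProbabilityMeasure (halfLineMeasure h) where
  measure_univ := by
    rw [halfLineMeasure_apply h MeasurableSet.univ]
    simp only [Set.preimage_univ, measure_univ, mul_one]
    exact tsum_ofReal_half_pow

theorem halfLineMeasure_Ioi_of_nonpos {x : ℝ} (hx : x ≤ 0) : halfLineMeasure h (Set.Ioi x) = 1 := by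
  rw [halfLineMeasure_apply h measurableSet_Ioi, ← tsum_ofReal_half_pow]
  congr 1; ext K
  have : (fun y : ℝ => y + (K : ℝ)) ⁻¹' Set.Ioi x = Set.Ioi (x - K) := by
    ext y; simp only [Set.mem_preimage, Set.mem_Ioi]; constructor <;> intro <;> linarith
  rw [this, unitMeasure_Ioi, h.clamped_of_nonpos (by have : (0 : ℝ) ≤ K := K.cast_nonneg
                                                     linarith)]
  simp

theorem halfLineMeasure_Ioi (x : ℝ) : halfLineMeasure h (Set.Ioi x) =
    ENNReal.ofReal (1 / 2) * (ENNReal.ofReal (1 - clamped G x) +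
      halfLineMeasure h (Set.Ioi (x - 1))) := by
  rw [halfLineMeasure_apply h measurableSet_Ioi, tsum_eq_zero_add' ENNReal.summable,
    halfLineMeasure_apply h measurableSet_Ioi, mul_add, ← ENNReal.tsum_mul_left]
  congr 1
  · simp only [zero_add, pow_one, Nat.cast_zero, add_zero, Set.preimage_id']
    rw [unitMeasure_Ioi]
  · congr 1; ext K
    rw [pow_succ, ENNReal.ofReal_mul (by positivity), mul_comm (ENNReal.ofReal _), mul_assoc]
    congr 3
    ext y; simp only [Set.mem_preimage, Set.mem_Ioi]; push_cast; constructor <;> intro <;> linarith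

/-- The tails of the extended distribution. -/
theorem halfLineMeasure_Ioi_add (K : ℕ) {t : ℝ} (ht : t ∈ Set.Icc (0 : ℝ) 1) :
    halfLineMeasure h (Set.Ioi (K + t)) = ENNReal.ofReal ((1 / 2) ^ K * (1 - G t / 2)) := by
  have hG : G t ≤ 1 := by
    have := h.mono ht ⟨zero_le_one, le_rfl⟩ ht.2
    rwa [h.one] at this
  induction K with
  | zero =>
    rw [halfLineMeasure_Ioi, Nat.cast_zero, zero_add,
      halfLineMeasure_Ioi_of_nonpos h (by linarith [ht.2]), clamped_of_mem ht,
      ← ENNReal.ofReal_one, ← ENNReal.ofReal_add (by linarith) zero_le_one,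
      ← ENNReal.ofReal_mul (by norm_num)]
    congr 1; ring
  | succ K ih =>
    have hK : (0 : ℝ) ≤ K := K.cast_nonneg
    rw [halfLineMeasure_Ioi, h.clamped_of_one_le (by push_cast; linarith [ht.1]),
      show ((K + 1 : ℕ) : ℝ) + t - 1 = K + t by push_cast; ring, ih, sub_self, ENNReal.ofReal_zero,
      zero_add, ← ENNReal.ofReal_mul (by norm_num)]
    congr 1; ring

theorem ae_pos_halfLineMeasure : ∀ᵐ x ∂halfLineMeasure h, 0 < x := by
  rw [halfLineMeasure, Measure.ae_sum_iff]
  intro K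
  refine Measure.ae_smul_measure ?_ _
  rw [ae_map_iff (by fun_prop) measurableSet_Ioi]
  filter_upwards [ae_pos_unitMeasure h] with x hx
  positivity

instance : NullSingletonClass (halfLineMeasure h) where
  measure_singleton x := by
    rw [halfLineMeasure_apply h (measurableSet_singleton x), ENNReal.tsum_eq_zero]
    intro K
    have : (fun y : ℝ => y + (K : ℝ)) ⁻¹' {x} = {x - K} := by
      ext y; simp only [Set.mem_preimage, Set.mem_singleton_iff]
      constructor <;> intro <;> linarith
    rw [this, measure_singleton, mul_zero]

/-- Integrability for the extended distribution, from bounds on the intervals `[K, K + 1]`. -/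
theorem integrable_halfLineMeasure {f : ℝ → ℝ} (hf : Measurable f) (B : ℕ → ℝ)
    (hB : ∀ K : ℕ, ∀ x ∈ Set.Ioc (0 : ℝ) 1, |f (x + K)| ≤ B K)
    (hs : Summable fun K : ℕ => (1 / 2) ^ (K + 1) * B K) :
    Integrable f (halfLineMeasure h) ∧
      HasSum (fun K : ℕ => (1 / 2) ^ (K + 1) * ∫ x, f (x + K) ∂unitMeasure h)
        (∫ x, f x ∂halfLineMeasure h) := by
  have hB0 : ∀ K, 0 ≤ B K := fun K => (abs_nonneg _).trans (hB K 1 ⟨one_pos, le_rfl⟩)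
  have hint : Integrable f (halfLineMeasure h) := by
    refine ⟨hf.aestronglyMeasurable, ?_⟩
    rw [hasFiniteIntegral_iff_norm, lintegral_halfLineMeasure h (by fun_prop)]
    refine lt_of_le_of_lt (b := ∑' K : ℕ, ENNReal.ofReal ((1 / 2) ^ (K + 1) * B K)) ?_ ?_
    · refine ENNReal.tsum_le_tsum fun K => ?_
      rw [ENNReal.ofReal_mul (by positivity)]
      gcongr
      calc ∫⁻ x, ENNReal.ofReal ‖f (x + K)‖ ∂unitMeasure h
          ≤ ∫⁻ _, ENNReal.ofReal (B K) ∂unitMeasure h := by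
            refine lintegral_mono_ae ?_
            filter_upwards [ae_mem_unitMeasure h, ae_pos_unitMeasure h] with x hx hx0
            exact ENNReal.ofReal_le_ofReal (hB K x ⟨hx0, hx.2⟩)
        _ = _ := by simp
    · rw [← ENNReal.ofReal_tsum_of_nonneg (fun K => mul_nonneg (by positivity) (hB0 K)) hs]
      exact ENNReal.ofReal_lt_top
  refine ⟨hint, ?_⟩
  have := hasSum_integral_measure (f := f) (by rw [← halfLineMeasure]; exact hint)
  rw [← halfLineMeasure] at this
  have e : ∀ K : ℕ, ∫ x, f x ∂(ENNReal.ofReal ((1 / 2) ^ (K + 1)) •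
      (unitMeasure h).map (fun x : ℝ => x + (K : ℝ))) =
        (1 / 2) ^ (K + 1) * ∫ x, f (x + K) ∂unitMeasure h := fun K => by
    rw [integral_smul_measure, integral_map (by fun_prop) hf.aestronglyMeasurable,
      ENNReal.toReal_ofReal (by positivity), smul_eq_mul]
  simpa only [e] using this

/-! ### The measure `dF` -/

theorem extQuestion_of_nonneg {x : ℝ} (hx : 0 ≤ x) : extQuestion x = question (x / (x + 1)) := by
  rw [extQuestion, max_eq_left hx]

theorem div_add_one_mem {x : ℝ} (hx : 0 ≤ x) : x / (x + 1) ∈ Set.Icc (0 : ℝ) 1 :=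
  ⟨by positivity, (div_le_one (by positivity)).2 (by linarith)⟩

theorem extQuestion_continuous : Continuous extQuestion := by
  refine question_continuousOn.comp_continuous ?_ fun x => div_add_one_mem (le_max_right _ _)
  refine Continuous.div (by fun_prop) (by fun_prop) fun x => ?_
  have := le_max_right x 0
  positivity

theorem extQuestion_add_inv {x : ℝ} (hx : 0 < x) : extQuestion x + extQuestion x⁻¹ = 1 := by
  have e : x⁻¹ / (x⁻¹ + 1) = 1 - x / (x + 1) := by field_simp; ring
  rw [extQuestion_of_nonneg hx.le, extQuestion_of_nonneg (by positivity), e,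
    question_add_question_one_sub (div_add_one_mem hx.le)]

theorem extQuestion_of_le_one {x : ℝ} (h0 : 0 ≤ x) (h1 : x ≤ 1) :
    extQuestion x = question x / 2 := by
  have h2 : x / (x + 1) ≤ 1 / 2 := by rw [div_le_div_iff₀ (by positivity) two_pos]; linarith
  have h3 : x / (x + 1) / (1 - x / (x + 1)) = x := by field_simp; simp
  have := question_div_one_sub (div_add_one_mem h0).1 h2
  rw [h3] at this
  rw [extQuestion_of_nonneg h0, this]; ring

theorem extQuestion_add_one {x : ℝ} (h0 : 0 ≤ x) :
    1 - extQuestion (x + 1) = (1 - extQuestion x) / 2 := by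
  have e1 := extQuestion_add_inv (x := x + 1) (by positivity)
  have e2 := extQuestion_of_le_one (x := (x + 1)⁻¹) (by positivity)
    (inv_le_one_of_one_le₀ (by linarith))
  have e3 := question_add_question_one_sub (div_add_one_mem h0)
  rw [extQuestion_of_nonneg h0]
  have e4 : 1 - x / (x + 1) = (x + 1)⁻¹ := by field_simp; ring
  rw [e4] at e3
  linarith

theorem one_sub_extQuestion_add (K : ℕ) {t : ℝ} (ht : t ∈ Set.Icc (0 : ℝ) 1) :
    1 - extQuestion (K + t) = (1 / 2) ^ K * (1 - question t / 2) := by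
  induction K with
  | zero => simp [extQuestion_of_le_one ht.1 ht.2]
  | succ K ih =>
    have : (0 : ℝ) ≤ K + t := add_nonneg K.cast_nonneg ht.1
    rw [show ((K + 1 : ℕ) : ℝ) + t = (K + t) + 1 by push_cast; ring, extQuestion_add_one this, ih]
    ring

theorem halfLineMeasure_question_Ioi {x : ℝ} (hx : 0 ≤ x) :
    halfLineMeasure isSymmDist_question (Set.Ioi x) = ENNReal.ofReal (1 - extQuestion x) := by
  have ht : Int.fract x ∈ Set.Icc (0 : ℝ) 1 := ⟨Int.fract_nonneg _, (Int.fract_lt_one _).le⟩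
  have e : x = (⌊x⌋₊ : ℝ) + Int.fract x := by
    rw [natCast_floor_eq_intCast_floor hx, Int.floor_add_fract]
  rw [e, halfLineMeasure_Ioi_add _ _ ht, one_sub_extQuestion_add _ ht]

theorem extQuestion_stieltjes (x : ℝ) :
    extQuestion_monotone.stieltjesFunction x = extQuestion x := by
  rw [Monotone.stieltjesFunction_eq]
  exact extQuestion_continuous.continuousWithinAt.rightLim_eq

theorem extMeasure_eq : extMeasure = halfLineMeasure isSymmDist_question := by
  have htop : Tendsto extQuestion_monotone.stieltjesFunction atTop (𝓝 1) := by
    have hc : Tendsto (fun x : ℝ => x⁻¹) atTop (𝓝 0) := tendsto_inv_atTop_zero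
    have := (extQuestion_continuous.tendsto 0).comp hc
    have h0 : extQuestion 0 = 0 := by simp [extQuestion, question_zero]
    rw [h0] at this
    have := this.const_sub 1
    rw [sub_zero] at this
    refine this.congr' ?_
    filter_upwards [eventually_gt_atTop 0] with x hx
    rw [extQuestion_stieltjes, Function.comp]
    linarith [extQuestion_add_inv hx]
  have hneg : ∀ x ≤ 0, extQuestion x = 0 := fun x hx => by
    simp [extQuestion, max_eq_right hx, question_zero]
  have hbot : Tendsto extQuestion_monotone.stieltjesFunction atBot (𝓝 0) := by
    refine tendsto_const_nhds.congr' ?_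
    filter_upwards [eventually_le_atBot 0] with y hy
    rw [extQuestion_stieltjes, hneg y hy]
  have : IsProbabilityMeasure extMeasure := StieltjesFunction.isProbabilityMeasure _ hbot htop
  refine Measure.ext_of_Iic _ _ fun x => ?_
  have key : extMeasure (Set.Ioi x) = halfLineMeasure isSymmDist_question (Set.Ioi x) := by
    rw [extMeasure, StieltjesFunction.measure_Ioi _ htop, extQuestion_stieltjes]
    rcases le_total x 0 with hx | hx
    · rw [halfLineMeasure_Ioi_of_nonpos _ hx, hneg x hx]; simp
    · rw [halfLineMeasure_question_Ioi hx]
  rw [← Set.compl_Ioi, prob_compl_eq_one_sub measurableSet_Ioi,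
    prob_compl_eq_one_sub measurableSet_Ioi, key]

/-- The functional equation `F(x) + F(1 / x) = 1`, for the measure `dF`. -/
theorem halfLineMeasure_question_Iic {x : ℝ} (hx : 0 < x) :
    halfLineMeasure isSymmDist_question (Set.Iic x) =
      halfLineMeasure isSymmDist_question (Set.Ici x⁻¹) := by
  rw [← Ioi_ae_eq_Ici.measure_eq, ← Set.compl_Ioi, prob_compl_eq_one_sub measurableSet_Ioi,
    halfLineMeasure_question_Ioi hx.le, halfLineMeasure_question_Ioi (by positivity),
    ← extQuestion_add_inv hx, ← ENNReal.ofReal_one, ← ENNReal.ofReal_sub, ← extQuestion_add_inv hx]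
  · congr 1; ring
  · linarith [(question_mem (div_add_one_mem (x := x⁻¹) (by positivity))).1,
      extQuestion_of_nonneg (x := x⁻¹) (by positivity)]

/-- If the extension of `dG` to the half line is invariant under inversion, then `G` satisfies
the recursion of the question mark function, which has only one bounded solution. -/
theorem eqOn_question_of_inv_invariant
    (hinv : ∀ x : ℝ, 0 < x → halfLineMeasure h (Set.Iic x) = halfLineMeasure h (Set.Ici x⁻¹)) :
    Set.EqOn G question (Set.Icc 0 1) := by
  have hG01 : ∀ t ∈ Set.Icc (0 : ℝ) 1, G t ∈ Set.Icc (0 : ℝ) 1 := fun t ht => by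
    have h1 := h.mono ht ⟨zero_le_one, le_rfl⟩ ht.2
    have h2 := h.mono ⟨le_rfl, zero_le_one⟩ ht ht.1
    rw [h.one] at h1; rw [h.zero] at h2
    exact ⟨h2, h1⟩
  have hrec : ∀ x : ℝ, 0 < x → x ≤ 1 → G x = (1 / 2) ^ ⌊x⁻¹⌋₊ * (2 - G (gaussMap x)) := by
    intro x h0 h1
    have e1 := hinv x h0
    have hx : x ∈ Set.Icc (0 : ℝ) 1 := ⟨h0.le, h1⟩
    have e2 := halfLineMeasure_Ioi_add h 0 hx
    have e3 := halfLineMeasure_Ioi_add h ⌊x⁻¹⌋₊ (gaussMap_mem (x := x))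
    have e : (⌊x⁻¹⌋₊ : ℝ) + gaussMap x = x⁻¹ := by
      rw [gaussMap, natCast_floor_eq_intCast_floor (by positivity), Int.floor_add_fract]
    have hg := hG01 _ (gaussMap_mem (x := x))
    have hgx := hG01 _ hx
    rw [e] at e3
    rw [Nat.cast_zero, zero_add, pow_zero, one_mul] at e2
    rw [← Ioi_ae_eq_Ici.measure_eq, ← Set.compl_Ioi, prob_compl_eq_one_sub measurableSet_Ioi,
      e2, e3, ← ENNReal.ofReal_one, ← ENNReal.ofReal_sub _ (by linarith [hgx.2]),
      ENNReal.ofReal_eq_ofReal_iff (by linarith [hgx.1])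
        (mul_nonneg (by positivity) (by linarith [hg.2]))] at e1
    linarith
  have key : ∀ k : ℕ, ∀ x ∈ Set.Icc (0 : ℝ) 1, |G x - question x| ≤ (1 / 2) ^ k := by
    intro k
    induction k with
    | zero =>
      intro x hx
      have a := hG01 x hx
      have b := question_mem hx
      rw [pow_zero, abs_le]; constructor <;> linarith [a.1, a.2, b.1, b.2]
    | succ k ih =>
      intro x hx
      rcases hx.1.eq_or_lt with h' | h'
      · rw [← h', h.zero, question_zero]; simp
      · rw [hrec x h' hx.2, question_rec h' hx.2, ← mul_sub, abs_mul, abs_of_nonneg (by positivity),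
          pow_succ', show 2 - G (gaussMap x) - (2 - question (gaussMap x)) =
            -(G (gaussMap x) - question (gaussMap x)) by ring, abs_neg]
        exact mul_le_mul (half_pow_floor_le h' hx.2) (ih _ gaussMap_mem) (abs_nonneg _)
          (by norm_num)
  intro x hx
  have hl : Tendsto (fun k : ℕ => (1 / 2 : ℝ) ^ k) atTop (𝓝 0) :=
    tendsto_pow_atTop_nhds_zero_of_lt_one (by norm_num) (by norm_num)
  have := ge_of_tendsto' hl fun k => key k x hx
  exact sub_eq_zero.1 (abs_eq_zero.1 (le_antisymm this (abs_nonneg _)))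

end

section

/-! ### Taylor remainders of the exponential function -/

/-- The remainder of the Taylor series of `exp` after the terms of degree `< N`. -/
noncomputable def expRem (N : ℕ) (u : ℝ) : ℝ :=
  Real.exp u - ∑ k ∈ Finset.range N, u ^ k / k.factorial

theorem hasDerivAt_expRem_succ (N : ℕ) (u : ℝ) :
    HasDerivAt (expRem (N + 1)) (expRem N u) u := by
  have h : ∀ k ∈ Finset.range N, HasDerivAt (fun u : ℝ => u ^ (k + 1) / (k + 1).factorial)
      (u ^ k / k.factorial) u := fun k _ => by
    have := (hasDerivAt_pow (k + 1) u).div_const ((k + 1).factorial : ℝ)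
    refine this.congr_deriv ?_
    rw [Nat.factorial_succ, Nat.add_sub_cancel]
    push_cast
    field_simp
  have h2 := (Real.hasDerivAt_exp u).sub ((HasDerivAt.fun_sum h).add_const (1 : ℝ))
  refine h2.congr_of_eventuallyEq (.of_forall fun v => ?_)
  simp [expRem, Finset.sum_range_succ']

theorem expRem_succ_zero (N : ℕ) : expRem (N + 1) 0 = 0 := by
  simp [expRem, Finset.sum_range_succ']

/-- On either half line (`σ = 1` or `σ = -1`) the remainder has constant sign. By this, one-sided
control of the integral of a remainder controls the integral of its absolute value. -/
theorem sign_mul_expRem_mem {σ : ℝ} (hσ : σ * σ = 1) (N : ℕ) : ∀ {u : ℝ}, 0 ≤ u →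
    0 ≤ σ ^ N * expRem N (σ * u) ∧
      σ ^ N * expRem N (σ * u) ≤ u ^ N * Real.exp (max σ 0 * u) := by
  induction N with
  | zero =>
    intro u hu
    simp only [expRem, Finset.range_zero, Finset.sum_empty, sub_zero, pow_zero, one_mul]
    exact ⟨(Real.exp_pos _).le, Real.exp_le_exp.2 (mul_le_mul_of_nonneg_right (le_max_left _ _) hu)⟩
  | succ N ih =>
    have hd : ∀ u : ℝ, HasDerivAt (fun u => σ ^ (N + 1) * expRem (N + 1) (σ * u))
        (σ ^ N * expRem N (σ * u)) u := fun u => by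
      have h1 : HasDerivAt (fun u : ℝ => σ * u) σ u := by
        simpa using (hasDerivAt_id u).const_mul σ
      have := ((hasDerivAt_expRem_succ N (σ * u)).comp u h1).const_mul (σ ^ (N + 1))
      refine this.congr_deriv ?_
      rw [pow_succ]
      linear_combination σ ^ N * expRem N (σ * u) * hσ
    set c := max σ 0 with hc
    have hc0 : 0 ≤ c := le_max_right _ _
    have hd2 : ∀ u : ℝ, HasDerivAt (fun u => u ^ (N + 1) * Real.exp (c * u))
        (((N + 1 : ℕ) : ℝ) * u ^ N * Real.exp (c * u) + u ^ (N + 1) * (Real.exp (c * u) * c)) u :=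
      fun u => by
        have h1 : HasDerivAt (fun u : ℝ => c * u) c u := by
          simpa using (hasDerivAt_id u).const_mul c
        exact (hasDerivAt_pow (N + 1) u).mul h1.exp
    have m1 : MonotoneOn (fun u => σ ^ (N + 1) * expRem (N + 1) (σ * u)) (Set.Ici 0) := by
      refine monotoneOn_of_deriv_nonneg (convex_Ici 0)
        (fun u _ => (hd u).continuousAt.continuousWithinAt)
        (fun u _ => (hd u).differentiableAt.differentiableWithinAt) fun u hu => ?_
      rw [interior_Ici] at hu
      rw [(hd u).deriv]
      exact (ih (le_of_lt hu)).1
    have m2 : MonotoneOn (fun u => u ^ (N + 1) * Real.exp (c * u) -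
        σ ^ (N + 1) * expRem (N + 1) (σ * u)) (Set.Ici 0) := by
      refine monotoneOn_of_deriv_nonneg (convex_Ici 0)
        (fun u _ => ((hd2 u).sub (hd u)).continuousAt.continuousWithinAt)
        (fun u _ => ((hd2 u).sub (hd u)).differentiableAt.differentiableWithinAt) fun u hu => ?_
      rw [interior_Ici] at hu
      have hu' : (0 : ℝ) ≤ u := le_of_lt hu
      have e := ((hd2 u).sub (hd u)).deriv
      simp only [Pi.sub_def] at e
      rw [e]
      have := (ih hu').2
      have h3 : u ^ N * Real.exp (c * u) ≤ ((N + 1 : ℕ) : ℝ) * u ^ N * Real.exp (c * u) := by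
        have : (0 : ℝ) ≤ N * (u ^ N * Real.exp (c * u)) := by positivity
        push_cast; linarith
      have h4 : 0 ≤ u ^ (N + 1) * (Real.exp (c * u) * c) := by positivity
      linarith
    intro u hu
    have a := m1 (Set.mem_Ici.2 le_rfl) (Set.mem_Ici.2 hu) hu
    have b := m2 (Set.mem_Ici.2 le_rfl) (Set.mem_Ici.2 hu) hu
    simp only [mul_zero, expRem_succ_zero, ne_eq, Nat.add_eq_zero_iff, one_ne_zero, and_false,
      not_false_eq_true, zero_pow, zero_mul, sub_zero] at a b
    exact ⟨a, by linarith⟩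

theorem abs_expRem_le (N : ℕ) (u : ℝ) : |expRem N u| ≤ |u| ^ N * max 1 (Real.exp u) := by
  rcases le_total 0 u with h | h
  · have := sign_mul_expRem_mem (σ := 1) (by norm_num) N h
    simp only [one_pow, one_mul, max_eq_left (zero_le_one' ℝ)] at this
    rw [abs_of_nonneg this.1, abs_of_nonneg h]
    exact this.2.trans (mul_le_mul_of_nonneg_left (le_max_right _ _) (by positivity))
  · have := sign_mul_expRem_mem (σ := -1) (by norm_num) N (neg_nonneg.2 h)
    rw [show max (-1 : ℝ) 0 = 0 by norm_num, zero_mul, Real.exp_zero, mul_one, neg_mul_neg,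
      one_mul] at this
    have e : |expRem N u| = (-1) ^ N * expRem N u := by
      rw [← abs_of_nonneg this.1, abs_mul, abs_pow, abs_neg, abs_one, one_pow, one_mul]
    rw [e, abs_of_nonpos h]
    exact this.2.trans (le_mul_of_one_le_right (pow_nonneg (neg_nonneg.2 h) _) (le_max_left _ _))

/-- The Taylor expansion of `s ↦ x ^ s` at `0`, with remainder. -/
theorem abs_rpow_sub_sum_le (N : ℕ) {x s : ℝ} (hx : 0 < x) (hs : 0 ≤ s) :
    |x ^ s - ∑ k ∈ Finset.range N, Real.log x ^ k / k.factorial * s ^ k| ≤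
      |Real.log x| ^ N * max 1 (x ^ s) * s ^ N := by
  have := abs_expRem_le N (Real.log x * s)
  rw [expRem, ← Real.rpow_def_of_pos hx, abs_mul, mul_pow, abs_of_nonneg hs] at this
  calc _ = |x ^ s - ∑ k ∈ Finset.range N, (Real.log x * s) ^ k / k.factorial| := by
        congr 2; refine Finset.sum_congr rfl fun k _ => ?_
        rw [mul_pow]; ring
    _ ≤ _ := by linarith

/-! ### Asymptotic expansions at `0` from the right -/

/-- The function `f` has the asymptotic expansion `p` as its argument tends to `0` from the
right. -/
def HasExpansion (f : ℝ → ℝ) (p : PowerSeries ℝ) : Prop :=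
  ∀ N : ℕ, (fun s => f s - ∑ k ∈ Finset.range N, PowerSeries.coeff k p * s ^ k)
    =O[𝓝[>] 0] fun s => s ^ N

namespace HasExpansion

variable {f g : ℝ → ℝ} {p q : PowerSeries ℝ}

theorem congr' (hf : HasExpansion f p) (h : f =ᶠ[𝓝[>] 0] g) : HasExpansion g p := fun N =>
  (hf N).congr' (h.mono fun s hs => by simp only [hs]) EventuallyEq.rfl

theorem of_bound {δ : ℝ} (hδ : 0 < δ) (C : ℕ → ℝ) (h : ∀ N : ℕ, ∀ s : ℝ, 0 < s → s ≤ δ →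
    |f s - ∑ k ∈ Finset.range N, PowerSeries.coeff k p * s ^ k| ≤ C N * s ^ N) :
    HasExpansion f p := fun N => by
  refine Asymptotics.IsBigO.of_bound (C N) ?_
  filter_upwards [Ioc_mem_nhdsGT hδ] with s hs
  rw [Real.norm_eq_abs, Real.norm_eq_abs, abs_of_nonneg (pow_nonneg hs.1.le N)]
  exact h N s hs.1 hs.2

theorem add (hf : HasExpansion f p) (hg : HasExpansion g q) :
    HasExpansion (fun s => f s + g s) (p + q) := fun N => by
  refine ((hf N).add (hg N)).congr_left fun s => ?_
  simp only [map_add, add_mul, Finset.sum_add_distrib]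
  ring

theorem sub (hf : HasExpansion f p) (hg : HasExpansion g q) :
    HasExpansion (fun s => f s - g s) (p - q) := fun N => by
  refine ((hf N).sub (hg N)).congr_left fun s => ?_
  simp only [map_sub, sub_mul, Finset.sum_sub_distrib]
  ring

theorem eval_trunc (N : ℕ) (p : PowerSeries ℝ) (s : ℝ) :
    (PowerSeries.trunc N p).eval s = ∑ k ∈ Finset.range N, PowerSeries.coeff k p * s ^ k := by
  have := PowerSeries.eval₂_trunc_eq_sum_range s (RingHom.id ℝ) N p
  simpa using this

theorem isBigO_eval_of_dvd {N : ℕ} {P : Polynomial ℝ} (h : Polynomial.X ^ N ∣ P) :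
    (fun s => P.eval s) =O[𝓝[>] 0] fun s : ℝ => s ^ N := by
  obtain ⟨Q, rfl⟩ := h
  have : (fun s : ℝ => Q.eval s) =O[𝓝[>] 0] fun _ => (1 : ℝ) :=
    (Q.continuous.tendsto 0 |>.mono_left nhdsWithin_le_nhds).isBigO_one ℝ
  simpa using (Asymptotics.isBigO_refl (fun s : ℝ => s ^ N) _).mul this

theorem ofPolynomial (P : Polynomial ℝ) : HasExpansion (fun s => P.eval s) (P : PowerSeries ℝ) := by
  intro N
  have h : Polynomial.X ^ N ∣ P - PowerSeries.trunc N (P : PowerSeries ℝ) := by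
    rw [Polynomial.X_pow_dvd_iff]
    intro d hd
    simp [PowerSeries.coeff_trunc, hd]
  refine (isBigO_eval_of_dvd h).congr_left fun s => ?_
  rw [Polynomial.eval_sub, eval_trunc]

theorem const (c : ℝ) : HasExpansion (fun _ => c) (PowerSeries.C c) := by
  simpa using ofPolynomial (Polynomial.C c)

theorem id : HasExpansion (fun s => s) PowerSeries.X := by
  simpa using ofPolynomial Polynomial.X

theorem mul (hf : HasExpansion f p) (hg : HasExpansion g q) :
    HasExpansion (fun s => f s * g s) (p * q) := fun N => by
  have hb : ∀ p : PowerSeries ℝ, (fun s => (PowerSeries.trunc N p).eval s) =O[𝓝[>] 0]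
      fun _ : ℝ => (1 : ℝ) := fun p =>
    ((PowerSeries.trunc N p).continuous.tendsto 0 |>.mono_left nhdsWithin_le_nhds).isBigO_one ℝ
  have hg1 : g =O[𝓝[>] 0] fun _ : ℝ => (1 : ℝ) := by simpa using hg 0
  have h1 := (hf N).mul hg1
  have h2 := (hb p).mul (hg N)
  have h3 : (fun s => (PowerSeries.trunc N p * PowerSeries.trunc N q -
      PowerSeries.trunc N (p * q)).eval s) =O[𝓝[>] 0] fun s : ℝ => s ^ N := by
    refine isBigO_eval_of_dvd ?_
    rw [Polynomial.X_pow_dvd_iff]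
    intro d hd
    rw [Polynomial.coeff_sub, PowerSeries.coeff_trunc, if_pos hd, PowerSeries.coeff_mul,
      Polynomial.coeff_mul, sub_eq_zero]
    refine Finset.sum_congr rfl fun x hx => ?_
    have := Finset.HasAntidiagonal.mem_antidiagonal.1 hx
    rw [PowerSeries.coeff_trunc, PowerSeries.coeff_trunc, if_pos (by omega), if_pos (by omega)]
  simp only [mul_one, one_mul] at h1 h2
  refine ((h1.add h2).add h3).congr_left fun s => ?_
  simp only [Polynomial.eval_sub, Polynomial.eval_mul, ← eval_trunc]
  ring

theorem const_mul (hf : HasExpansion f p) (c : ℝ) :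
    HasExpansion (fun s => c * f s) (PowerSeries.C c * p) := (const c).mul hf

/-- The coefficients of an expansion are limits of the rescaled remainders. -/
theorem tendsto (hf : HasExpansion f p) (N : ℕ) :
    Tendsto (fun s => (f s - ∑ k ∈ Finset.range N, PowerSeries.coeff k p * s ^ k) / s ^ N)
      (𝓝[>] 0) (𝓝 (PowerSeries.coeff N p)) := by
  have h1 : (fun s => (f s - ∑ k ∈ Finset.range (N + 1), PowerSeries.coeff k p * s ^ k) / s ^ N)
      =O[𝓝[>] 0] fun s => s := by
    refine ((hf (N + 1)).mul (Asymptotics.isBigO_refl (fun s : ℝ => (s ^ N)⁻¹) _)).congr' ?_ ?_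
    · exact .of_forall fun s => (div_eq_mul_inv _ _).symm
    · filter_upwards [self_mem_nhdsWithin] with s hs
      have : s ≠ 0 := ne_of_gt hs
      field_simp
      ring
  have h2 : Tendsto (fun s : ℝ => s) (𝓝[>] 0) (𝓝 0) := nhdsWithin_le_nhds
  have h3 := (h1.trans_tendsto h2).add_const (PowerSeries.coeff N p)
  rw [zero_add] at h3
  refine h3.congr' ?_
  filter_upwards [self_mem_nhdsWithin] with s hs
  have : s ≠ 0 := ne_of_gt hs
  rw [Finset.sum_range_succ]
  field_simp
  ring

theorem unique (hp : HasExpansion f p) (hq : HasExpansion f q) : p = q := by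
  ext N
  induction N using Nat.strong_induction_on with
  | _ N ih =>
    refine tendsto_nhds_unique (hp.tendsto N) ((hq.tendsto N).congr fun s => ?_)
    congr 2
    exact Finset.sum_congr rfl fun k hk => by rw [ih k (Finset.mem_range.1 hk)]

theorem of_hasSum (h : ∀ᶠ s in 𝓝 (0 : ℝ), HasSum (fun k => PowerSeries.coeff k p * s ^ k) (f s)) :
    HasExpansion f p := fun N => by
  have hP : HasFPowerSeriesAt f
      (FormalMultilinearSeries.ofScalars ℝ fun k => PowerSeries.coeff k p) 0 := by
    rw [hasFPowerSeriesAt_iff]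
    filter_upwards [h] with s hs
    simpa [FormalMultilinearSeries.coeff_ofScalars, mul_comm] using hs
  have := hP.isBigO_sub_partialSum_pow N
  simp only [zero_add] at this
  have h2 := this.mono (nhdsWithin_le_nhds (s := Set.Ioi 0))
  refine (h2.congr_left fun s => ?_).trans (Asymptotics.IsBigO.of_bound 1 ?_)
  · rw [FormalMultilinearSeries.partialSum]
    congr 1
    refine Finset.sum_congr rfl fun k _ => ?_
    simp [mul_comm]
  · exact .of_forall fun s => by simp

/-- The expansion of a function that is analytic at the origin of the expansion. -/
theorem of_analyticAt {a : ℝ} (h : AnalyticAt ℝ f a) : HasExpansion (fun s => f (a + s))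
    (PowerSeries.mk fun k => iteratedDeriv k f a / k.factorial) := by
  refine of_hasSum ?_
  have := hasFPowerSeriesAt_iff.1 h.hasFPowerSeriesAt
  filter_upwards [this] with s hs
  simpa [FormalMultilinearSeries.coeff_ofScalars, mul_comm] using hs

theorem rpow {c : ℝ} (hc : 0 < c) : HasExpansion (fun s => c ^ s) (powSeries c) := by
  refine of_hasSum (.of_forall fun s => ?_)
  rw [Real.rpow_def_of_pos hc, Real.exp_eq_exp_ℝ]
  have := NormedSpace.expSeries_div_hasSum_exp (𝔸 := ℝ) (Real.log c * s)
  have e : (fun k => PowerSeries.coeff k (powSeries c) * s ^ k) =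
      fun k => (Real.log c * s) ^ k / k.factorial := funext fun k => by
    simp [powSeries, PowerSeries.coeff_rescale, PowerSeries.coeff_exp, mul_pow]
    ring
  rw [e]
  exact this

theorem sin_mul (c : ℝ) : HasExpansion (fun s => Real.sin (c * s))
    (PowerSeries.rescale c (PowerSeries.sin ℝ)) := by
  refine of_hasSum (.of_forall fun s => ?_)
  have := Real.hasSum_sin (c * s)
  have hinj : Function.Injective fun n : ℕ => 2 * n + 1 := fun a b hab => by simpa using hab
  rw [← hinj.hasSum_iff]
  · convert this using 2 with n
    have : ¬ Even (2 * n + 1) := by simp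
    have e : (2 * n + 1) / 2 = n := by omega
    simp [PowerSeries.sin, PowerSeries.coeff_rescale, mul_pow, e]
    ring
  · intro n hn
    have : Even n := by
      by_contra hne
      obtain ⟨k, hk⟩ := Nat.not_even_iff_odd.1 hne
      exact hn ⟨k, hk.symm⟩
    simp [PowerSeries.sin, PowerSeries.coeff_rescale, this]

end HasExpansion

/-- The explicit remainder of a series of functions with expansions. -/
theorem abs_tsum_sub_sum_le {f : ℕ → ℝ} {N : ℕ} {q : ℕ → ℕ → ℝ} {B : ℕ → ℝ} {s : ℝ}
    (hq : ∀ k, Summable fun n => q n k) (hB : Summable B)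
    (h : ∀ n, |f n - ∑ k ∈ Finset.range N, q n k * s ^ k| ≤ B n * s ^ N) :
    |∑' n, f n - ∑ k ∈ Finset.range N, (∑' n, q n k) * s ^ k| ≤ (∑' n, B n) * s ^ N := by
  have hs1 : Summable fun n => ∑ k ∈ Finset.range N, q n k * s ^ k :=
    summable_sum fun k _ => (hq k).mul_right _
  have hs2 : Summable fun n => f n - ∑ k ∈ Finset.range N, q n k * s ^ k :=
    Summable.of_norm_bounded (hB.mul_right (s ^ N)) h
  have hs3 : Summable f := by simpa using hs2.add hs1
  have e : ∑ k ∈ Finset.range N, (∑' n, q n k) * s ^ k =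
      ∑' n, ∑ k ∈ Finset.range N, q n k * s ^ k := by
    rw [Summable.tsum_finsetSum fun k _ => (hq k).mul_right _]
    exact Finset.sum_congr rfl fun k _ => tsum_mul_right.symm
  rw [e, ← hs3.tsum_sub hs1, ← tsum_mul_right, ← Real.norm_eq_abs]
  exact tsum_of_norm_bounded (hB.mul_right (s ^ N)).hasSum h

/-- Expansions may be summed if their remainders are summable. -/
theorem HasExpansion.tsum {f : ℕ → ℝ → ℝ} {q : ℕ → ℕ → ℝ} (B : ℕ → ℕ → ℝ) {δ : ℝ} (hδ : 0 < δ)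
    (hq : ∀ k, Summable fun n => q n k) (hB : ∀ N, Summable (B N))
    (h : ∀ N n s, 0 < s → s ≤ δ → |f n s - ∑ k ∈ Finset.range N, q n k * s ^ k| ≤ B N n * s ^ N) :
    HasExpansion (fun s => ∑' n, f n s) (PowerSeries.mk fun k => ∑' n, q n k) := by
  refine .of_bound hδ (fun N => ∑' n, B N n) fun N s h0 h1 => ?_
  simp only [PowerSeries.coeff_mk]
  exact abs_tsum_sub_sum_le hq (hB N) fun n => h N n s h0 h1

/-- The expansion of `∑ wₙ n ^ s`. -/
theorem HasExpansion.tsum_rpow {w : ℕ → ℝ} {δ : ℝ} (hδ : 0 < δ)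
    (hw : ∀ N : ℕ, Summable fun n : ℕ => |w n| * (Real.log (n + 1) ^ N * (n + 1 : ℝ) ^ δ)) :
    HasExpansion (fun s => ∑' n : ℕ, w n * (n + 1 : ℝ) ^ s)
      (PowerSeries.mk fun k => ∑' n : ℕ, w n * (Real.log (n + 1) ^ k / k.factorial)) := by
  have hn : ∀ n : ℕ, (1 : ℝ) ≤ n + 1 := fun n => by simp
  have hl : ∀ n : ℕ, 0 ≤ Real.log (n + 1) := fun n => Real.log_nonneg (hn n)
  refine .tsum (fun N n => |w n| * (Real.log (n + 1) ^ N * (n + 1 : ℝ) ^ δ)) hδ (fun k => ?_) hw ?_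
  · refine Summable.of_norm_bounded (hw k) fun n => ?_
    rw [norm_mul, Real.norm_eq_abs, Real.norm_eq_abs,
      abs_of_nonneg (div_nonneg (pow_nonneg (hl n) k) (by positivity))]
    refine mul_le_mul_of_nonneg_left ?_ (abs_nonneg _)
    have h1 : (1 : ℝ) ≤ (n + 1 : ℝ) ^ δ := Real.one_le_rpow (hn n) hδ.le
    have h2 : (1 : ℝ) ≤ k.factorial := by exact_mod_cast Nat.factorial_pos k
    calc _ ≤ Real.log (n + 1) ^ k := div_le_self (pow_nonneg (hl n) k) h2
      _ ≤ _ := le_mul_of_one_le_right (pow_nonneg (hl n) k) h1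
  · intro N n s h0 h1
    have := abs_rpow_sub_sum_le N (x := n + 1) (by linarith [hn n]) h0.le
    have e : w n * (n + 1 : ℝ) ^ s - ∑ k ∈ Finset.range N,
        w n * (Real.log (n + 1) ^ k / k.factorial) * s ^ k =
        w n * ((n + 1 : ℝ) ^ s - ∑ k ∈ Finset.range N, Real.log (n + 1) ^ k / k.factorial * s ^ k) := by
      rw [mul_sub, Finset.mul_sum]; simp only [mul_assoc]
    rw [e, abs_mul, mul_assoc]
    refine mul_le_mul_of_nonneg_left (this.trans ?_) (abs_nonneg _)
    rw [abs_of_nonneg (hl n)]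
    refine mul_le_mul_of_nonneg_right (mul_le_mul_of_nonneg_left ?_ (pow_nonneg (hl n) N))
      (by positivity)
    rw [max_eq_right (Real.one_le_rpow (hn n) h0.le)]
    exact Real.rpow_le_rpow_of_exponent_le (hn n) h1

/-! ### The expansions of `Γ(1 + s)`, `s ζ(1 + s)` and `H(s)` -/

theorem hasExpansion_Gamma :
    HasExpansion (fun s => Real.Gamma (1 + s)) (PowerSeries.mk gammaCoeff) := by
  have h : AnalyticAt ℂ Complex.Gamma ((1 : ℝ) : ℂ) := by
    refine DifferentiableOn.analyticAt (s := {z : ℂ | 0 < z.re}) (fun z hz => ?_) ?_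
    · refine (Complex.differentiableAt_Gamma z fun m hm => ?_).differentiableWithinAt
      have : (0 : ℝ) ≤ m := m.cast_nonneg
      rw [hm] at hz
      simp at hz
      linarith
    · exact (isOpen_lt continuous_const Complex.continuous_re).mem_nhds (by simp)
  have h2 := h.re_ofReal
  have e : (fun x : ℝ => (Complex.Gamma x).re) = Real.Gamma := by
    ext x; rw [Complex.Gamma_ofReal, Complex.ofReal_re]
  rw [e] at h2
  exact .of_analyticAt h2

theorem analyticAt_zeta :
    AnalyticAt ℂ (Function.update (fun s : ℂ => (s - 1) * riemannZeta s) 1 1) 1 := by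
  refine Complex.analyticAt_of_differentiable_on_punctured_nhds_of_continuousAt ?_ ?_
  · filter_upwards [self_mem_nhdsWithin] with s hs
    have : (fun s : ℂ => (s - 1) * riemannZeta s) =ᶠ[𝓝 s]
        Function.update (fun s : ℂ => (s - 1) * riemannZeta s) 1 1 := by
      filter_upwards [isOpen_ne.mem_nhds hs] with z hz
      rw [Function.update_of_ne hz]
    refine DifferentiableAt.congr_of_eventuallyEq ?_ this.symm
    exact (differentiableAt_id.sub_const 1).mul (differentiableAt_riemannZeta hs)
  · rw [continuousAt_update_same]
    exact riemannZeta_residue_one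

theorem hasExpansion_zeta :
    HasExpansion (fun s => s * (riemannZeta (1 + s)).re) (PowerSeries.mk zetaCoeff) := by
  have h : HasExpansion (fun s : ℝ => (Function.update (fun s : ℂ => (s - 1) * riemannZeta s) 1 1
      (1 + s)).re) (PowerSeries.mk zetaCoeff) := by
    refine .of_hasSum ?_
    have h1 := hasFPowerSeriesAt_iff.1 analyticAt_zeta.hasFPowerSeriesAt
    have h2 : Tendsto (fun s : ℝ => (s : ℂ)) (𝓝 0) (𝓝 0) := by
      simpa using Complex.continuous_ofReal.tendsto 0
    filter_upwards [h2.eventually h1] with s hs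
    have := Complex.hasSum_re hs
    have e : (fun k => PowerSeries.coeff k (PowerSeries.mk zetaCoeff) * s ^ k) = fun k : ℕ =>
        ((s : ℂ) ^ k • (FormalMultilinearSeries.ofScalars ℂ fun n => iteratedDeriv n
          (Function.update (fun s : ℂ => (s - 1) * riemannZeta s) 1 1) 1 /
            n.factorial).coeff k).re :=
      funext fun k => by
        rw [PowerSeries.coeff_mk, zetaCoeff, FormalMultilinearSeries.coeff_ofScalars, smul_eq_mul,
          ← Complex.ofReal_pow, Complex.re_ofReal_mul, mul_comm]
    rw [e]
    exact this
  refine h.congr' ?_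
  filter_upwards [self_mem_nhdsWithin] with s hs
  have hs' : (1 + s : ℂ) ≠ 1 := by simpa using ne_of_gt hs
  rw [Function.update_of_ne hs', add_sub_cancel_left, Complex.re_ofReal_mul]

/-- `H(s) = (2π)^{-(s+1)} Γ(s+1) sin(πs/2)`. -/
noncomputable def H (s : ℝ) : ℝ :=
  1 / (2 * Real.pi) * (2 * Real.pi)⁻¹ ^ s * Real.Gamma (1 + s) * Real.sin (Real.pi / 2 * s)

theorem hasExpansion_H : HasExpansion H HSeries :=
  (((HasExpansion.rpow (c := (2 * Real.pi)⁻¹) (by positivity)).const_mul _).mul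
    hasExpansion_Gamma).mul (HasExpansion.sin_mul _)

end

section

/-! ### Growth of logarithms -/

/-- The constant in `(log y)^N ≤ C y^{1/4}`. -/
noncomputable def logBound (N : ℕ) : ℝ := (4 * (N + 1)) ^ N

theorem logBound_nonneg (N : ℕ) : 0 ≤ logBound N := by unfold logBound; positivity

theorem log_pow_le (N : ℕ) {y : ℝ} (hy : 1 ≤ y) :
    Real.log y ^ N ≤ logBound N * y ^ (1 / 4 : ℝ) := by
  have hN : (0 : ℝ) < 4 * (N + 1) := by positivity
  have h1 := Real.log_le_rpow_div (x := y) (ε := (4 * (N + 1) : ℝ)⁻¹) (by linarith) (by positivity)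
  calc Real.log y ^ N ≤ (y ^ (4 * (N + 1) : ℝ)⁻¹ / (4 * (N + 1) : ℝ)⁻¹) ^ N :=
        pow_le_pow_left₀ (Real.log_nonneg hy) h1 N
    _ = logBound N * y ^ ((4 * (N + 1) : ℝ)⁻¹ * N) := by
        rw [div_inv_eq_mul, mul_pow, Real.rpow_mul (by linarith), Real.rpow_natCast, mul_comm,
          logBound]
    _ ≤ _ := by
        refine mul_le_mul_of_nonneg_left (Real.rpow_le_rpow_of_exponent_le hy ?_)
          (logBound_nonneg N)
        rw [inv_mul_le_iff₀ hN]; linarith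

theorem summable_geometric_mul_log_pow (N : ℕ) {δ : ℝ} (hδ : δ ≤ 1) :
    Summable fun K : ℕ => (1 / 2 : ℝ) ^ (K + 1) * (Real.log (K + 1) ^ N * (K + 1 : ℝ) ^ δ) := by
  have h1 : Summable fun K : ℕ => ((K : ℝ)) ^ 2 * (1 / 2 : ℝ) ^ K :=
    summable_pow_mul_geometric_of_norm_lt_one 2 (by norm_num)
  have h2 := ((summable_nat_add_iff 1).2 h1).mul_left (logBound N)
  have hK : ∀ K : ℕ, (1 : ℝ) ≤ K + 1 := fun K => by simp
  refine Summable.of_nonneg_of_le (fun K => ?_) (fun K => ?_) h2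
  · have := Real.log_nonneg (hK K); positivity
  · have h3 : (K + 1 : ℝ) ^ (1 / 4 : ℝ) * (K + 1 : ℝ) ^ δ ≤ (K + 1 : ℝ) ^ 2 := by
      rw [← Real.rpow_add (by positivity), ← Real.rpow_natCast]
      exact Real.rpow_le_rpow_of_exponent_le (hK K) (by norm_num; linarith)
    have h4 : Real.log (K + 1) ^ N * (K + 1 : ℝ) ^ δ ≤ logBound N * (K + 1 : ℝ) ^ 2 :=
      calc _ ≤ logBound N * (K + 1 : ℝ) ^ (1 / 4 : ℝ) * (K + 1 : ℝ) ^ δ :=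
            mul_le_mul_of_nonneg_right (log_pow_le N (hK K)) (by positivity)
        _ ≤ _ := by
            rw [mul_assoc]; exact mul_le_mul_of_nonneg_left h3 (logBound_nonneg N)
    push_cast
    calc _ ≤ (1 / 2 : ℝ) ^ (K + 1) * (logBound N * (K + 1 : ℝ) ^ 2) :=
          mul_le_mul_of_nonneg_left h4 (by positivity)
      _ = _ := by ring

theorem summable_geometric_mul_log (N : ℕ) :
    Summable fun K : ℕ => (1 / 2 : ℝ) ^ (K + 1) * Real.log (K + 1) ^ N := by
  simpa using summable_geometric_mul_log_pow N (δ := 0) (by norm_num)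

/-! ### Integrals of `1 - cos` against powers -/

/-- `∫_a^∞ (1 - cos 2πmx) (c x)^s dx / x²`. -/
noncomputable def cosMellin (a m c s : ℝ) : ℝ :=
  ∫ x in Set.Ioi a, (1 - Real.cos (2 * Real.pi * m * x)) * ((c * x) ^ s / x ^ 2)

/-- `∫_a^∞ (1 - cos 2πmx) (log (c x))^k dx / x²`. -/
noncomputable def cosLogMoment (a m c : ℝ) (k : ℕ) : ℝ :=
  ∫ x in Set.Ioi a, (1 - Real.cos (2 * Real.pi * m * x)) * (Real.log (c * x) ^ k / x ^ 2)

theorem one_sub_cos_mem (θ : ℝ) : 0 ≤ 1 - Real.cos θ ∧ 1 - Real.cos θ ≤ 2 :=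
  ⟨by linarith [Real.cos_le_one θ], by linarith [Real.neg_one_le_cos θ]⟩

theorem abs_one_sub_cos_mul_le (θ : ℝ) {y z : ℝ} (h : |y| ≤ z) :
    |(1 - Real.cos θ) * y| ≤ 2 * z := by
  rw [abs_mul, abs_of_nonneg (one_sub_cos_mem θ).1]
  exact mul_le_mul (one_sub_cos_mem θ).2 h (abs_nonneg _) zero_le_two

theorem integrableOn_rpow_neg {a : ℝ} (ha : 1 ≤ a) :
    IntegrableOn (fun x : ℝ => x ^ (-5 / 4 : ℝ)) (Set.Ioi a) :=
  integrableOn_Ioi_rpow_of_lt (by norm_num) (by linarith)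

theorem integral_rpow_neg_le {a : ℝ} (ha : 1 ≤ a) :
    ∫ x in Set.Ioi a, x ^ (-5 / 4 : ℝ) ≤ 4 := by
  rw [integral_Ioi_rpow_of_lt (by norm_num) (by linarith)]
  have : a ^ (-5 / 4 + 1 : ℝ) ≤ 1 := Real.rpow_le_one_of_one_le_of_nonpos ha (by norm_num)
  have e : (-5 / 4 + 1 : ℝ) = -1 / 4 := by norm_num
  rw [e] at *
  linarith

/-- The common majorant: `(log cx)^N (cx)^s / x² ≤ C c x^{-5/4}` for `s ≤ 1 / 2`. -/
theorem log_pow_mul_rpow_le (N : ℕ) {c x s : ℝ} (hc : 1 ≤ c) (hx : 1 ≤ x) (hs : s ≤ 1 / 2) :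
    |Real.log (c * x)| ^ N * (c * x) ^ s / x ^ 2 ≤ logBound N * c * x ^ (-5 / 4 : ℝ) := by
  have hcx : 1 ≤ c * x := one_le_mul_of_one_le_of_one_le hc hx
  have hx0 : 0 < x := by linarith
  rw [abs_of_nonneg (Real.log_nonneg hcx), div_le_iff₀ (by positivity)]
  calc Real.log (c * x) ^ N * (c * x) ^ s
      ≤ (logBound N * (c * x) ^ (1 / 4 : ℝ)) * (c * x) ^ (1 / 2 : ℝ) :=
        mul_le_mul (log_pow_le N hcx) (Real.rpow_le_rpow_of_exponent_le hcx hs) (by positivity)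
          (mul_nonneg (logBound_nonneg N) (by positivity))
    _ = logBound N * (c ^ (3 / 4 : ℝ) * x ^ (3 / 4 : ℝ)) := by
        rw [mul_assoc, ← Real.rpow_add (by positivity), Real.mul_rpow (by positivity) hx0.le]
        norm_num
    _ ≤ logBound N * (c * x ^ (3 / 4 : ℝ)) := by
        refine mul_le_mul_of_nonneg_left (mul_le_mul_of_nonneg_right ?_ (by positivity))
          (logBound_nonneg N)
        simpa using Real.rpow_le_rpow_of_exponent_le hc (by norm_num : (3 / 4 : ℝ) ≤ 1)
    _ = _ := by
        have : x ^ (3 / 4 : ℝ) = x ^ (-5 / 4 : ℝ) * x ^ 2 := by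
          rw [← Real.rpow_natCast, ← Real.rpow_add hx0]; norm_num
        rw [this]; ring

theorem integrableOn_of_le_rpow {a C : ℝ} (ha : 1 ≤ a) {f : ℝ → ℝ} (hf : Measurable f)
    (h : ∀ x, a < x → |f x| ≤ C * x ^ (-5 / 4 : ℝ)) : IntegrableOn f (Set.Ioi a) := by
  refine Integrable.mono' ((integrableOn_rpow_neg ha).const_mul C) hf.aestronglyMeasurable ?_
  exact (ae_restrict_mem measurableSet_Ioi).mono fun x hx => h x hx

theorem abs_integral_le_of_le_rpow {a C : ℝ} (ha : 1 ≤ a) (hC : 0 ≤ C) {f : ℝ → ℝ}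
    (h : ∀ x, a < x → |f x| ≤ C * x ^ (-5 / 4 : ℝ)) : |∫ x in Set.Ioi a, f x| ≤ 4 * C := by
  have := norm_integral_le_of_norm_le (f := f) ((integrableOn_rpow_neg ha).const_mul C)
    ((ae_restrict_mem measurableSet_Ioi).mono fun x hx => h x hx)
  rw [integral_const_mul] at this
  refine this.trans ?_
  nlinarith [integral_rpow_neg_le ha]

variable {a m c : ℝ}

theorem abs_log_integrand_le (k : ℕ) (hc : 1 ≤ c) {x : ℝ} (hx : 1 ≤ x) (m : ℝ) :
    |(1 - Real.cos (2 * Real.pi * m * x)) * (Real.log (c * x) ^ k / x ^ 2)| ≤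
      2 * logBound k * c * x ^ (-5 / 4 : ℝ) := by
  have := log_pow_mul_rpow_le k hc hx (s := 0) (by norm_num)
  rw [Real.rpow_zero, mul_one] at this
  refine (abs_one_sub_cos_mul_le _ (z := logBound k * c * x ^ (-5 / 4 : ℝ)) ?_).trans_eq (by ring)
  rwa [abs_div, abs_pow, abs_of_nonneg (sq_nonneg x)]

theorem integrableOn_log_integrand (ha : 1 ≤ a) (hc : 1 ≤ c) (m : ℝ) (k : ℕ) :
    IntegrableOn (fun x => (1 - Real.cos (2 * Real.pi * m * x)) * (Real.log (c * x) ^ k / x ^ 2))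
      (Set.Ioi a) :=
  integrableOn_of_le_rpow ha (by fun_prop) fun _ hx =>
    abs_log_integrand_le k hc (ha.trans hx.le) m

theorem abs_cosLogMoment_le (ha : 1 ≤ a) (hc : 1 ≤ c) (m : ℝ) (k : ℕ) :
    |cosLogMoment a m c k| ≤ 8 * logBound k * c := by
  have := abs_integral_le_of_le_rpow ha (C := 2 * logBound k * c)
    (mul_nonneg (mul_nonneg zero_le_two (logBound_nonneg k)) (by linarith))
    fun _ hx => abs_log_integrand_le k hc (ha.trans hx.le) m
  refine this.trans (le_of_eq (by ring))

theorem integrableOn_cosMellin (ha : 1 ≤ a) (hc : 1 ≤ c) (m : ℝ) {s : ℝ} (hs : s ≤ 1 / 2) :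
    IntegrableOn (fun x => (1 - Real.cos (2 * Real.pi * m * x)) * ((c * x) ^ s / x ^ 2))
      (Set.Ioi a) := by
  refine integrableOn_of_le_rpow (C := 2 * (logBound 0 * c)) ha (by fun_prop) fun x hx => ?_
  refine (abs_one_sub_cos_mul_le _ (z := logBound 0 * c * x ^ (-5 / 4 : ℝ)) ?_).trans_eq (by ring)
  have hx' : 1 ≤ x := ha.trans hx.le
  have hcx : 0 ≤ c * x := by positivity
  have := log_pow_mul_rpow_le 0 hc hx' hs
  rw [pow_zero, one_mul] at this
  rwa [abs_of_nonneg (by positivity)]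

/-- The Taylor expansion of `s ↦ cosMellin a m c s` with a remainder uniform in `a`, `m` and `c`. -/
theorem abs_cosMellin_sub_le (ha : 1 ≤ a) (hc : 1 ≤ c) (m : ℝ) (N : ℕ) {s : ℝ} (h0 : 0 ≤ s)
    (hs : s ≤ 1 / 2) :
    |cosMellin a m c s - ∑ k ∈ Finset.range N, cosLogMoment a m c k / k.factorial * s ^ k| ≤
      8 * logBound N * c * s ^ N := by
  have e : cosMellin a m c s - ∑ k ∈ Finset.range N, cosLogMoment a m c k / k.factorial * s ^ k =
      ∫ x in Set.Ioi a, (1 - Real.cos (2 * Real.pi * m * x)) * (((c * x) ^ s -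
        ∑ k ∈ Finset.range N, Real.log (c * x) ^ k / k.factorial * s ^ k) / x ^ 2) := by
    have hk : ∀ k ∈ Finset.range N, IntegrableOn (fun x => (1 - Real.cos (2 * Real.pi * m * x)) *
        (Real.log (c * x) ^ k / x ^ 2) * (s ^ k / k.factorial)) (Set.Ioi a) := fun k _ =>
      (integrableOn_log_integrand ha hc m k).mul_const _
    rw [cosMellin, Finset.sum_congr rfl fun k _ => show cosLogMoment a m c k / k.factorial * s ^ k =
      ∫ x in Set.Ioi a, (1 - Real.cos (2 * Real.pi * m * x)) *
        (Real.log (c * x) ^ k / x ^ 2) * (s ^ k / k.factorial) by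
          rw [integral_mul_const, cosLogMoment]; ring, ← integral_finsetSum _ hk,
      ← integral_sub (integrableOn_cosMellin ha hc m hs) (integrable_finsetSum _ hk)]
    congr 1
    ext x
    rw [sub_div, mul_sub, Finset.sum_div, Finset.mul_sum]
    congr 1
    refine Finset.sum_congr rfl fun k _ => ?_
    ring
  rw [e]
  have := abs_integral_le_of_le_rpow ha (C := 2 * (logBound N * c * s ^ N))
    (f := fun x => (1 - Real.cos (2 * Real.pi * m * x)) * (((c * x) ^ s -
        ∑ k ∈ Finset.range N, Real.log (c * x) ^ k / k.factorial * s ^ k) / x ^ 2))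
    (mul_nonneg zero_le_two (mul_nonneg (mul_nonneg (logBound_nonneg N) (by linarith))
      (by positivity))) fun x hx => ?_
  · exact this.trans (le_of_eq (by ring))
  have hx' : 1 ≤ x := ha.trans hx.le
  have hcx : 1 ≤ c * x := one_le_mul_of_one_le_of_one_le hc hx'
  refine (abs_one_sub_cos_mul_le _ (z := logBound N * c * s ^ N * x ^ (-5 / 4 : ℝ)) ?_).trans_eq
    (by ring)
  have h1 := abs_rpow_sub_sum_le N (x := c * x) (by linarith) h0
  rw [max_eq_right (Real.one_le_rpow hcx h0)] at h1
  have h2 := log_pow_mul_rpow_le N hc hx' hs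
  have hsN : 0 ≤ s ^ N := by positivity
  rw [abs_div, abs_of_nonneg (sq_nonneg x)]
  calc _ ≤ |Real.log (c * x)| ^ N * (c * x) ^ s * s ^ N / x ^ 2 := by gcongr
    _ = |Real.log (c * x)| ^ N * (c * x) ^ s / x ^ 2 * s ^ N := by ring
    _ ≤ logBound N * c * x ^ (-5 / 4 : ℝ) * s ^ N := mul_le_mul_of_nonneg_right h2 hsN
    _ = _ := by ring

theorem hasExpansion_cosMellin (ha : 1 ≤ a) (hc : 1 ≤ c) (m : ℝ) :
    HasExpansion (cosMellin a m c) (PowerSeries.mk fun k => cosLogMoment a m c k / k.factorial) :=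
  .of_bound (δ := 1 / 2) (by norm_num) (fun N => 8 * logBound N * c) fun N s h0 hs => by
    simpa using abs_cosMellin_sub_le ha hc m N h0.le hs

theorem cosMellin_eq_rpow_mul (ha : 0 ≤ a) (hc : 0 ≤ c) (m s : ℝ) :
    cosMellin a m c s = c ^ s * cosMellin a m 1 s := by
  rw [cosMellin, cosMellin, ← integral_const_mul]
  refine setIntegral_congr_fun measurableSet_Ioi fun x hx => ?_
  rw [Real.mul_rpow hc (ha.trans (le_of_lt hx)), one_mul]
  ring

theorem cosMellin_scale {n : ℝ} (hn : 0 < n) (hc : 0 ≤ c) (m s : ℝ) :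
    cosMellin n m c s = n ^ s * n⁻¹ * cosMellin 1 (m * n) c s := by
  have h := integral_comp_mul_left_Ioi (fun x => (1 - Real.cos (2 * Real.pi * m * x)) *
    ((c * x) ^ s / x ^ 2)) 1 hn
  rw [mul_one, smul_eq_mul] at h
  rw [cosMellin, ← mul_right_inj' (inv_ne_zero hn.ne'), ← h, cosMellin, ← integral_const_mul,
    ← integral_const_mul]
  refine setIntegral_congr_fun measurableSet_Ioi fun x hx => ?_
  have hx : (0 : ℝ) < x := lt_trans one_pos hx
  rw [show c * (n * x) = n * (c * x) by ring, Real.mul_rpow hn.le (by positivity),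
    show 2 * Real.pi * m * (n * x) = 2 * Real.pi * (m * n) * x by ring]
  field_simp

/-! ### The improper integrals -/

theorem hasDerivAt_log_pow_div (j : ℕ) {x : ℝ} (hx : 0 < x) :
    HasDerivAt (fun x => Real.log x ^ j / x)
      (-(Real.log x ^ j / x ^ 2 - j * (Real.log x ^ (j - 1) / x ^ 2))) x := by
  have := ((Real.hasDerivAt_log hx.ne').pow j).div (hasDerivAt_id x) hx.ne'
  refine this.congr_deriv ?_
  simp only [Pi.pow_apply, id]
  field_simp
  ring

/-- The integrand left after an integration by parts. -/
theorem integrableOn_log_parts {a : ℝ} (ha : 1 ≤ a) (m : ℝ) (j : ℕ) :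
    IntegrableOn (fun x => (1 - Real.cos (2 * Real.pi * m * x)) *
      (Real.log x ^ j / x ^ 2 - j * (Real.log x ^ (j - 1) / x ^ 2))) (Set.Ioi a) := by
  have h1 := integrableOn_log_integrand ha le_rfl m j
  have h2 := (integrableOn_log_integrand ha le_rfl m (j - 1)).const_mul (j : ℝ)
  simp only [one_mul] at h1 h2
  refine (h1.sub h2).congr (.of_forall fun x => ?_)
  simp only [Pi.sub_apply]
  ring

theorem integral_log_parts {a : ℝ} (ha : 1 ≤ a) (m : ℝ) (j : ℕ) :
    ∫ x in Set.Ioi a, (1 - Real.cos (2 * Real.pi * m * x)) *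
      (Real.log x ^ j / x ^ 2 - j * (Real.log x ^ (j - 1) / x ^ 2)) =
    cosLogMoment a m 1 j - j * cosLogMoment a m 1 (j - 1) := by
  have h1 := integrableOn_log_integrand ha le_rfl m j
  have h2 := (integrableOn_log_integrand ha le_rfl m (j - 1)).const_mul (j : ℝ)
  rw [cosLogMoment, cosLogMoment, ← integral_const_mul, ← integral_sub h1 h2]
  simp only [one_mul]
  congr 1; ext x; ring

theorem cos_two_pi_mul_nat (m n : ℕ) : Real.cos (2 * Real.pi * (m : ℝ) * n) = 1 := by
  rw [show 2 * Real.pi * (m : ℝ) * n = ((m * n : ℕ) : ℝ) * (2 * Real.pi) by push_cast; ring]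
  exact Real.cos_nat_mul_two_pi _

/-- Integration by parts with the antiderivative `1 - cos`, which vanishes at the integers. -/
theorem integral_sin_mul_log (m : ℕ) (hm : 1 ≤ m) (n : ℕ) (hn : 1 ≤ n) (j : ℕ) {R : ℝ}
    (hR : (n : ℝ) ≤ R) :
    ∫ x in (n : ℝ)..R, Real.sin (2 * Real.pi * m * x) * (Real.log x ^ j / x) =
      1 / (2 * Real.pi * m) * ((1 - Real.cos (2 * Real.pi * m * R)) * (Real.log R ^ j / R) +
        ∫ x in (n : ℝ)..R, (1 - Real.cos (2 * Real.pi * m * x)) *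
          (Real.log x ^ j / x ^ 2 - j * (Real.log x ^ (j - 1) / x ^ 2))) := by
  have hn' : (1 : ℝ) ≤ n := by exact_mod_cast hn
  have hm' : (2 * Real.pi * m : ℝ) ≠ 0 := by
    have : (0 : ℝ) < m := by exact_mod_cast hm
    positivity
  have hpos : ∀ x ∈ Set.uIcc (n : ℝ) R, 0 < x := fun x hx => by
    rw [Set.uIcc_of_le hR] at hx; linarith [hx.1]
  have hu : ∀ x ∈ Set.uIcc (n : ℝ) R, HasDerivAt (fun x => Real.log x ^ j / x) _ x :=
    fun x hx => hasDerivAt_log_pow_div j (hpos x hx)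
  have hv : ∀ x ∈ Set.uIcc (n : ℝ) R, HasDerivAt
      (fun x => (1 - Real.cos (2 * Real.pi * m * x)) / (2 * Real.pi * m))
      (Real.sin (2 * Real.pi * m * x)) x := fun x _ => by
    have h1 : HasDerivAt (fun x : ℝ => 2 * Real.pi * m * x) (2 * Real.pi * m) x := by
      simpa using (hasDerivAt_id x).const_mul (2 * Real.pi * m)
    refine ((h1.cos.const_sub 1).div_const (2 * Real.pi * m)).congr_deriv ?_
    field_simp
  have hc : ∀ k : ℕ, ContinuousOn (fun x : ℝ => Real.log x ^ k / x ^ 2) (Set.uIcc (n : ℝ) R) :=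
    fun k => ((Real.continuousOn_log.mono fun x hx => (hpos x hx).ne').pow k).div
      (by fun_prop) fun x hx => (pow_pos (hpos x hx) 2).ne'
  have := intervalIntegral.integral_mul_deriv_eq_deriv_mul hu hv
    (((hc j).sub ((hc (j - 1)).const_smul (j : ℝ))).neg.intervalIntegrable)
    ((by fun_prop : Continuous fun x : ℝ => Real.sin (2 * Real.pi * m * x)).intervalIntegrable _ _)
  rw [cos_two_pi_mul_nat] at this
  calc _ = ∫ x in (n : ℝ)..R, (Real.log x ^ j / x) * Real.sin (2 * Real.pi * m * x) := by
        simp only [mul_comm]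
    _ = _ := by
        rw [this, sub_self, zero_div, mul_zero, sub_zero, mul_add,
          ← intervalIntegral.integral_const_mul, sub_eq_add_neg, ← intervalIntegral.integral_neg]
        congr 1
        · field_simp
        · congr 1; ext x; field_simp

theorem tendsto_integral_sin_mul_log (m : ℕ) (hm : 1 ≤ m) (n : ℕ) (hn : 1 ≤ n) (j : ℕ) :
    Tendsto (fun R : ℝ => ∫ x in (n : ℝ)..R, Real.sin (2 * Real.pi * m * x) * (Real.log x ^ j / x))
      atTop (𝓝 (1 / (2 * Real.pi * m) *
        (cosLogMoment n m 1 j - j * cosLogMoment n m 1 (j - 1)))) := by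
  have hn' : (1 : ℝ) ≤ n := by exact_mod_cast hn
  have h1 : Tendsto (fun R : ℝ => Real.log R ^ j / R) atTop (𝓝 0) := by
    simpa using Real.tendsto_pow_log_div_mul_add_atTop 1 0 j one_ne_zero
  have h2 : Tendsto (fun R : ℝ => (1 - Real.cos (2 * Real.pi * m * R)) * (Real.log R ^ j / R))
      atTop (𝓝 0) := by
    refine squeeze_zero_norm (fun R => ?_) (by
      simpa only [norm_zero, mul_zero] using (h1.norm).const_mul 2)
    exact abs_one_sub_cos_mul_le _ le_rfl
  have h3 := intervalIntegral_tendsto_integral_Ioi (n : ℝ) (integrableOn_log_parts hn' m j)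
    tendsto_id
  rw [integral_log_parts hn'] at h3
  have h4 := (h2.add h3).const_mul (1 / (2 * Real.pi * m))
  rw [zero_add] at h4
  refine h4.congr' ?_
  filter_upwards [eventually_ge_atTop (n : ℝ)] with R hR
  exact (integral_sin_mul_log m hm n hn j hR).symm

theorem abs_integral_sin_mul_log_le (m : ℕ) (hm : 1 ≤ m) (n : ℕ) (hn : 1 ≤ n) (j : ℕ) {R : ℝ}
    (hR : (n : ℝ) ≤ R) :
    |∫ x in (n : ℝ)..R, Real.sin (2 * Real.pi * m * x) * (Real.log x ^ j / x)| ≤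
      10 * (logBound j + j * logBound (j - 1)) := by
  have hn' : (1 : ℝ) ≤ n := by exact_mod_cast hn
  have hm' : (1 : ℝ) ≤ m := by exact_mod_cast hm
  have hlb := logBound_nonneg j
  have hlb' : 0 ≤ j * logBound (j - 1) := mul_nonneg j.cast_nonneg (logBound_nonneg _)
  rw [integral_sin_mul_log m hm n hn j hR, abs_mul]
  have h1 : |1 / (2 * Real.pi * m)| ≤ 1 := by
    rw [abs_of_nonneg (by positivity), div_le_one (by positivity)]
    nlinarith [Real.pi_gt_three]
  refine (mul_le_of_le_one_left (abs_nonneg _) h1).trans ((abs_add_le _ _).trans ?_)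
  have h2 : |(1 - Real.cos (2 * Real.pi * m * R)) * (Real.log R ^ j / R)| ≤ 2 * logBound j := by
    have hR1 : 1 ≤ R := hn'.trans hR
    refine abs_one_sub_cos_mul_le _ ?_
    rw [abs_of_nonneg (div_nonneg (pow_nonneg (Real.log_nonneg hR1) _) (by linarith)),
      div_le_iff₀ (by linarith)]
    refine (log_pow_le j hR1).trans (mul_le_mul_of_nonneg_left ?_ hlb)
    simpa using Real.rpow_le_rpow_of_exponent_le hR1 (by norm_num : (1 / 4 : ℝ) ≤ 1)
  have h3 : |∫ x in (n : ℝ)..R, (1 - Real.cos (2 * Real.pi * m * x)) *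
      (Real.log x ^ j / x ^ 2 - j * (Real.log x ^ (j - 1) / x ^ 2))| ≤
      4 * (2 * (logBound j + j * logBound (j - 1))) := by
    have hb : ∀ x : ℝ, n < x → |(1 - Real.cos (2 * Real.pi * m * x)) *
        (Real.log x ^ j / x ^ 2 - j * (Real.log x ^ (j - 1) / x ^ 2))| ≤
          2 * (logBound j + j * logBound (j - 1)) * x ^ (-5 / 4 : ℝ) := by
      intro x hx
      have hx1 : 1 ≤ x := hn'.trans hx.le
      have key : ∀ k : ℕ, |Real.log x ^ k / x ^ 2| ≤ logBound k * x ^ (-5 / 4 : ℝ) := fun k => by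
        have := log_pow_mul_rpow_le k le_rfl hx1 (s := 0) (by norm_num)
        simp only [one_mul, mul_one, Real.rpow_zero] at this
        rwa [abs_div, abs_pow, abs_of_nonneg (sq_nonneg x)]
      refine (abs_one_sub_cos_mul_le _ (z := (logBound j + j * logBound (j - 1)) *
        x ^ (-5 / 4 : ℝ)) ((abs_sub _ _).trans ?_)).trans_eq (by ring)
      rw [abs_mul, Nat.abs_cast]
      have := mul_le_mul_of_nonneg_left (key (j - 1)) j.cast_nonneg (α := ℝ)
      linarith [key j]
    rw [intervalIntegral.integral_of_le hR]
    have hi : IntegrableOn (fun x : ℝ => 2 * (logBound j + j * logBound (j - 1)) *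
        x ^ (-5 / 4 : ℝ)) (Set.Ioi (n : ℝ)) := (integrableOn_rpow_neg hn').const_mul _
    have h4 := norm_integral_le_of_norm_le (μ := volume.restrict (Set.Ioc (n : ℝ) R))
      (f := fun x => (1 - Real.cos (2 * Real.pi * m * x)) *
        (Real.log x ^ j / x ^ 2 - j * (Real.log x ^ (j - 1) / x ^ 2)))
      (hi.mono_set Set.Ioc_subset_Ioi_self)
      ((ae_restrict_mem measurableSet_Ioc).mono fun x hx => hb x hx.1)
    refine h4.trans ((setIntegral_mono_set hi ?_ Set.Ioc_subset_Ioi_self.eventuallyLE).trans ?_)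
    · filter_upwards [ae_restrict_mem measurableSet_Ioi] with x hx
      have : (0 : ℝ) < x := by linarith [Set.mem_Ioi.1 hx]
      simp only [Pi.zero_apply]
      positivity
    · rw [integral_const_mul]
      nlinarith [integral_rpow_neg_le hn']
  linarith

theorem oscPartial_eq_tsum (n : ℕ) (hn : 1 ≤ n) (i j : ℕ) {R : ℝ} (hR : (n : ℝ) ≤ R) :
    oscPartial n i j R = ∑' K : ℕ, (1 / 2) ^ (K + 1) * Real.log (K + 1) ^ i *
      ∫ x in (n : ℝ)..R, Real.sin (2 * Real.pi * (K + 1 : ℕ) * x) * (Real.log x ^ j / x) := by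
  have hn' : (1 : ℝ) ≤ n := by exact_mod_cast hn
  have hpos : ∀ x ∈ Set.uIcc (n : ℝ) R, 0 < x := fun x hx => by
    rw [Set.uIcc_of_le hR] at hx; linarith [hx.1]
  have hK : ∀ K : ℕ, 0 ≤ Real.log (K + 1) := fun K => Real.log_nonneg (by simp)
  have hc : ContinuousOn (fun x : ℝ => Real.log x ^ j / x) (Set.uIcc (n : ℝ) R) :=
    ((Real.continuousOn_log.mono fun x hx => (hpos x hx).ne').pow j).div
      (by fun_prop) fun x hx => (hpos x hx).ne'
  have hbs : ∀ x : ℝ, Summable fun K : ℕ => (1 / 2 : ℝ) ^ (K + 1) * Real.log (K + 1) ^ i *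
      |Real.log x ^ j / x| := fun x => (summable_geometric_mul_log i).mul_right _
  have hterm : ∀ (K : ℕ) (x : ℝ), |(1 / 2 : ℝ) ^ (K + 1) * Real.log (K + 1) ^ i *
      (Real.sin (2 * Real.pi * (K + 1 : ℕ) * x) * (Real.log x ^ j / x))| ≤
      (1 / 2 : ℝ) ^ (K + 1) * Real.log (K + 1) ^ i * |Real.log x ^ j / x| := fun K x => by
    have hw : 0 ≤ (1 / 2 : ℝ) ^ (K + 1) * Real.log (K + 1) ^ i := by
      have := hK K; positivity
    rw [abs_mul, abs_of_nonneg hw, abs_mul]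
    exact mul_le_mul_of_nonneg_left
      (mul_le_of_le_one_left (abs_nonneg _) (Real.abs_sin_le_one _)) hw
  have h := intervalIntegral.hasSum_integral_of_dominated_convergence
    (μ := volume) (a := (n : ℝ)) (b := R)
    (F := fun (K : ℕ) (x : ℝ) => (1 / 2 : ℝ) ^ (K + 1) * Real.log (K + 1) ^ i *
      (Real.sin (2 * Real.pi * (K + 1 : ℕ) * x) * (Real.log x ^ j / x)))
    (f := fun x => oscKernel i x * (Real.log x ^ j / x))
    (fun K x => (1 / 2 : ℝ) ^ (K + 1) * Real.log (K + 1) ^ i * |Real.log x ^ j / x|)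
    (fun K => (Measurable.aestronglyMeasurable (by fun_prop)))
    (fun K => .of_forall fun x _ => hterm K x)
    (.of_forall fun x _ => hbs x)
    (by
      simp only [tsum_mul_right]
      exact (hc.abs.intervalIntegrable).const_mul _)
    (.of_forall fun x _ => by
      have hs : Summable fun K : ℕ => (1 / 2 : ℝ) ^ (K + 1) * Real.log (K + 1) ^ i *
          (Real.sin (2 * Real.pi * (K + 1 : ℕ) * x) * (Real.log x ^ j / x)) :=
        Summable.of_norm_bounded (hbs x) (fun K => hterm K x)
      have e : oscKernel i x * (Real.log x ^ j / x) = ∑' K : ℕ, (1 / 2 : ℝ) ^ (K + 1) *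
          Real.log (K + 1) ^ i * (Real.sin (2 * Real.pi * (K + 1 : ℕ) * x) *
            (Real.log x ^ j / x)) := by
        rw [oscKernel, ← tsum_mul_right]
        congr 1; ext K; push_cast; ring
      rw [e]
      exact hs.hasSum)
  simp only [intervalIntegral.integral_const_mul] at h
  exact h.tsum_eq.symm

theorem tendsto_oscPartial_aux (n : ℕ) (hn : 1 ≤ n) (i j : ℕ) :
    Tendsto (oscPartial n i j) atTop (𝓝 (∑' K : ℕ, (1 / 2) ^ (K + 1) * Real.log (K + 1) ^ i *
      (1 / (2 * Real.pi * (K + 1 : ℕ)) * (cosLogMoment n (K + 1 : ℕ) 1 j -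
        j * cosLogMoment n (K + 1 : ℕ) 1 (j - 1))))) := by
  have hK : ∀ K : ℕ, 0 ≤ Real.log (K + 1) := fun K => Real.log_nonneg (by simp)
  have := tendsto_tsum_of_dominated_convergence (𝓕 := atTop)
    (f := fun (R : ℝ) (K : ℕ) => (1 / 2 : ℝ) ^ (K + 1) * Real.log (K + 1) ^ i *
      ∫ x in (n : ℝ)..R, Real.sin (2 * Real.pi * (K + 1 : ℕ) * x) * (Real.log x ^ j / x))
    ((summable_geometric_mul_log i).mul_right (10 * (logBound j + j * logBound (j - 1))))
    (fun K => (tendsto_integral_sin_mul_log (K + 1) (by omega) n hn j).const_mul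
      ((1 / 2 : ℝ) ^ (K + 1) * Real.log (K + 1) ^ i))
    (by
      filter_upwards [eventually_ge_atTop (n : ℝ)] with R hR K
      have hw : 0 ≤ (1 / 2 : ℝ) ^ (K + 1) * Real.log (K + 1) ^ i := by
        have := hK K; positivity
      rw [Real.norm_eq_abs, abs_mul, abs_of_nonneg hw]
      exact mul_le_mul_of_nonneg_left
        (abs_integral_sin_mul_log_le (K + 1) (by omega) n hn j hR) hw)
  refine this.congr' ?_
  filter_upwards [eventually_ge_atTop (n : ℝ)] with R hR
  exact (oscPartial_eq_tsum n hn i j hR).symm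

theorem tendsto_oscPartial (n : ℕ) (hn : 1 ≤ n) (i j : ℕ) :
    Tendsto (oscPartial n i j) atTop (𝓝 (oscIntegral n i j)) := by
  have := tendsto_oscPartial_aux n hn i j
  rwa [oscIntegral, this.limUnder_eq]

theorem oscIntegral_eq_tsum (n : ℕ) (hn : 1 ≤ n) (i j : ℕ) :
    oscIntegral n i j = ∑' K : ℕ, (1 / 2) ^ (K + 1) * Real.log (K + 1) ^ i *
      (1 / (2 * Real.pi * (K + 1 : ℕ)) * (cosLogMoment n (K + 1 : ℕ) 1 j -
        j * cosLogMoment n (K + 1 : ℕ) 1 (j - 1))) :=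
  (tendsto_oscPartial_aux n hn i j).limUnder_eq

end

section

/-! ### The power series of the oscillatory integrals -/

/-- `∑_{K ≥ 1} 2^{-K} K^{-1} ∫_a^∞ (1 - cos 2π m_K x) (K x)^s dx / x²`. -/
noncomputable def oscSum (a : ℝ) (m : ℕ → ℝ) (s : ℝ) : ℝ :=
  ∑' K : ℕ, (1 / 2) ^ (K + 1) / (K + 1 : ℕ) * cosMellin a (m K) (K + 1 : ℕ) s

/-- The Taylor coefficients of `oscSum a m` at `0`. -/
noncomputable def oscSumCoeff (a : ℝ) (m : ℕ → ℝ) (k : ℕ) : ℝ :=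
  ∑' K : ℕ, (1 / 2) ^ (K + 1) / (K + 1 : ℕ) * (cosLogMoment a (m K) (K + 1 : ℕ) k / k.factorial)

theorem hasSum_half_pow : HasSum (fun K : ℕ => (1 / 2 : ℝ) ^ (K + 1)) 1 := by
  have := hasSum_geometric_two.mul_right (1 / 2 : ℝ)
  simpa only [← pow_succ, show (2 : ℝ) * (1 / 2) = 1 by norm_num] using this

theorem abs_oscSumCoeff_term_le {a : ℝ} (ha : 1 ≤ a) (m : ℕ → ℝ) (k K : ℕ) :
    |(1 / 2) ^ (K + 1) / (K + 1 : ℕ) * (cosLogMoment a (m K) (K + 1 : ℕ) k / k.factorial)| ≤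
      (1 / 2) ^ (K + 1) * (8 * logBound k) := by
  have hK : (1 : ℝ) ≤ (K + 1 : ℕ) := by exact_mod_cast Nat.succ_le_succ K.zero_le
  have h1 := abs_cosLogMoment_le ha hK (m K) k
  have h2 : (1 : ℝ) ≤ k.factorial := by exact_mod_cast Nat.factorial_pos k
  have h3 : |cosLogMoment a (m K) (K + 1 : ℕ) k / k.factorial| ≤ 8 * logBound k * (K + 1 : ℕ) := by
    rw [abs_div, Nat.abs_cast]
    exact (div_le_self (abs_nonneg _) h2).trans h1
  rw [abs_mul, abs_of_nonneg (by positivity)]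
  calc _ ≤ (1 / 2) ^ (K + 1) / (K + 1 : ℕ) * (8 * logBound k * (K + 1 : ℕ)) := by gcongr
    _ = _ := by field_simp

theorem summable_oscSumCoeff {a : ℝ} (ha : 1 ≤ a) (m : ℕ → ℝ) (k : ℕ) : Summable fun K : ℕ =>
    (1 / 2) ^ (K + 1) / (K + 1 : ℕ) * (cosLogMoment a (m K) (K + 1 : ℕ) k / k.factorial) :=
  Summable.of_norm_bounded (hasSum_half_pow.summable.mul_right _)
    (abs_oscSumCoeff_term_le ha m k)

theorem abs_oscSumCoeff_le {a : ℝ} (ha : 1 ≤ a) (m : ℕ → ℝ) (k : ℕ) :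
    |oscSumCoeff a m k| ≤ 8 * logBound k := by
  have := tsum_of_norm_bounded (f := fun K : ℕ => (1 / 2) ^ (K + 1) / (K + 1 : ℕ) *
      (cosLogMoment a (m K) (K + 1 : ℕ) k / k.factorial))
    (hasSum_half_pow.mul_right (8 * logBound k)) (abs_oscSumCoeff_term_le ha m k)
  rwa [one_mul] at this

theorem abs_oscSum_sub_le {a : ℝ} (ha : 1 ≤ a) (m : ℕ → ℝ) (N : ℕ) {s : ℝ} (h0 : 0 ≤ s)
    (hs : s ≤ 1 / 2) :
    |oscSum a m s - ∑ k ∈ Finset.range N, oscSumCoeff a m k * s ^ k| ≤ 8 * logBound N * s ^ N := by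
  have hw := hasSum_half_pow.mul_right (8 * logBound N)
  rw [one_mul] at hw
  have := abs_tsum_sub_sum_le (N := N) (s := s) (summable_oscSumCoeff ha m) hw.summable
    (f := fun K : ℕ => (1 / 2) ^ (K + 1) / (K + 1 : ℕ) * cosMellin a (m K) (K + 1 : ℕ) s)
    fun K => by
      have hK : (1 : ℝ) ≤ (K + 1 : ℕ) := by exact_mod_cast Nat.succ_le_succ K.zero_le
      have e : (1 / 2 : ℝ) ^ (K + 1) / (K + 1 : ℕ) * cosMellin a (m K) (K + 1 : ℕ) s -
          ∑ k ∈ Finset.range N, (1 / 2) ^ (K + 1) / (K + 1 : ℕ) *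
            (cosLogMoment a (m K) (K + 1 : ℕ) k / k.factorial) * s ^ k =
          (1 / 2) ^ (K + 1) / (K + 1 : ℕ) * (cosMellin a (m K) (K + 1 : ℕ) s -
            ∑ k ∈ Finset.range N, cosLogMoment a (m K) (K + 1 : ℕ) k / k.factorial * s ^ k) := by
        rw [mul_sub, Finset.mul_sum]; simp only [mul_assoc]
      rw [e, abs_mul, abs_of_nonneg (by positivity)]
      calc _ ≤ (1 / 2 : ℝ) ^ (K + 1) / (K + 1 : ℕ) * (8 * logBound N * (K + 1 : ℕ) * s ^ N) :=
            mul_le_mul_of_nonneg_left (abs_cosMellin_sub_le ha hK (m K) N h0 hs) (by positivity)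
        _ = _ := by field_simp
  rwa [hw.tsum_eq] at this

theorem hasExpansion_oscSum {a : ℝ} (ha : 1 ≤ a) (m : ℕ → ℝ) :
    HasExpansion (oscSum a m) (PowerSeries.mk (oscSumCoeff a m)) :=
  .of_bound (δ := 1 / 2) (by norm_num) (fun N => 8 * logBound N) fun N s h0 hs => by
    simpa using abs_oscSum_sub_le ha m N h0.le hs

theorem coeff_mul_mk_tsum (P : PowerSeries ℝ) {u : ℕ → ℕ → ℝ} (hu : ∀ k, Summable fun n => u n k)
    (r : ℕ) : PowerSeries.coeff r (P * PowerSeries.mk fun k => ∑' n, u n k) =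
      ∑' n, PowerSeries.coeff r (P * PowerSeries.mk (u n)) := by
  simp only [PowerSeries.coeff_mul, PowerSeries.coeff_mk]
  rw [Summable.tsum_finsetSum fun p _ => (hu p.2).mul_left _]
  simp only [tsum_mul_left]

theorem coeff_powSeries (c : ℝ) (k : ℕ) :
    PowerSeries.coeff k (powSeries c) = Real.log c ^ k / k.factorial := by
  simp [powSeries, PowerSeries.coeff_rescale, PowerSeries.coeff_exp]
  ring

/-- The Taylor series of `c^s ∫_a^∞ (1 - cos 2πmx) x^{s-2} dx` is obtained by expanding
`(log c + log x)^k`. -/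
theorem powSeries_mul_cosLogMoment {a c : ℝ} (hc : 1 ≤ c) (ha : 1 ≤ a) (m : ℝ) :
    powSeries c * (PowerSeries.mk fun k => cosLogMoment a m 1 k / k.factorial) =
      PowerSeries.mk fun k => cosLogMoment a m c k / k.factorial := by
  refine HasExpansion.unique (((HasExpansion.rpow (by linarith)).mul
    (hasExpansion_cosMellin ha le_rfl m)).congr' (.of_forall fun s => ?_))
    (hasExpansion_cosMellin ha hc m)
  exact (cosMellin_eq_rpow_mul (by linarith) (by linarith) m s).symm

theorem coeff_one_sub_X_mul (q : ℕ → ℝ) (j : ℕ) :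
    PowerSeries.coeff j ((1 - PowerSeries.X) * PowerSeries.mk fun k => q k / k.factorial) =
      (q j - j * q (j - 1)) / j.factorial := by
  rw [sub_mul, one_mul, map_sub, PowerSeries.coeff_mk]
  cases j with
  | zero => simp
  | succ j =>
    rw [PowerSeries.coeff_succ_X_mul, PowerSeries.coeff_mk, Nat.factorial_succ, Nat.add_sub_cancel]
    push_cast
    field_simp

/-- The contribution of the `K`-th summand to `oscIntegral n i j`. -/
noncomputable def oscTerm (n i j K : ℕ) : ℝ :=
  (1 / 2) ^ (K + 1) * Real.log (K + 1) ^ i * (1 / (2 * Real.pi * (K + 1 : ℕ)) *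
    (cosLogMoment n (K + 1 : ℕ) 1 j - j * cosLogMoment n (K + 1 : ℕ) 1 (j - 1)))

theorem summable_oscTerm (n : ℕ) (hn : 1 ≤ n) (i j : ℕ) : Summable (oscTerm n i j) := by
  have hn' : (1 : ℝ) ≤ n := by exact_mod_cast hn
  refine Summable.of_norm_bounded ((summable_geometric_mul_log i).mul_right
    (8 * logBound j + j * (8 * logBound (j - 1)))) fun K => ?_
  have hK : (1 : ℝ) ≤ (K + 1 : ℕ) := by exact_mod_cast Nat.succ_le_succ K.zero_le
  have hw : 0 ≤ (1 / 2 : ℝ) ^ (K + 1) * Real.log (K + 1) ^ i := by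
    have : 0 ≤ Real.log (K + 1) := Real.log_nonneg (by simp)
    positivity
  rw [Real.norm_eq_abs, oscTerm, abs_mul, abs_of_nonneg hw]
  refine mul_le_mul_of_nonneg_left ?_ hw
  rw [abs_mul]
  have h1 : |1 / (2 * Real.pi * (K + 1 : ℕ))| ≤ 1 := by
    rw [abs_of_nonneg (by positivity), div_le_one (by positivity)]
    nlinarith [Real.pi_gt_three]
  refine (mul_le_of_le_one_left (abs_nonneg _) h1).trans ((abs_sub _ _).trans ?_)
  have h2 := abs_cosLogMoment_le hn' le_rfl (K + 1 : ℕ) j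
  have h3 := mul_le_mul_of_nonneg_left (abs_cosLogMoment_le hn' le_rfl (K + 1 : ℕ) (j - 1))
    j.cast_nonneg (α := ℝ)
  rw [abs_mul, Nat.abs_cast]
  linarith

/-- The `K`-th summands of the coefficients of `oscSeries n`. -/
theorem sum_oscTerm (n : ℕ) (hn : 1 ≤ n) (r K : ℕ) :
    ∑ p ∈ Finset.HasAntidiagonal.antidiagonal r,
      oscTerm n p.1 p.2 K / (p.1.factorial * p.2.factorial) =
    PowerSeries.coeff r (PowerSeries.C (1 / (2 * Real.pi)) * (1 - PowerSeries.X) *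
      PowerSeries.mk fun k => (1 / 2) ^ (K + 1) / (K + 1 : ℕ) *
        (cosLogMoment n (K + 1 : ℕ) (K + 1 : ℕ) k / k.factorial)) := by
  have hn' : (1 : ℝ) ≤ n := by exact_mod_cast hn
  have hK : (1 : ℝ) ≤ (K + 1 : ℕ) := by exact_mod_cast Nat.succ_le_succ K.zero_le
  set Q : PowerSeries ℝ := PowerSeries.mk fun k => cosLogMoment n (K + 1 : ℕ) 1 k / k.factorial
    with hQ
  have e1 : (PowerSeries.mk fun k => (1 / 2) ^ (K + 1) / ((K + 1 : ℕ) : ℝ) *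
        (cosLogMoment n (K + 1 : ℕ) (K + 1 : ℕ) k / k.factorial)) =
      PowerSeries.C ((1 / 2) ^ (K + 1) / ((K + 1 : ℕ) : ℝ)) * (powSeries (K + 1 : ℕ) * Q) := by
    rw [hQ, powSeries_mul_cosLogMoment hK hn']
    ext k
    rw [PowerSeries.coeff_C_mul, PowerSeries.coeff_mk, PowerSeries.coeff_mk]
  have e2 : ∀ A B C D E : PowerSeries ℝ, A * B * (C * (D * E)) = A * (C * (D * (B * E))) :=
    fun A B C D E => by ring
  rw [e1, e2, PowerSeries.coeff_C_mul, PowerSeries.coeff_C_mul, PowerSeries.coeff_mul,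
    Finset.mul_sum, Finset.mul_sum]
  refine Finset.sum_congr rfl fun p _ => ?_
  rw [coeff_powSeries, hQ, coeff_one_sub_X_mul, oscTerm, Nat.cast_succ]
  field_simp

theorem oscSeries_eq (n : ℕ) (hn : 1 ≤ n) :
    oscSeries n = PowerSeries.C (1 / (2 * Real.pi)) * ((1 - PowerSeries.X) *
      PowerSeries.mk (oscSumCoeff n fun K => (K + 1 : ℕ))) := by
  have hn' : (1 : ℝ) ≤ n := by exact_mod_cast hn
  ext r
  have h := coeff_mul_mk_tsum (PowerSeries.C (1 / (2 * Real.pi)) * (1 - PowerSeries.X))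
    (summable_oscSumCoeff hn' fun K => (K + 1 : ℕ)) r
  rw [← mul_assoc]
  refine Eq.trans ?_ h.symm
  rw [tsum_congr fun K => (sum_oscTerm n hn r K).symm,
    Summable.tsum_finsetSum fun p _ => (summable_oscTerm n hn p.1 p.2).div_const _,
    oscSeries, PowerSeries.coeff_mk]
  refine Finset.sum_congr rfl fun p _ => ?_
  rw [oscIntegral_eq_tsum n hn, tsum_div_const]
  rfl

/-- The function with the Taylor coefficients `eta r n / r!`. -/
noncomputable def etaFun (n : ℕ) (s : ℝ) : ℝ :=
  1 / (4 * Real.pi ^ 2 * n ^ 2) * (s * (1 - s) * oscSum 1 (fun K => (K + 1 : ℕ) * n) s)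

theorem oscSum_scale {n : ℝ} (hn : 0 < n) (s : ℝ) :
    oscSum n (fun K => (K + 1 : ℕ)) s = n ^ s * n⁻¹ * oscSum 1 (fun K => (K + 1 : ℕ) * n) s := by
  rw [oscSum, oscSum, ← tsum_mul_left]
  congr 1
  ext K
  rw [cosMellin_scale hn (by positivity)]
  ring

theorem hasExpansion_one_sub : HasExpansion (fun s => 1 - s) (1 - PowerSeries.X) := by
  simpa using (HasExpansion.const 1).sub HasExpansion.id

theorem hasExpansion_etaFun (n : ℕ) (hn : 1 ≤ n) : HasExpansion (etaFun n)
    (PowerSeries.C (1 / (2 * Real.pi * n)) * PowerSeries.X * powSeries (n : ℝ)⁻¹ *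
      oscSeries n) := by
  have hn' : (1 : ℝ) ≤ n := by exact_mod_cast hn
  have hn0 : (0 : ℝ) < n := by linarith
  rw [oscSeries_eq n hn]
  refine (((HasExpansion.id.const_mul (1 / (2 * Real.pi * n))).mul (HasExpansion.rpow
    (inv_pos.2 hn0))).mul ((hasExpansion_one_sub.mul (hasExpansion_oscSum hn' _)).const_mul
      (1 / (2 * Real.pi)))).congr' (.of_forall fun s => ?_)
  simp only
  rw [oscSum_scale hn0, Real.inv_rpow hn0.le, etaFun]
  have : (n : ℝ) ^ s ≠ 0 := (Real.rpow_pos_of_pos hn0 s).ne'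
  field_simp
  ring

theorem hasExpansion_etaFun' (n : ℕ) : HasExpansion (etaFun n)
    (PowerSeries.C (1 / (4 * Real.pi ^ 2 * n ^ 2)) * (PowerSeries.X * (1 - PowerSeries.X) *
      PowerSeries.mk (oscSumCoeff 1 fun K => (K + 1 : ℕ) * n))) :=
  ((HasExpansion.id.mul hasExpansion_one_sub).mul (hasExpansion_oscSum le_rfl _)).const_mul _

theorem eta_div_factorial (r n : ℕ) (hn : 1 ≤ n) :
    eta r n / r.factorial = 1 / (4 * Real.pi ^ 2 * n ^ 2) * PowerSeries.coeff r
      (PowerSeries.X * (1 - PowerSeries.X) *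
        PowerSeries.mk (oscSumCoeff 1 fun K => (K + 1 : ℕ) * n)) := by
  have hf : (r.factorial : ℝ) ≠ 0 := by exact_mod_cast r.factorial_ne_zero
  rw [eta, (hasExpansion_etaFun n hn).unique (hasExpansion_etaFun' n), PowerSeries.coeff_C_mul,
    mul_div_cancel_left₀ _ hf]

/-- `η_{r,n} = O(n⁻²)`. -/
theorem exists_abs_eta_le (r : ℕ) : ∃ C : ℝ, 0 ≤ C ∧ ∀ n : ℕ, 1 ≤ n → |eta r n| ≤ C / n ^ 2 := by
  refine ⟨r.factorial * ∑ p ∈ Finset.HasAntidiagonal.antidiagonal r, |PowerSeries.coeff p.1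
    ((PowerSeries.X * (1 - PowerSeries.X) : PowerSeries ℝ))| * (8 * logBound p.2), ?_, ?_⟩
  · exact mul_nonneg (Nat.cast_nonneg _) (Finset.sum_nonneg fun p _ =>
      mul_nonneg (abs_nonneg _) (mul_nonneg (by norm_num) (logBound_nonneg _)))
  intro n hn
  have hn' : (1 : ℝ) ≤ n := by exact_mod_cast hn
  have hf : (r.factorial : ℝ) ≠ 0 := by exact_mod_cast r.factorial_ne_zero
  have e := eta_div_factorial r n hn
  rw [div_eq_iff hf, mul_comm] at e
  rw [e, abs_mul, Nat.abs_cast, mul_div_assoc]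
  refine mul_le_mul_of_nonneg_left ?_ (Nat.cast_nonneg _)
  have h1 : |1 / (4 * Real.pi ^ 2 * (n : ℝ) ^ 2)| ≤ 1 / (n : ℝ) ^ 2 := by
    rw [abs_of_nonneg (by positivity)]
    refine one_div_le_one_div_of_le (by positivity) (le_mul_of_one_le_left (by positivity) ?_)
    nlinarith [Real.pi_gt_three]
  rw [abs_mul, PowerSeries.coeff_mul]
  calc _ ≤ 1 / (n : ℝ) ^ 2 * ∑ p ∈ Finset.HasAntidiagonal.antidiagonal r, |PowerSeries.coeff p.1
        ((PowerSeries.X * (1 - PowerSeries.X) : PowerSeries ℝ))| * (8 * logBound p.2) := by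
        refine mul_le_mul h1 ((Finset.abs_sum_le_sum_abs _ _).trans ?_) (abs_nonneg _)
          (by positivity)
        refine Finset.sum_le_sum fun p _ => ?_
        rw [abs_mul, PowerSeries.coeff_mk]
        exact mul_le_mul_of_nonneg_left (abs_oscSumCoeff_le le_rfl _ _) (abs_nonneg _)
    _ = _ := by ring

theorem summable_one_div_nat_add_one_sq : Summable fun n : ℕ => 1 / ((n + 1 : ℕ) : ℝ) ^ 2 :=
  (summable_nat_add_iff 1).2 (Real.summable_one_div_nat_pow.2 one_lt_two)

variable {e : ℕ → ℝ} {D : ℝ}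

theorem summable_mul_eta (he : ∀ n, |e n| ≤ D) (r : ℕ) :
    Summable fun n : ℕ => |e n * eta r (n + 1)| := by
  obtain ⟨C, hC, h⟩ := exists_abs_eta_le r
  have hD : 0 ≤ D := (abs_nonneg _).trans (he 0)
  refine Summable.of_nonneg_of_le (fun _ => abs_nonneg _) (fun n => ?_)
    (summable_one_div_nat_add_one_sq.mul_left (D * C))
  rw [abs_mul]
  refine (mul_le_mul (he n) (h (n + 1) (by omega)) (abs_nonneg _) hD).trans (le_of_eq (by ring))

theorem abs_etaFun_le (n : ℕ) (hn : 1 ≤ n) {s : ℝ} (h0 : 0 ≤ s) (hs : s ≤ 1 / 2) :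
    |etaFun n s| ≤ 8 * logBound 0 / n ^ 2 := by
  have hn' : (1 : ℝ) ≤ n := by exact_mod_cast hn
  have h := abs_oscSum_sub_le le_rfl (fun K => ((K + 1 : ℕ) : ℝ) * n) 0 h0 hs
  simp only [Finset.range_zero, Finset.sum_empty, sub_zero, pow_zero, mul_one] at h
  have h2 : |s * (1 - s) * oscSum 1 (fun K => ((K + 1 : ℕ) : ℝ) * n) s| ≤ 8 * logBound 0 := by
    rw [abs_mul]
    refine (mul_le_of_le_one_left (abs_nonneg _) ?_).trans h
    rw [abs_of_nonneg (mul_nonneg h0 (by linarith))]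
    nlinarith
  have h1 : |1 / (4 * Real.pi ^ 2 * (n : ℝ) ^ 2)| ≤ 1 / (n : ℝ) ^ 2 := by
    rw [abs_of_nonneg (by positivity)]
    refine one_div_le_one_div_of_le (by positivity) (le_mul_of_one_le_left (by positivity) ?_)
    nlinarith [Real.pi_gt_three]
  rw [etaFun, abs_mul]
  exact (mul_le_mul h1 h2 (abs_nonneg _) (by positivity)).trans (le_of_eq (by ring))

theorem summable_mul_etaFun (he : ∀ n, |e n| ≤ D) {s : ℝ} (h0 : 0 ≤ s) (hs : s ≤ 1 / 2) :
    Summable fun n : ℕ => e n * etaFun (n + 1) s := by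
  have hD : 0 ≤ D := (abs_nonneg _).trans (he 0)
  refine Summable.of_norm_bounded
    (summable_one_div_nat_add_one_sq.mul_left (D * (8 * logBound 0))) fun n => ?_
  rw [norm_mul]
  refine (mul_le_mul (he n) (abs_etaFun_le (n + 1) (by omega) h0 hs) (abs_nonneg _) hD).trans
    (le_of_eq (by ring))

theorem hasExpansion_tsum_etaFun (he : ∀ n, |e n| ≤ D) :
    HasExpansion (fun s => ∑' n : ℕ, e n * etaFun (n + 1) s)
      (PowerSeries.mk fun r => ∑' n : ℕ, e n * (eta r (n + 1) / r.factorial)) := by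
  have hD : 0 ≤ D := (abs_nonneg _).trans (he 0)
  set u : ℕ → ℕ → ℝ := fun n k => e n / ((n + 1 : ℕ) : ℝ) ^ 2 *
    oscSumCoeff 1 (fun K => ((K + 1 : ℕ) : ℝ) * (n + 1 : ℕ)) k with hu
  have hen : ∀ n, |e n / ((n + 1 : ℕ) : ℝ) ^ 2| ≤ D * (1 / ((n + 1 : ℕ) : ℝ) ^ 2) := fun n => by
    rw [abs_div, abs_of_nonneg (sq_nonneg (((n + 1 : ℕ) : ℝ))), ← div_eq_mul_one_div]
    gcongr
    exact he n
  have hus : ∀ k, Summable fun n => u n k := fun k => by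
    refine Summable.of_norm_bounded
      (summable_one_div_nat_add_one_sq.mul_left (D * (8 * logBound k))) fun n => ?_
    rw [hu, norm_mul]
    refine (mul_le_mul (hen n) (abs_oscSumCoeff_le le_rfl _ k) (abs_nonneg _)
      (by positivity)).trans (le_of_eq (by ring))
  have h1 : HasExpansion (fun s => ∑' n : ℕ, e n / ((n + 1 : ℕ) : ℝ) ^ 2 *
      oscSum 1 (fun K => ((K + 1 : ℕ) : ℝ) * (n + 1 : ℕ)) s)
      (PowerSeries.mk fun k => ∑' n, u n k) := by
    refine .tsum (fun N n => D * (8 * logBound N) * (1 / ((n + 1 : ℕ) : ℝ) ^ 2)) (δ := 1 / 2)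
      (by norm_num) hus (fun N => summable_one_div_nat_add_one_sq.mul_left _) fun N n s h0 hs => ?_
    have := abs_oscSum_sub_le le_rfl (fun K => ((K + 1 : ℕ) : ℝ) * (n + 1 : ℕ)) N h0.le hs
    simp only [hu, mul_assoc]
    rw [← Finset.mul_sum, ← mul_sub, abs_mul]
    refine (mul_le_mul (hen n) this (abs_nonneg _) (by positivity)).trans (le_of_eq (by ring))
  have h2 := ((HasExpansion.id.mul hasExpansion_one_sub).mul h1).const_mul
    (1 / (4 * Real.pi ^ 2))
  have e1 : (PowerSeries.mk fun r => ∑' n : ℕ, e n * (eta r (n + 1) / r.factorial)) =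
      PowerSeries.C (1 / (4 * Real.pi ^ 2)) * (PowerSeries.X * (1 - PowerSeries.X) *
        PowerSeries.mk fun k => ∑' n, u n k) := by
    ext r
    rw [PowerSeries.coeff_C_mul, coeff_mul_mk_tsum _ hus, PowerSeries.coeff_mk, ← tsum_mul_left]
    congr 1
    ext n
    have e2 : PowerSeries.mk (u n) = PowerSeries.C (e n / ((n + 1 : ℕ) : ℝ) ^ 2) *
        PowerSeries.mk (oscSumCoeff 1 fun K => ((K + 1 : ℕ) : ℝ) * (n + 1 : ℕ)) := by
      ext k; simp [hu]
    rw [eta_div_factorial r (n + 1) (by omega), e2, mul_left_comm, mul_left_comm _ (PowerSeries.C _),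
      PowerSeries.coeff_C_mul]
    field_simp
  rw [e1]
  refine h2.congr' (.of_forall fun s => ?_)
  simp only
  rw [← tsum_mul_left, ← tsum_mul_left]
  congr 1
  ext n
  rw [etaFun]
  field_simp

end

/-! ### The Mellin transform of `1 - cos` -/

/-- Tonelli's theorem for nonnegative kernels on the quadrant with known inner integrals. -/
theorem lintegral_quadrant_swap {f : ℝ → ℝ → ℝ} {φ ψ : ℝ → ℝ}
    (hf : Measurable (Function.uncurry f)) (hf0 : ∀ x > 0, ∀ t > 0, 0 ≤ f x t)
    (hφi : ∀ x > 0, IntegrableOn (fun t => f x t) (Set.Ioi 0))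
    (hφ : ∀ x > 0, ∫ t in Set.Ioi 0, f x t = φ x)
    (hψi : ∀ t > 0, IntegrableOn (fun x => f x t) (Set.Ioi 0))
    (hψ : ∀ t > 0, ∫ x in Set.Ioi 0, f x t = ψ t) :
    ∫⁻ x in Set.Ioi 0, ENNReal.ofReal (φ x) = ∫⁻ t in Set.Ioi 0, ENNReal.ofReal (ψ t) := by
  have h1 : ∫⁻ x in Set.Ioi (0 : ℝ), ENNReal.ofReal (φ x) =
      ∫⁻ x in Set.Ioi (0 : ℝ), ∫⁻ t in Set.Ioi (0 : ℝ), ENNReal.ofReal (f x t) := by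
    refine setLIntegral_congr_fun measurableSet_Ioi fun x hx => ?_
    rw [← hφ x hx, ofReal_integral_eq_lintegral_ofReal (hφi x hx)
      ((ae_restrict_mem measurableSet_Ioi).mono fun t ht => hf0 x hx t ht)]
  have h2 : ∫⁻ t in Set.Ioi (0 : ℝ), ENNReal.ofReal (ψ t) =
      ∫⁻ t in Set.Ioi (0 : ℝ), ∫⁻ x in Set.Ioi (0 : ℝ), ENNReal.ofReal (f x t) := by
    refine setLIntegral_congr_fun measurableSet_Ioi fun t ht => ?_
    rw [← hψ t ht, ofReal_integral_eq_lintegral_ofReal (hψi t ht)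
      ((ae_restrict_mem measurableSet_Ioi).mono fun x hx => hf0 x hx t ht)]
  rw [h1, h2]
  exact lintegral_lintegral_swap (f := fun x t => ENNReal.ofReal (f x t))
    (ENNReal.measurable_ofReal.comp hf).aemeasurable

theorem integrableOn_rpow_mul_exp {a r : ℝ} (ha : 0 < a) (hr : 0 < r) :
    IntegrableOn (fun t : ℝ => t ^ (a - 1) * Real.exp (-(r * t))) (Set.Ioi 0) := by
  have := integrableOn_rpow_mul_exp_neg_mul_rpow (p := 1) (s := a - 1) (b := r) (by linarith)
    one_pos hr
  simpa using this

theorem integrableOn_exp_mul_one_sub_cos {t : ℝ} (ht : 0 < t) :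
    IntegrableOn (fun x : ℝ => (1 - Real.cos x) * Real.exp (-(x * t))) (Set.Ioi 0) := by
  have h := (integrableOn_rpow_mul_exp (a := 1) one_pos ht).const_mul 2
  refine Integrable.mono' h (Measurable.aestronglyMeasurable (by fun_prop)) (.of_forall fun x => ?_)
  rw [sub_self, Real.rpow_zero, one_mul, norm_mul, Real.norm_eq_abs, Real.norm_eq_abs,
    abs_of_nonneg (one_sub_cos_mem x).1, abs_of_nonneg (Real.exp_pos _).le, mul_comm x]
  exact mul_le_mul_of_nonneg_right (one_sub_cos_mem x).2 (Real.exp_pos _).le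

theorem integral_exp_mul_one_sub_cos {t : ℝ} (ht : 0 < t) :
    ∫ x in Set.Ioi 0, (1 - Real.cos x) * Real.exp (-(x * t)) = 1 / (t * (1 + t ^ 2)) := by
  have hre : (-(t : ℂ) + Complex.I).re < 0 := by simpa using ht
  have h1 := integral_exp_mul_complex_Ioi hre 0
  have hint1 := integrableOn_exp_mul_complex_Ioi hre 0
  have h3 : ∫ x in Set.Ioi (0 : ℝ), Real.cos x * Real.exp (-(x * t)) = t / (1 + t ^ 2) := by
    have e : ∀ x : ℝ, Real.cos x * Real.exp (-(x * t)) =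
        RCLike.re (Complex.exp ((-(t : ℂ) + Complex.I) * x)) := fun x => by
      rw [RCLike.re_eq_complex_re, Complex.exp_re]
      simp [mul_comm]
    simp only [e]
    rw [integral_re hint1, h1]
    simp only [Complex.ofReal_zero, mul_zero, Complex.exp_zero, RCLike.re_eq_complex_re]
    rw [Complex.div_re]
    simp [Complex.normSq_apply]
    field_simp
    ring
  have hi1 := integrableOn_rpow_mul_exp (a := 1) one_pos ht
  have h2 := Real.integral_rpow_mul_exp_neg_mul_Ioi (a := 1) one_pos ht
  simp only [sub_self, Real.rpow_zero, one_mul, Real.rpow_one, Real.Gamma_one, mul_one] at h2 hi1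
  have e : ∀ x : ℝ, (1 - Real.cos x) * Real.exp (-(x * t)) =
      Real.exp (-(t * x)) - Real.cos x * Real.exp (-(x * t)) := fun x => by
    rw [mul_comm t x]; ring
  have hi3 : IntegrableOn (fun x : ℝ => Real.cos x * Real.exp (-(x * t))) (Set.Ioi 0) := by
    refine (hi1.sub (integrableOn_exp_mul_one_sub_cos ht)).congr (.of_forall fun x => ?_)
    simp only [Pi.sub_apply, e]
    ring
  simp only [e]
  rw [integral_sub hi1 hi3, h2, h3]
  field_simp
  ring

theorem integral_rpow_mul_exp_sq {s v : ℝ} (hs : s < 1) (hv : 0 < v) :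
    ∫ t in Set.Ioi (0 : ℝ), t ^ (-s) * Real.exp (-(v * (1 + t ^ 2))) =
      1 / 2 * Real.Gamma ((1 - s) / 2) * (v ^ ((1 + s) / 2 - 1) * Real.exp (-(1 * v))) := by
  have := integral_rpow_mul_exp_neg_mul_rpow (p := 2) (q := -s) (b := v) two_pos (by linarith) hv
  have e : ∀ t : ℝ, t ^ (-s) * Real.exp (-(v * (1 + t ^ 2))) =
      Real.exp (-(1 * v)) * (t ^ (-s) * Real.exp (-v * t ^ (2 : ℝ))) := fun t => by
    rw [mul_left_comm, ← Real.exp_add, Real.rpow_two]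
    ring_nf
  simp only [e]
  rw [integral_const_mul, this, show -(-s + 1) / 2 = (1 + s) / 2 - 1 by ring,
    show (-s + 1) / 2 = (1 - s) / 2 by ring]
  ring

/-- Obtained by swapping the integrals after writing `1 / (1 + t²) = ∫₀^∞ e^{-v(1 + t²)} dv`. -/
theorem lintegral_rpow_div_one_add_sq {s : ℝ} (h0 : 0 < s) (h1 : s < 1) :
    ∫⁻ t in Set.Ioi (0 : ℝ), ENNReal.ofReal (t ^ (-s) / (1 + t ^ 2)) =
      ENNReal.ofReal (1 / 2 * Real.Gamma ((1 - s) / 2) * Real.Gamma ((1 + s) / 2)) := by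
  have hG : 0 < Real.Gamma ((1 - s) / 2) := Real.Gamma_pos_of_pos (by linarith)
  rw [lintegral_quadrant_swap (f := fun t v => t ^ (-s) * Real.exp (-(v * (1 + t ^ 2))))
    (φ := fun t => t ^ (-s) / (1 + t ^ 2)) (ψ := fun v => 1 / 2 * Real.Gamma ((1 - s) / 2) *
      (v ^ ((1 + s) / 2 - 1) * Real.exp (-(1 * v))))
    (by fun_prop) (fun t ht v hv => by positivity) (fun t ht => ?_) (fun t ht => ?_)
    (fun v hv => ?_) (fun v hv => integral_rpow_mul_exp_sq h1 hv)]
  · have hi := (integrableOn_rpow_mul_exp (a := (1 + s) / 2) (r := 1) (by linarith)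
      one_pos).const_mul (1 / 2 * Real.Gamma ((1 - s) / 2))
    rw [← ofReal_integral_eq_lintegral_ofReal hi, integral_const_mul,
      Real.integral_rpow_mul_exp_neg_mul_Ioi (by linarith) one_pos]
    · simp
    · filter_upwards [ae_restrict_mem measurableSet_Ioi] with v hv
      have : (0 : ℝ) < v := hv
      simp only [Pi.zero_apply]
      positivity
  · have hi := (integrableOn_rpow_mul_exp (a := 1) (r := 1 + t ^ 2) one_pos
      (by positivity)).const_mul (t ^ (-s))
    refine hi.congr (.of_forall fun v => ?_)
    simp only [sub_self, Real.rpow_zero, one_mul]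
    rw [mul_comm (1 + t ^ 2)]
  · have h2 := Real.integral_rpow_mul_exp_neg_mul_Ioi (a := 1) (r := 1 + t ^ 2) one_pos
      (by positivity)
    simp only [sub_self, Real.rpow_zero, one_mul, Real.rpow_one, Real.Gamma_one, mul_one] at h2
    simp only [mul_comm _ (1 + t ^ 2)]
    rw [integral_const_mul, h2]
    ring
  · have hi := (integrableOn_rpow_mul_exp_neg_mul_rpow (p := 2) (s := -s) (b := v) (by linarith)
      two_pos hv).const_mul (Real.exp (-v))
    refine hi.congr (.of_forall fun t => ?_)
    simp only
    rw [mul_left_comm, ← Real.exp_add, Real.rpow_two]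
    ring_nf

/-- The representation `Γ(2 - s) x^{s-2} = ∫₀^∞ t^{1-s} e^{-xt} dt` reduces this to the integral of
`t^{-s} / (1 + t²)`; the reflection formula puts the value in the stated form. -/
theorem lintegral_one_sub_cos_mul_rpow {s : ℝ} (h0 : 0 < s) (h1 : s < 1) :
    ∫⁻ x in Set.Ioi (0 : ℝ), ENNReal.ofReal ((1 - Real.cos x) * (x ^ s / x ^ 2)) =
      ENNReal.ofReal (Real.Gamma s * Real.sin (Real.pi / 2 * s) / (1 - s)) := by
  have hG : 0 < Real.Gamma (2 - s) := Real.Gamma_pos_of_pos (by linarith)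
  have hG1 : 0 < Real.Gamma (1 - s) := Real.Gamma_pos_of_pos (by linarith)
  have hswap := lintegral_quadrant_swap
    (f := fun x t => (1 - Real.cos x) * (t ^ (2 - s - 1) * Real.exp (-(x * t))))
    (φ := fun x => Real.Gamma (2 - s) * ((1 - Real.cos x) * (x ^ s / x ^ 2)))
    (ψ := fun t => t ^ (-s) / (1 + t ^ 2))
    (by fun_prop) (fun x hx t ht => mul_nonneg (one_sub_cos_mem x).1 (by positivity))
    (fun x hx => (integrableOn_rpow_mul_exp (by linarith) hx).const_mul _)
    (fun x hx => by
      rw [integral_const_mul, Real.integral_rpow_mul_exp_neg_mul_Ioi (by linarith) hx,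
        Real.div_rpow zero_le_one (le_of_lt hx), Real.one_rpow, Real.rpow_sub hx, Real.rpow_two]
      field_simp)
    (fun t ht => by
      refine ((integrableOn_exp_mul_one_sub_cos ht).const_mul (t ^ (2 - s - 1))).congr
        (.of_forall fun x => ?_)
      simp only
      ring)
    (fun t ht => by
      have ht' : (0 : ℝ) < t := ht
      rw [show (fun x => (1 - Real.cos x) * (t ^ (2 - s - 1) * Real.exp (-(x * t)))) =
        fun x => t ^ (2 - s - 1) * ((1 - Real.cos x) * Real.exp (-(x * t))) by ext x; ring,
        integral_const_mul, integral_exp_mul_one_sub_cos ht,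
        show 2 - s - 1 = -s + 1 by ring, Real.rpow_add_one ht'.ne']
      field_simp)
  rw [lintegral_rpow_div_one_add_sq h0 h1] at hswap
  simp only [ENNReal.ofReal_mul hG.le] at hswap
  rw [lintegral_const_mul' _ _ ENNReal.ofReal_ne_top] at hswap
  have hsin : 0 < Real.sin (Real.pi / 2 * s) := Real.sin_pos_of_pos_of_lt_pi
    (by have := Real.pi_pos; positivity) (by nlinarith [Real.pi_pos])
  have hcos : 0 < Real.cos (Real.pi / 2 * s) := Real.cos_pos_of_mem_Ioo
    ⟨by nlinarith [Real.pi_pos], by nlinarith [Real.pi_pos]⟩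
  have r1 := Real.Gamma_mul_Gamma_one_sub s
  have r2 := Real.Gamma_mul_Gamma_one_sub ((1 - s) / 2)
  rw [show 1 - (1 - s) / 2 = (1 + s) / 2 by ring, show Real.pi * ((1 - s) / 2) =
    Real.pi / 2 - Real.pi / 2 * s by ring, Real.sin_pi_div_two_sub] at r2
  rw [show Real.pi * s = 2 * (Real.pi / 2 * s) by ring, Real.sin_two_mul] at r1
  have r3 : Real.Gamma (2 - s) = (1 - s) * Real.Gamma (1 - s) := by
    rw [show 2 - s = 1 - s + 1 by ring, Real.Gamma_add_one (by linarith)]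
  have e : 1 / 2 * Real.Gamma ((1 - s) / 2) * Real.Gamma ((1 + s) / 2) =
      Real.Gamma (2 - s) * (Real.Gamma s * Real.sin (Real.pi / 2 * s) / (1 - s)) := by
    have hs1 : 1 - s ≠ 0 := by linarith
    rw [mul_assoc, r2, r3]
    rw [eq_div_iff (by positivity)] at r1
    generalize Real.pi / 2 * s = a at *
    rw [← r1]
    field_simp
  rw [e, ENNReal.ofReal_mul hG.le] at hswap
  exact (ENNReal.mul_right_inj (by simpa using hG) ENNReal.ofReal_ne_top).1 hswap

theorem integrableOn_one_sub_cos_mul_rpow {s : ℝ} (h0 : 0 < s) (h1 : s < 1) :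
    IntegrableOn (fun x : ℝ => (1 - Real.cos x) * (x ^ s / x ^ 2)) (Set.Ioi 0) := by
  refine ⟨Measurable.aestronglyMeasurable (by fun_prop), ?_⟩
  rw [hasFiniteIntegral_iff_ofReal, lintegral_one_sub_cos_mul_rpow h0 h1]
  · exact ENNReal.ofReal_lt_top
  · filter_upwards [ae_restrict_mem measurableSet_Ioi] with x hx
    have : (0 : ℝ) < x := hx
    exact mul_nonneg (one_sub_cos_mem x).1 (by positivity)

/-- `∫₀^∞ (1 - cos x) x^{s-2} dx = Γ(s) sin(πs/2) / (1 - s)` for `0 < s < 1`. -/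
theorem integral_one_sub_cos_mul_rpow {s : ℝ} (h0 : 0 < s) (h1 : s < 1) :
    ∫ x in Set.Ioi (0 : ℝ), (1 - Real.cos x) * (x ^ s / x ^ 2) =
      Real.Gamma s * Real.sin (Real.pi / 2 * s) / (1 - s) := by
  have hsin : 0 < Real.sin (Real.pi / 2 * s) := Real.sin_pos_of_pos_of_lt_pi
    (by have := Real.pi_pos; positivity) (by nlinarith [Real.pi_pos])
  have hs1 : 0 < 1 - s := by linarith
  have hG := Real.Gamma_pos_of_pos h0
  rw [integral_eq_lintegral_of_nonneg_ae, lintegral_one_sub_cos_mul_rpow h0 h1,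
    ENNReal.toReal_ofReal (by positivity)]
  · filter_upwards [ae_restrict_mem measurableSet_Ioi] with x hx
    have : (0 : ℝ) < x := hx
    exact mul_nonneg (one_sub_cos_mem x).1 (by positivity)
  · exact Measurable.aestronglyMeasurable (by fun_prop)

/-! ### Fourier cosine series -/

/-- A continuous function on `[0, 1]` symmetric under `x ↦ 1 - x` is the sum of its cosine series,
if the latter converges absolutely. -/
theorem hasSum_cosine_series {h : ℝ → ℝ} (hc : ContinuousOn h (Set.Icc 0 1))
    (hsymm : ∀ x, h (1 - x) = h x) {a : ℕ → ℝ}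
    (ha : ∀ n : ℕ, ∫ x in (0 : ℝ)..1, h x * Real.cos (2 * Real.pi * n * x) = a n)
    (hs : Summable a) {x : ℝ} (hx : x ∈ Set.Ico (0 : ℝ) 1) :
    HasSum (fun n : ℕ => a (n + 1) * Real.cos (2 * Real.pi * (n + 1 : ℕ) * x))
      ((h x - a 0) / 2) := by
  have hint : ∀ φ : ℝ → ℝ, Continuous φ →
      IntervalIntegrable (fun x => ((h x * φ x : ℝ) : ℂ)) volume 0 1 :=
    fun φ hφ => ContinuousOn.intervalIntegrable (by
      rw [Set.uIcc_of_le zero_le_one]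
      exact Complex.continuous_ofReal.comp_continuousOn (hc.mul hφ.continuousOn))
  have hsin : ∀ n : ℕ, ∫ x in (0 : ℝ)..1, h x * Real.sin (2 * Real.pi * n * x) = 0 := fun n => by
    have h1 := intervalIntegral.integral_comp_sub_left (a := 0) (b := 1)
      (fun x => h x * Real.sin (2 * Real.pi * n * x)) 1
    have h2 : ∀ x : ℝ, h (1 - x) * Real.sin (2 * Real.pi * n * (1 - x)) =
        -(h x * Real.sin (2 * Real.pi * n * x)) := fun x => by
      rw [hsymm, show 2 * Real.pi * n * (1 - x) = n * (2 * Real.pi) - 2 * Real.pi * n * x by ring,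
        Real.sin_nat_mul_two_pi_sub]
      ring
    simp only [h2, intervalIntegral.integral_neg, sub_self, sub_zero] at h1
    linarith
  let B : C(AddCircle (1 : ℝ), ℂ) := ⟨AddCircle.liftIco 1 0 fun x => (h x : ℂ),
    AddCircle.liftIco_zero_continuous (by simpa using (hsymm 1))
      (Complex.continuous_ofReal.comp_continuousOn hc)⟩
  have hcoef : ∀ k : ℤ, fourierCoeff B k = (a k.natAbs : ℂ) := fun k => by
    change fourierCoeff (AddCircle.liftIco 1 0 fun x => (h x : ℂ)) k = _
    rw [fourierCoeff_liftIco_eq, fourierCoeffOn_eq_integral]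
    have key : ∀ n : ℕ, ∀ σ : ℝ, (∫ x in (0 : ℝ)..1,
        ((h x * Real.cos (2 * Real.pi * n * x) : ℝ) : ℂ) +
          (σ * Complex.I) * ((h x * Real.sin (2 * Real.pi * n * x) : ℝ) : ℂ)) = a n := fun n σ => by
      rw [intervalIntegral.integral_add (hint _ (by fun_prop))
        ((hint _ (by fun_prop)).const_mul _), intervalIntegral.integral_const_mul,
        intervalIntegral.integral_ofReal, intervalIntegral.integral_ofReal, hsin, ha]
      simp
    have hexp : ∀ x y : ℝ, Complex.exp (y * Complex.I) * h x =
        ((h x * Real.cos y : ℝ) : ℂ) + Complex.I * ((h x * Real.sin y : ℝ) : ℂ) := fun x y => by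
      rw [Complex.exp_mul_I]; push_cast; ring
    simp only [zero_add, sub_zero, div_one, one_smul, smul_eq_mul, fourier_coe_apply]
    obtain ⟨n, rfl | rfl⟩ := k.eq_nat_or_neg
    · rw [Int.natAbs_natCast, ← key n (-1)]
      congr 1
      ext x
      rw [show 2 * (Real.pi : ℂ) * Complex.I * ((-(n : ℤ) : ℤ) : ℂ) * x / ((1 : ℝ) : ℂ) =
        ((-(2 * Real.pi * n * x) : ℝ) : ℂ) * Complex.I by push_cast; ring, hexp, Real.cos_neg,
        Real.sin_neg]
      push_cast; ring
    · rw [Int.natAbs_neg, Int.natAbs_natCast, ← key n 1]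
      congr 1
      ext x
      rw [show 2 * (Real.pi : ℂ) * Complex.I * ((-(-(n : ℤ)) : ℤ) : ℂ) * x / ((1 : ℝ) : ℂ) =
        (((2 * Real.pi * n * x) : ℝ) : ℂ) * Complex.I by push_cast; ring, hexp]
      push_cast; ring
  have hsum : Summable (fourierCoeff B) := by
    refine Summable.of_nat_of_neg ?_ ?_
    · simpa [hcoef] using Complex.hasSum_ofReal.2 hs.hasSum |>.summable
    · simpa [hcoef] using Complex.hasSum_ofReal.2 hs.hasSum |>.summable
  have h1 := has_pointwise_sum_fourier_series_of_summable hsum (x : AddCircle (1 : ℝ))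
  have h2 := Complex.hasSum_re h1.nat_add_neg
  have hB : B (x : AddCircle (1 : ℝ)) = h x :=
    AddCircle.liftIco_coe_apply (f := fun x => (h x : ℂ))
      (show x ∈ Set.Ico 0 (0 + 1) by rwa [zero_add])
  have e : ∀ n : ℕ, (fourierCoeff B n • fourier n (x : AddCircle (1 : ℝ)) +
      fourierCoeff B (-n : ℤ) • fourier (-n : ℤ) (x : AddCircle (1 : ℝ))).re =
        2 * (a n * Real.cos (2 * Real.pi * n * x)) := fun n => by
    rw [hcoef, hcoef, fourier_coe_apply, fourier_coe_apply, Int.natAbs_neg, Int.natAbs_natCast,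
      show 2 * (Real.pi : ℂ) * Complex.I * ((n : ℤ) : ℂ) * x / ((1 : ℝ) : ℂ) =
        (((2 * Real.pi * n * x) : ℝ) : ℂ) * Complex.I by push_cast; ring,
      show 2 * (Real.pi : ℂ) * Complex.I * ((-(n : ℤ) : ℤ) : ℂ) * x / ((1 : ℝ) : ℂ) =
        ((-(2 * Real.pi * n * x) : ℝ) : ℂ) * Complex.I by push_cast; ring]
    rw [Complex.add_re, smul_eq_mul, smul_eq_mul, Complex.re_ofReal_mul, Complex.re_ofReal_mul,
      Complex.exp_ofReal_mul_I_re, Complex.exp_ofReal_mul_I_re, Real.cos_neg]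
    ring
  simp only [e] at h2
  have h3 := h2.div_const 2
  simp only [mul_div_cancel_left₀ _ (two_ne_zero (α := ℝ))] at h3
  have h4 := (hasSum_nat_add_iff' 1).2 h3
  have e5 : (B (x : AddCircle (1 : ℝ)) +
      fourierCoeff B 0 • fourier 0 (x : AddCircle (1 : ℝ))).re / 2 -
        ∑ i ∈ Finset.range 1, a i * Real.cos (2 * Real.pi * i * x) = (h x - a 0) / 2 := by
    rw [hB, hcoef]
    simp
    ring
  rwa [e5] at h4

/-! ### The sums over the shifts -/

/-- `∑_{K ≥ 0} 2^{-K-1} (x + K)^s`. -/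
noncomputable def shiftSum (s x : ℝ) : ℝ := ∑' K : ℕ, (1 / 2) ^ (K + 1) * (x + K) ^ s

theorem summable_half_pow_mul : Summable fun K : ℕ => (1 / 2 : ℝ) ^ (K + 1) * (K + 1 : ℝ) := by
  simpa using summable_geometric_mul_log_pow 0 (δ := 1) le_rfl

theorem shift_rpow_mem {s : ℝ} (h0 : 0 ≤ s) (h1 : s ≤ 1) (K : ℕ) {x : ℝ}
    (hx : x ∈ Set.Icc (0 : ℝ) 1) : 0 ≤ (x + K) ^ s ∧ (x + K) ^ s ≤ K + 1 := by
  have hx0 : 0 ≤ x + K := add_nonneg hx.1 (Nat.cast_nonneg _)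
  refine ⟨Real.rpow_nonneg hx0 _, ?_⟩
  refine (Real.rpow_le_rpow hx0 (by linarith [hx.2] : x + K ≤ K + 1) h0).trans ?_
  have : (1 : ℝ) ≤ K + 1 := by simp
  simpa using Real.rpow_le_rpow_of_exponent_le this h1

theorem summable_shiftSum {s : ℝ} (h0 : 0 ≤ s) (h1 : s ≤ 1) {x : ℝ} (hx : x ∈ Set.Icc (0 : ℝ) 1) :
    Summable fun K : ℕ => (1 / 2) ^ (K + 1) * (x + K) ^ s :=
  Summable.of_norm_bounded summable_half_pow_mul fun K => by
    rw [norm_mul, Real.norm_of_nonneg (by positivity),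
      Real.norm_of_nonneg (shift_rpow_mem h0 h1 K hx).1]
    exact mul_le_mul_of_nonneg_left (shift_rpow_mem h0 h1 K hx).2 (by positivity)

theorem continuousOn_shiftSum {s : ℝ} (h0 : 0 ≤ s) (h1 : s ≤ 1) :
    ContinuousOn (shiftSum s) (Set.Icc 0 1) := by
  refine continuousOn_tsum (fun K => ?_) summable_half_pow_mul fun K x hx => ?_
  · exact (continuous_const.mul ((continuous_id.add continuous_const).rpow_const
      fun x => Or.inr h0)).continuousOn
  · rw [norm_mul, Real.norm_of_nonneg (by positivity),
      Real.norm_of_nonneg (shift_rpow_mem h0 h1 K hx).1]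
    exact mul_le_mul_of_nonneg_left (shift_rpow_mem h0 h1 K hx).2 (by positivity)

theorem measurable_shiftSum (s : ℝ) : Measurable (shiftSum s) :=
  Measurable.tsum fun K => by fun_prop

theorem hasSum_integral_shiftSum {s : ℝ} (h0 : 0 ≤ s) (h1 : s ≤ 1) {μ : Measure ℝ}
    [IsFiniteMeasure μ] (hμ : ∀ᵐ x ∂μ, x ∈ Set.Icc (0 : ℝ) 1) {φ : ℝ → ℝ} (hφ : Measurable φ)
    (hφ1 : ∀ x, |φ x| ≤ 1) :
    HasSum (fun K : ℕ => (1 / 2) ^ (K + 1) * ∫ x, (x + K) ^ s * φ x ∂μ)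
      (∫ x, shiftSum s x * φ x ∂μ) := by
  have hb : ∀ K : ℕ, ∀ x ∈ Set.Icc (0 : ℝ) 1,
      ‖(1 / 2) ^ (K + 1) * ((x + K) ^ s * φ x)‖ ≤ (1 / 2) ^ (K + 1) * (K + 1 : ℝ) := by
    intro K x hx
    rw [norm_mul, norm_mul, Real.norm_of_nonneg (by positivity : (0 : ℝ) ≤ (1 / 2) ^ (K + 1)),
      Real.norm_of_nonneg (shift_rpow_mem h0 h1 K hx).1]
    refine mul_le_mul_of_nonneg_left ?_ (by positivity)
    exact (mul_le_of_le_one_right (shift_rpow_mem h0 h1 K hx).1 (hφ1 x)).trans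
      (shift_rpow_mem h0 h1 K hx).2
  have := hasSum_integral_of_dominated_convergence (μ := μ)
    (F := fun K : ℕ => fun x => (1 / 2) ^ (K + 1) * ((x + K) ^ s * φ x))
    (f := fun x => shiftSum s x * φ x) (fun K _ => (1 / 2) ^ (K + 1) * (K + 1 : ℝ))
    (fun K => Measurable.aestronglyMeasurable (by fun_prop))
    (fun K => hμ.mono fun x hx => hb K x hx)
    (.of_forall fun _ => summable_half_pow_mul) (integrable_const _)
    (hμ.mono fun x hx => by
      rw [shiftSum, ← tsum_mul_right]
      simpa only [mul_assoc] using ((summable_shiftSum h0 h1 hx).mul_right (φ x)).hasSum)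
  simpa only [integral_const_mul] using this

/-! ### Fourier coefficients of the shift sums -/

theorem cosMellin_zero {s : ℝ} (h0 : 0 < s) (h1 : s < 1) (n : ℕ) (hn : 1 ≤ n) :
    IntegrableOn (fun x => (1 - Real.cos (2 * Real.pi * n * x)) * ((1 * x) ^ s / x ^ 2))
      (Set.Ioi 0) ∧
    cosMellin 0 n 1 s = 2 * Real.pi * n * ((2 * Real.pi * n) ^ s)⁻¹ *
      (Real.Gamma s * Real.sin (Real.pi / 2 * s) / (1 - s)) := by
  have hn' : (0 : ℝ) < n := by exact_mod_cast hn
  set b : ℝ := 2 * Real.pi * n with hb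
  have hb0 : 0 < b := by have := Real.pi_pos; positivity
  have hbs : 0 < b ^ s := Real.rpow_pos_of_pos hb0 s
  have e : ∀ x ∈ Set.Ioi (0 : ℝ), (1 - Real.cos (b * x)) * ((1 * x) ^ s / x ^ 2) =
      b ^ 2 * (b ^ s)⁻¹ * ((1 - Real.cos (b * x)) * ((b * x) ^ s / (b * x) ^ 2)) := fun x hx => by
    have hx : (0 : ℝ) < x := hx
    rw [one_mul, Real.mul_rpow hb0.le hx.le]
    field_simp
  constructor
  · have h2 := (integrableOn_Ioi_comp_mul_left_iff
      (fun x => (1 - Real.cos x) * (x ^ s / x ^ 2)) 0 hb0).2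
        (by rw [mul_zero]; exact integrableOn_one_sub_cos_mul_rpow h0 h1)
    exact IntegrableOn.congr_fun (h2.const_mul _) (fun x hx => (e x hx).symm) measurableSet_Ioi
  · rw [cosMellin, setIntegral_congr_fun measurableSet_Ioi e, integral_const_mul,
      integral_comp_mul_left_Ioi (fun x => (1 - Real.cos x) * (x ^ s / x ^ 2)) 0 hb0, mul_zero,
      integral_one_sub_cos_mul_rpow h0 h1, smul_eq_mul]
    field_simp

theorem continuous_rpow_mul_one_sub_cos_div {s : ℝ} (h0 : 0 < s) (b : ℝ) :
    ContinuousOn (fun x : ℝ => x ^ s * ((1 - Real.cos (b * x)) / x)) (Set.Ici 0) := by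
  intro x hx
  rcases (show (0 : ℝ) ≤ x from hx).eq_or_lt with rfl | hx
  · rw [ContinuousWithinAt]
    simp only [div_zero, mul_zero]
    have hlim : Tendsto (fun x : ℝ => x ^ s * (b ^ 2 / 2 * x)) (𝓝[Set.Ici 0] 0) (𝓝 0) := by
      have : Continuous fun x : ℝ => x ^ s * (b ^ 2 / 2 * x) :=
        (Real.continuous_rpow_const h0.le).mul (by fun_prop)
      have h := (this.tendsto 0).mono_left (nhdsWithin_le_nhds (s := Set.Ici 0))
      simpa using h
    refine squeeze_zero' ?_ ?_ hlim
    · filter_upwards [self_mem_nhdsWithin] with x hx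
      have hx : (0 : ℝ) ≤ x := hx
      exact mul_nonneg (Real.rpow_nonneg hx _) (div_nonneg (one_sub_cos_mem _).1 hx)
    · filter_upwards [self_mem_nhdsWithin] with x hx
      have hx : (0 : ℝ) ≤ x := hx
      refine mul_le_mul_of_nonneg_left ?_ (Real.rpow_nonneg hx _)
      rcases hx.eq_or_lt with rfl | hx
      · simp
      rw [div_le_iff₀ hx]
      have := Real.one_sub_sq_div_two_le_cos (x := b * x)
      nlinarith
  · refine ContinuousAt.continuousWithinAt ?_
    exact (Real.continuousAt_rpow_const x s (Or.inl hx.ne')).mul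
      ((by fun_prop : ContinuousAt (fun x => 1 - Real.cos (b * x)) x).div continuousAt_id hx.ne')

/-- Two integrations by parts on `[K, K + 1]`; all boundary terms vanish. -/
theorem integral_rpow_mul_cos {s : ℝ} (h0 : 0 < s) (h1 : s < 1) (n : ℕ) (hn : 1 ≤ n) (K : ℕ) :
    ∫ x in (K : ℝ)..(K + 1 : ℕ), x ^ s * Real.cos (2 * Real.pi * n * x) =
      -(s * (1 - s) / (2 * Real.pi * n) ^ 2) * ∫ x in (K : ℝ)..(K + 1 : ℕ),
        (1 - Real.cos (2 * Real.pi * n * x)) * ((1 * x) ^ s / x ^ 2) := by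
  have hn' : (0 : ℝ) < n := by exact_mod_cast hn
  have hcos : ∀ m : ℕ, Real.cos (2 * Real.pi * n * m) = 1 := fun m => cos_two_pi_mul_nat n m
  have hsin : ∀ m : ℕ, Real.sin (2 * Real.pi * n * m) = 0 := fun m => by
    rw [show 2 * Real.pi * (n : ℝ) * m = ((2 * (n * m) : ℕ) : ℝ) * Real.pi by push_cast; ring]
    exact Real.sin_nat_mul_pi _
  have hint := (cosMellin_zero h0 h1 n hn).1
  set b : ℝ := 2 * Real.pi * n with hb
  have hb0 : 0 < b := by have := Real.pi_pos; positivity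
  have hK : (K : ℝ) ≤ (K + 1 : ℕ) := by push_cast; linarith
  have hK0 : (0 : ℝ) ≤ K := Nat.cast_nonneg K
  have i1 : IntervalIntegrable (fun x => x ^ s * Real.cos (b * x)) volume K (K + 1 : ℕ) :=
    Continuous.intervalIntegrable ((Real.continuous_rpow_const h0.le).mul (by fun_prop)) _ _
  have i2 : IntervalIntegrable (fun x => (1 - Real.cos (b * x)) * ((1 * x) ^ s / x ^ 2)) volume K
      (K + 1 : ℕ) := by
    rw [intervalIntegrable_iff_integrableOn_Ioc_of_le hK]
    exact hint.mono_set fun x hx => lt_of_le_of_lt hK0 hx.1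
  have hftc := intervalIntegral.integral_eq_sub_of_hasDerivAt_of_le hK
    (f := fun x => x ^ s * Real.sin (b * x) / b -
      s / b ^ 2 * (x ^ s * ((1 - Real.cos (b * x)) / x)))
    (f' := fun x => x ^ s * Real.cos (b * x) +
      s * (1 - s) / b ^ 2 * ((1 - Real.cos (b * x)) * ((1 * x) ^ s / x ^ 2)))
    (by
      refine ContinuousOn.sub (((Real.continuous_rpow_const h0.le).mul
        (by fun_prop)).div_const b).continuousOn (continuousOn_const.mul ?_)
      exact (continuous_rpow_mul_one_sub_cos_div h0 b).mono fun x hx => hK0.trans hx.1)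
    (fun x hx => by
      have hx0 : 0 < x := lt_of_le_of_lt hK0 hx.1
      have d1 : HasDerivAt (fun x : ℝ => x ^ s) (s * x ^ (s - 1)) x :=
        Real.hasDerivAt_rpow_const (Or.inl hx0.ne')
      have d2 : HasDerivAt (fun x : ℝ => Real.sin (b * x)) (Real.cos (b * x) * b) x := by
        simpa using ((hasDerivAt_id x).const_mul b).sin
      have d3 : HasDerivAt (fun x : ℝ => 1 - Real.cos (b * x)) (Real.sin (b * x) * b) x := by
        simpa using (((hasDerivAt_id x).const_mul b).cos).const_sub 1
      have d4 := ((d1.mul d2).div_const b).sub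
        ((d1.mul (d3.div (hasDerivAt_id x) hx0.ne')).const_mul (s / b ^ 2))
      refine d4.congr_deriv ?_
      simp only [Pi.div_apply, id]
      rw [Real.rpow_sub_one hx0.ne', one_mul]
      field_simp
      ring)
    (i1.add (i2.const_mul _))
  rw [intervalIntegral.integral_add i1 (i2.const_mul _),
    intervalIntegral.integral_const_mul] at hftc
  simp only [hcos, hsin] at hftc
  simp only [mul_zero, zero_div, sub_self] at hftc
  linarith

/-- The coefficient of the Fourier series of the symmetrised `shiftSum s`, up to the factor
`-1/2`. Its Taylor coefficients at `s = 0` are the `xi r n / r!`. -/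
noncomputable def xiFun (n : ℕ) (s : ℝ) : ℝ := (n : ℝ)⁻¹ * ((n : ℝ)⁻¹ ^ s * H s) - etaFun n s

theorem cosMellin_nat_add_one (n K : ℕ) (s : ℝ) : cosMellin (K + 1 : ℕ) n 1 s =
    1 / (K + 1 : ℕ) * cosMellin 1 ((K + 1 : ℕ) * n) (K + 1 : ℕ) s := by
  rw [cosMellin_scale (by positivity) zero_le_one,
    cosMellin_eq_rpow_mul zero_le_one (Nat.cast_nonneg _), mul_comm (n : ℝ)]
  ring

theorem integral_shift_eq {s : ℝ} (h0 : 0 < s) (h1 : s < 1) (n : ℕ) (hn : 1 ≤ n) (K : ℕ) :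
    ∫ x in Set.Icc (0 : ℝ) 1, (x + K) ^ s * Real.cos (2 * Real.pi * n * x) =
      -(s * (1 - s) / (2 * Real.pi * n) ^ 2) *
        (cosMellin K n 1 s - cosMellin (K + 1 : ℕ) n 1 s) := by
  have hK : (K : ℝ) ≤ (K + 1 : ℕ) := by push_cast; linarith
  have hK0 : (0 : ℝ) ≤ K := Nat.cast_nonneg K
  have hint := (cosMellin_zero h0 h1 n hn).1
  have e1 : cosMellin K n 1 s - cosMellin (K + 1 : ℕ) n 1 s = ∫ x in (K : ℝ)..(K + 1 : ℕ),
      (1 - Real.cos (2 * Real.pi * n * x)) * ((1 * x) ^ s / x ^ 2) := by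
    rw [intervalIntegral.integral_of_le hK, cosMellin, cosMellin, ← Set.Ioc_union_Ioi_eq_Ioi hK,
      setIntegral_union (Set.Ioc_disjoint_Ioi le_rfl) measurableSet_Ioi]
    · ring
    · exact hint.mono_set fun x hx => lt_of_le_of_lt hK0 hx.1
    · exact hint.mono_set fun x hx => lt_of_le_of_lt (hK0.trans hK) hx
  rw [e1, ← integral_rpow_mul_cos h0 h1 n hn K, integral_Icc_eq_integral_Ioc,
    ← intervalIntegral.integral_of_le zero_le_one]
  have := intervalIntegral.integral_comp_add_right (a := 0) (b := 1)
    (fun x => x ^ s * Real.cos (2 * Real.pi * n * x)) (K : ℝ)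
  rw [zero_add, show (1 : ℝ) + K = (K + 1 : ℕ) by push_cast; ring] at this
  rw [← this]
  congr 1
  ext x
  rw [show 2 * Real.pi * n * (x + K) = 2 * Real.pi * n * x + ((n * K : ℕ) : ℝ) * (2 * Real.pi) by
    push_cast; ring, Real.cos_add_nat_mul_two_pi]

theorem summable_cosMellin_nat (n : ℕ) {s : ℝ} (h0 : 0 ≤ s) (h1 : s ≤ 1 / 2) :
    Summable fun K : ℕ => (1 / 2) ^ (K + 1) * cosMellin (K + 1 : ℕ) n 1 s := by
  refine Summable.of_norm_bounded (hasSum_half_pow.summable.mul_right (8 * logBound 0)) fun K => ?_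
  have hK : (1 : ℝ) ≤ (K + 1 : ℕ) := by exact_mod_cast Nat.succ_le_succ K.zero_le
  have := abs_cosMellin_sub_le hK le_rfl (n : ℝ) 0 h0 h1
  simp only [Finset.range_zero, Finset.sum_empty, sub_zero, pow_zero, mul_one] at this
  rw [norm_mul, Real.norm_of_nonneg (by positivity)]
  exact mul_le_mul_of_nonneg_left this (by positivity)

/-- The Fourier coefficients of `shiftSum s`. -/
theorem integral_shiftSum_mul_cos {s : ℝ} (h0 : 0 < s) (h1 : s ≤ 1 / 2) (n : ℕ) (hn : 1 ≤ n) :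
    ∫ x in Set.Icc (0 : ℝ) 1, shiftSum s x * Real.cos (2 * Real.pi * n * x) =
      -(1 / 2 * xiFun n s) := by
  have hn' : (0 : ℝ) < n := by exact_mod_cast hn
  have hπ := Real.pi_pos
  have hsum := hasSum_integral_shiftSum h0.le (by linarith : s ≤ 1)
    (μ := volume.restrict (Set.Icc 0 1)) (ae_restrict_mem measurableSet_Icc)
    (φ := fun x => Real.cos (2 * Real.pi * n * x)) (by fun_prop) (fun x => Real.abs_cos_le_one _)
  simp only [integral_shift_eq h0 (by linarith : s < 1) n hn] at hsum
  have ht := summable_cosMellin_nat n h0.le h1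
  have e2 : ∑' K : ℕ, (1 / 2 : ℝ) ^ (K + 1) * cosMellin (K + 1 : ℕ) n 1 s =
      oscSum 1 (fun K => (K + 1 : ℕ) * n) s := by
    rw [oscSum]; congr 1; ext K; rw [cosMellin_nat_add_one]; ring
  have h2 : HasSum (fun K : ℕ => (1 / 2 : ℝ) ^ (K + 1) * cosMellin K n 1 s)
      (1 / 2 * cosMellin 0 n 1 s + 1 / 2 * oscSum 1 (fun K => (K + 1 : ℕ) * n) s) := by
    rw [← hasSum_nat_add_iff' 1]
    have := ht.hasSum.mul_left (1 / 2)
    have e : ∀ K : ℕ, 1 / 2 * ((1 / 2) ^ (K + 1) * cosMellin (K + 1 : ℕ) n 1 s) =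
      (1 / 2 : ℝ) ^ (K + 1 + 1) * cosMellin (K + 1 : ℕ) n 1 s := fun K => by ring
    simp only [e] at this
    rw [e2] at this
    have e3 : 1 / 2 * cosMellin 0 n 1 s + 1 / 2 * oscSum 1 (fun K => (K + 1 : ℕ) * n) s -
        ∑ i ∈ Finset.range 1, (1 / 2 : ℝ) ^ (i + 1) * cosMellin i n 1 s =
          1 / 2 * oscSum 1 (fun K => (K + 1 : ℕ) * n) s := by simp
    rw [e3]
    exact this
  have h3 := (h2.sub ht.hasSum).mul_left (-(s * (1 - s) / (2 * Real.pi * n) ^ 2))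
  rw [e2] at h3
  have e4 : ∀ K : ℕ, -(s * (1 - s) / (2 * Real.pi * n) ^ 2) *
      ((1 / 2) ^ (K + 1) * cosMellin K n 1 s - (1 / 2) ^ (K + 1) * cosMellin (K + 1 : ℕ) n 1 s) =
      (1 / 2) ^ (K + 1) * (-(s * (1 - s) / (2 * Real.pi * n) ^ 2) *
        (cosMellin K n 1 s - cosMellin (K + 1 : ℕ) n 1 s)) := fun K => by ring
  simp only [e4] at h3
  rw [hsum.unique h3, (cosMellin_zero h0 (by linarith) n hn).2, xiFun, H, etaFun, add_comm 1 s,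
    Real.Gamma_add_one h0.ne', Real.mul_rpow (by positivity) hn'.le, Real.inv_rpow hn'.le,
    Real.inv_rpow (by positivity)]
  have hs1 : 1 - s ≠ 0 := by linarith
  have := Real.rpow_pos_of_pos hn' s
  have := Real.rpow_pos_of_pos (by positivity : 0 < 2 * Real.pi) s
  field_simp
  ring

section

/-! ### The Mellin transform of a symmetric distribution -/

theorem summable_one_div_rpow {s : ℝ} (h0 : 0 < s) :
    Summable fun n : ℕ => ((n + 1 : ℕ) : ℝ)⁻¹ * ((n + 1 : ℕ) : ℝ)⁻¹ ^ s := by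
  have h := (summable_nat_add_iff 1).2 (Real.summable_one_div_nat_rpow.2 (by linarith : 1 < 1 + s))
  refine h.congr fun n => ?_
  have : (0 : ℝ) < (n + 1 : ℕ) := by positivity
  rw [Real.rpow_add this, Real.rpow_one, Real.inv_rpow this.le]
  field_simp

theorem summable_xiFun {s : ℝ} (h0 : 0 < s) (h1 : s ≤ 1 / 2) :
    Summable fun n : ℕ => xiFun (n + 1) s := by
  have h2 := (summable_one_div_rpow h0).mul_right (H s)
  have h3 := summable_mul_etaFun (e := fun _ => 1) (D := 1) (by simp) h0.le h1
  refine (h2.sub h3).congr fun n => ?_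
  rw [xiFun]
  ring

variable {G : ℝ → ℝ} (h : IsSymmDist G)

theorem shiftSum_zero_add_one {s : ℝ} (h0 : 0 < s) (h1 : s ≤ 1) :
    (shiftSum s 0 + shiftSum s 1) / 2 =
      3 / 4 * ∑' K : ℕ, (1 / 2) ^ (K + 1) * (K + 1 : ℝ) ^ s := by
  have e0 : shiftSum s 0 = 1 / 2 * ∑' K : ℕ, (1 / 2) ^ (K + 1) * (K + 1 : ℝ) ^ s := by
    rw [shiftSum, (summable_shiftSum h0.le h1 ⟨le_rfl, zero_le_one⟩).tsum_eq_zero_add,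
      ← tsum_mul_left]
    simp only [Nat.cast_zero, add_zero, Real.zero_rpow h0.ne', mul_zero, zero_add]
    congr 1; ext K; push_cast; ring
  have e1 : shiftSum s 1 = ∑' K : ℕ, (1 / 2) ^ (K + 1) * (K + 1 : ℝ) ^ s := by
    rw [shiftSum]
    simp only [add_comm (1 : ℝ)]
  rw [e0, e1]; ring

theorem integrable_of_continuousOn_unit {g : ℝ → ℝ} (hg : ContinuousOn g (Set.Icc 0 1))
    (hm : Measurable g) : Integrable g (unitMeasure h) := by
  obtain ⟨C, hC⟩ := isCompact_Icc.exists_bound_of_continuousOn hg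
  exact (integrable_const C).mono' hm.aestronglyMeasurable
    ((ae_mem_unitMeasure h).mono fun x hx => hC x hx)

/-- The Mellin transform of the extended distribution, expressed through the Fourier--Stieltjes
coefficients of `G`. -/
theorem integral_rpow_halfLineMeasure {s : ℝ} (h0 : 0 < s) (h1 : s ≤ 1 / 2) :
    Integrable (fun x => x ^ s) (halfLineMeasure h) ∧
    ∫ x, x ^ s ∂halfLineMeasure h =
      3 / 4 * ∑' K : ℕ, (1 / 2) ^ (K + 1) * (K + 1 : ℝ) ^ s +
        ∑' n : ℕ, xiFun (n + 1) s * (1 - fsCoeff G h.mono (n + 1)) := by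
  have hs1 : s ≤ 1 := by linarith
  have hI := integrable_halfLineMeasure h (f := fun x => x ^ s) (by fun_prop)
    (fun K => (K + 1 : ℝ)) (fun K x hx => by
      have := shift_rpow_mem h0.le hs1 K ⟨hx.1.le, hx.2⟩
      rw [abs_of_nonneg this.1]; exact this.2) summable_half_pow_mul
  refine ⟨hI.1, ?_⟩
  have hI2 := hasSum_integral_shiftSum h0.le hs1 (μ := unitMeasure h) (ae_mem_unitMeasure h)
    (φ := fun _ => 1) measurable_const (by simp)
  simp only [mul_one] at hI2
  rw [hI.2.unique hI2]
  set f : ℝ → ℝ := fun x => (shiftSum s x + shiftSum s (1 - x)) / 2 with hf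
  have hgc := continuousOn_shiftSum h0.le hs1
  have hgc' : ContinuousOn (fun x => shiftSum s (1 - x)) (Set.Icc 0 1) :=
    hgc.comp (by fun_prop) fun x hx => ⟨by linarith [hx.2], by linarith [hx.1]⟩
  have hfc : ContinuousOn f (Set.Icc 0 1) := (hgc.add hgc').div_const 2
  have hfsymm : ∀ x, f (1 - x) = f x := fun x => by simp only [hf, sub_sub_cancel]; ring
  have hcos : ∀ n : ℕ, Continuous fun x => Real.cos (2 * Real.pi * n * x) := fun n => by fun_prop
  have hint : ∀ g : ℝ → ℝ, ContinuousOn g (Set.Icc 0 1) → ∀ n : ℕ,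
      IntervalIntegrable (fun x => g x * Real.cos (2 * Real.pi * n * x)) volume 0 1 :=
    fun g hg n => ContinuousOn.intervalIntegrable (by
      rw [Set.uIcc_of_le zero_le_one]; exact hg.mul (hcos n).continuousOn)
  have hcoef : ∀ n : ℕ, ∫ x in (0 : ℝ)..1, f x * Real.cos (2 * Real.pi * n * x) =
      ∫ x in (0 : ℝ)..1, shiftSum s x * Real.cos (2 * Real.pi * n * x) := fun n => by
    have hsub := intervalIntegral.integral_comp_sub_left (a := 0) (b := 1)
      (fun x => shiftSum s x * Real.cos (2 * Real.pi * n * x)) 1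
    have hc : ∀ x : ℝ, Real.cos (2 * Real.pi * n * (1 - x)) = Real.cos (2 * Real.pi * n * x) :=
      fun x => by
        rw [show 2 * Real.pi * n * (1 - x) = n * (2 * Real.pi) - 2 * Real.pi * n * x by ring,
          Real.cos_nat_mul_two_pi_sub]
    simp only [hc, sub_self, sub_zero] at hsub
    have e : ∀ x, f x * Real.cos (2 * Real.pi * n * x) =
        1 / 2 * (shiftSum s x * Real.cos (2 * Real.pi * n * x)) +
        1 / 2 * (shiftSum s (1 - x) * Real.cos (2 * Real.pi * n * x)) := fun x => by
      simp only [hf]; ring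
    simp only [e]
    rw [intervalIntegral.integral_add ((hint _ hgc n).const_mul _) ((hint _ hgc' n).const_mul _),
      intervalIntegral.integral_const_mul, intervalIntegral.integral_const_mul, hsub]
    ring
  have hcoef' : ∀ n : ℕ, ∫ x in (0 : ℝ)..1,
      shiftSum s x * Real.cos (2 * Real.pi * (n + 1 : ℕ) * x) =
      -(1 / 2 * xiFun (n + 1) s) := fun n => by
    rw [intervalIntegral.integral_of_le zero_le_one, ← integral_Icc_eq_integral_Ioc]
    exact integral_shiftSum_mul_cos h0 h1 (n + 1) (by omega)
  have hxi := summable_xiFun h0 h1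
  have hsum : Summable fun n : ℕ => ∫ x in (0 : ℝ)..1, f x * Real.cos (2 * Real.pi * n * x) := by
    rw [← summable_nat_add_iff 1]
    simp only [hcoef, hcoef']
    exact (hxi.mul_left _).neg
  have hseries := fun x hx => hasSum_cosine_series hfc hfsymm (fun n => rfl) hsum (x := x) hx
  simp only [hcoef, hcoef'] at hseries
  -- the difference with the value at `0` is an absolutely convergent series of `1 - cos`
  have hdiff : ∀ x ∈ Set.Ico (0 : ℝ) 1, HasSum (fun n : ℕ => xiFun (n + 1) s *
      (1 - Real.cos (2 * Real.pi * (n + 1 : ℕ) * x))) (f x - f 0) := fun x hx => by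
    have := ((hseries x hx).sub (hseries 0 ⟨le_rfl, one_pos⟩)).mul_left 2
    have e : (fun n : ℕ => xiFun (n + 1) s * (1 - Real.cos (2 * Real.pi * (n + 1 : ℕ) * x))) =
        fun n : ℕ => 2 * (-(1 / 2 * xiFun (n + 1) s) * Real.cos (2 * Real.pi * (n + 1 : ℕ) * x) -
          -(1 / 2 * xiFun (n + 1) s) * Real.cos (2 * Real.pi * (n + 1 : ℕ) * 0)) := by
      funext n; rw [mul_zero, Real.cos_zero]; ring
    rw [e, show f x - f 0 = 2 * ((f x - ∫ x in (0 : ℝ)..1, shiftSum s x *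
      Real.cos (2 * Real.pi * (0 : ℕ) * x)) / 2 - (f 0 - ∫ x in (0 : ℝ)..1, shiftSum s x *
      Real.cos (2 * Real.pi * (0 : ℕ) * x)) / 2) by ring]
    exact this
  have hae : ∀ᵐ x ∂unitMeasure h, x ∈ Set.Ico (0 : ℝ) 1 := by
    have h2 : ∀ᵐ x ∂unitMeasure h, x ≠ 1 := by
      rw [ae_iff]; simp
    filter_upwards [ae_mem_unitMeasure h, h2] with x hx hx1
    exact ⟨hx.1, lt_of_le_of_ne hx.2 hx1⟩
  have hcI : ∀ n : ℕ, Integrable (fun x => Real.cos (2 * Real.pi * n * x)) (unitMeasure h) :=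
    fun n => (integrable_const (1 : ℝ)).mono' (hcos n).measurable.aestronglyMeasurable
      (.of_forall fun x => Real.abs_cos_le_one _)
  have hmain := hasSum_integral_of_dominated_convergence (μ := unitMeasure h)
    (F := fun n : ℕ => fun x => xiFun (n + 1) s * (1 - Real.cos (2 * Real.pi * (n + 1 : ℕ) * x)))
    (f := fun x => f x - f 0) (fun n _ => |xiFun (n + 1) s| * 2)
    (fun n => Measurable.aestronglyMeasurable (by fun_prop))
    (fun n => .of_forall fun x => by
      rw [norm_mul, Real.norm_eq_abs, Real.norm_eq_abs, abs_of_nonneg (one_sub_cos_mem _).1]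
      exact mul_le_mul_of_nonneg_left (one_sub_cos_mem _).2 (abs_nonneg _))
    (.of_forall fun _ => hxi.abs.mul_right 2) (integrable_const _)
    (hae.mono fun x hx => hdiff x hx)
  have e1 : ∀ n : ℕ, ∫ x, xiFun (n + 1) s * (1 - Real.cos (2 * Real.pi * (n + 1 : ℕ) * x))
      ∂unitMeasure h = xiFun (n + 1) s * (1 - fsCoeff G h.mono (n + 1)) := fun n => by
    rw [integral_const_mul, integral_sub (integrable_const _) (hcI _), fsCoeff_eq h]
    simp
  simp only [e1] at hmain
  rw [hmain.tsum_eq]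
  have hgI : Integrable (shiftSum s) (unitMeasure h) := by
    have := integrable_of_continuousOn_unit h hgc (measurable_shiftSum s)
    exact this
  have hgI' : Integrable (fun x => shiftSum s (1 - x)) (unitMeasure h) := by
    have := integrable_of_continuousOn_unit h hgc' ((measurable_shiftSum s).comp (by fun_prop))
    exact this
  have hsw : ∫ x, shiftSum s (1 - x) ∂unitMeasure h = ∫ x, shiftSum s x ∂unitMeasure h := by
    conv_rhs => rw [← map_one_sub_unitMeasure h]
    rw [integral_map (by fun_prop) (measurable_shiftSum s).aestronglyMeasurable]
  have hfI : Integrable f (unitMeasure h) := (hgI.add hgI').div_const 2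
  rw [integral_sub hfI (integrable_const _)]
  have hf0 : f 0 = 3 / 4 * ∑' K : ℕ, (1 / 2) ^ (K + 1) * (K + 1 : ℝ) ^ s := by
    simp only [hf, sub_zero]; exact shiftSum_zero_add_one h0 hs1
  have hfi : ∫ x, f x ∂unitMeasure h = ∫ x, shiftSum s x ∂unitMeasure h := by
    simp only [hf]
    rw [integral_div, integral_add hgI hgI', hsw]
    ring
  rw [hfi, integral_const, hf0]
  simp

end

section

/-! ### The expansion of the Mellin transform -/

theorem HasExpansion.of_id_mul {f : ℝ → ℝ} {p : PowerSeries ℝ}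
    (hf : HasExpansion (fun s => s * f s) p) (h0 : PowerSeries.coeff 0 p = 0) :
    HasExpansion f (PowerSeries.mk fun r => PowerSeries.coeff (r + 1) p) := fun N => by
  obtain ⟨C, hC⟩ := (hf (N + 1)).bound
  refine Asymptotics.IsBigO.of_bound C ?_
  filter_upwards [hC, self_mem_nhdsWithin] with s hs h1
  have h1 : 0 < s := h1
  have e : s * f s - ∑ k ∈ Finset.range (N + 1), PowerSeries.coeff k p * s ^ k =
      s * (f s - ∑ k ∈ Finset.range N, PowerSeries.coeff k (PowerSeries.mk fun r =>
        PowerSeries.coeff (r + 1) p) * s ^ k) := by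
    rw [Finset.sum_range_succ', h0, mul_sub, Finset.mul_sum]
    simp only [PowerSeries.coeff_mk, zero_mul, add_zero]
    congr 1
    exact Finset.sum_congr rfl fun k _ => by ring
  rw [e, norm_mul, pow_succ, norm_mul, mul_comm, mul_comm ‖s ^ N‖, ← mul_assoc, mul_comm C,
    mul_comm ‖f s - _‖, mul_assoc] at hs
  exact le_of_mul_le_mul_left hs (norm_pos_iff.2 h1.ne')

theorem coeff_zero_HSeries : PowerSeries.coeff 0 HSeries = 0 := by
  simp [HSeries, PowerSeries.coeff_mul, PowerSeries.coeff_rescale, PowerSeries.sin]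

theorem riemannZeta_re_eq_tsum {s : ℝ} (h0 : 0 < s) : (riemannZeta (1 + s)).re =
    ∑' n : ℕ, ((n + 1 : ℕ) : ℝ)⁻¹ * ((n + 1 : ℕ) : ℝ)⁻¹ ^ s := by
  rw [zeta_eq_tsum_one_div_nat_add_one_cpow (by simpa using h0)]
  have e : ∀ n : ℕ, 1 / ((n : ℂ) + 1) ^ (1 + (s : ℂ)) =
      ((((n + 1 : ℕ) : ℝ)⁻¹ * ((n + 1 : ℕ) : ℝ)⁻¹ ^ s : ℝ) : ℂ) := fun n => by
    have : (0 : ℝ) < (n + 1 : ℕ) := by positivity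
    rw [Real.inv_rpow this.le, ← mul_inv, ← Real.rpow_one_add' this.le (by positivity),
      Complex.ofReal_inv, Complex.ofReal_cpow this.le]
    push_cast
    rw [one_div]
  simp only [e]
  rw [← Complex.ofReal_tsum, Complex.ofReal_re]

/-- The part of `xi r n` coming from `n^{-s-1} H(s)`. -/
noncomputable def xiLead (r n : ℕ) : ℝ :=
  r.factorial * PowerSeries.coeff r (PowerSeries.C (1 / (n : ℝ)) * powSeries (n : ℝ)⁻¹ * HSeries)

theorem xi_eq (r n : ℕ) : xi r n = xiLead r n - eta r n := rfl

variable {e : ℕ → ℝ}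

theorem abs_mul_log_term_le (k n : ℕ) :
    |e n * (((n + 1 : ℕ) : ℝ)⁻¹ * PowerSeries.coeff k (powSeries ((n + 1 : ℕ) : ℝ)⁻¹))| ≤
      |e n| * Real.log (n + 1) ^ k / (n + 1) := by
  have hl : 0 ≤ Real.log ((n : ℝ) + 1) := Real.log_nonneg (by simp)
  have hk : (1 : ℝ) ≤ k.factorial := by exact_mod_cast Nat.factorial_pos k
  rw [coeff_powSeries, Real.log_inv, abs_mul, abs_mul, abs_div, abs_pow, abs_neg, Nat.abs_cast,
    abs_of_nonneg (by positivity : (0 : ℝ) ≤ ((n + 1 : ℕ) : ℝ)⁻¹)]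
  push_cast
  rw [abs_of_nonneg hl]
  calc _ ≤ |e n| * (((n : ℝ) + 1)⁻¹ * Real.log (n + 1) ^ k) := by
        gcongr
        exact div_le_self (by positivity) hk
    _ = _ := by rw [div_eq_mul_inv]; ring

theorem hasExpansion_dirichlet
    (he : ∀ j : ℕ, Summable fun n : ℕ => |e n| * Real.log (n + 1) ^ j / (n + 1)) :
    HasExpansion (fun s => ∑' n : ℕ, e n * (((n + 1 : ℕ) : ℝ)⁻¹ * ((n + 1 : ℕ) : ℝ)⁻¹ ^ s))
      (PowerSeries.mk fun k => ∑' n : ℕ, e n * (((n + 1 : ℕ) : ℝ)⁻¹ *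
        PowerSeries.coeff k (powSeries ((n + 1 : ℕ) : ℝ)⁻¹))) := by
  refine .tsum (fun N n => |e n| * Real.log (n + 1) ^ N / (n + 1)) one_pos
    (fun k => Summable.of_norm_bounded (he k) fun n => abs_mul_log_term_le k n) he ?_
  intro N n s h0 _
  have hn : (1 : ℝ) ≤ (n + 1 : ℕ) := by exact_mod_cast Nat.succ_le_succ n.zero_le
  have hn1 : ((n + 1 : ℕ) : ℝ)⁻¹ ≤ 1 := inv_le_one_of_one_le₀ hn
  have h1 := abs_rpow_sub_sum_le N (x := ((n + 1 : ℕ) : ℝ)⁻¹) (by positivity) h0.le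
  rw [max_eq_left (Real.rpow_le_one (by positivity) hn1 h0.le), mul_one, Real.log_inv, abs_neg,
    abs_of_nonneg (Real.log_nonneg hn)] at h1
  have e1 : e n * (((n + 1 : ℕ) : ℝ)⁻¹ * ((n + 1 : ℕ) : ℝ)⁻¹ ^ s) - ∑ k ∈ Finset.range N,
      e n * (((n + 1 : ℕ) : ℝ)⁻¹ * PowerSeries.coeff k (powSeries ((n + 1 : ℕ) : ℝ)⁻¹)) * s ^ k =
      e n * ((n + 1 : ℕ) : ℝ)⁻¹ * (((n + 1 : ℕ) : ℝ)⁻¹ ^ s - ∑ k ∈ Finset.range N,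
        (-Real.log (n + 1 : ℕ)) ^ k / k.factorial * s ^ k) := by
    rw [mul_sub, Finset.mul_sum]
    simp only [coeff_powSeries, Real.log_inv]
    congr 1
    · ring
    · exact Finset.sum_congr rfl fun k _ => by ring
  rw [e1, abs_mul, abs_mul, abs_of_nonneg (by positivity : (0 : ℝ) ≤ ((n + 1 : ℕ) : ℝ)⁻¹)]
  refine (mul_le_mul_of_nonneg_left h1 (by positivity)).trans_eq ?_
  push_cast
  rw [div_eq_mul_inv]; ring

theorem xiLead_div_factorial (r n : ℕ) :
    PowerSeries.coeff r (HSeries * PowerSeries.mk fun k =>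
      e n * (((n + 1 : ℕ) : ℝ)⁻¹ * PowerSeries.coeff k (powSeries ((n + 1 : ℕ) : ℝ)⁻¹))) =
      xiLead r (n + 1) * e n / r.factorial := by
  have hr : (r.factorial : ℝ) ≠ 0 := by exact_mod_cast r.factorial_ne_zero
  have e1 : (PowerSeries.mk fun k => e n * (((n + 1 : ℕ) : ℝ)⁻¹ *
      PowerSeries.coeff k (powSeries ((n + 1 : ℕ) : ℝ)⁻¹))) =
      PowerSeries.C (e n) * (PowerSeries.C (1 / ((n + 1 : ℕ) : ℝ)) *
        powSeries ((n + 1 : ℕ) : ℝ)⁻¹) := by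
    ext k
    simp [PowerSeries.coeff_C_mul]
  rw [e1, mul_left_comm, PowerSeries.coeff_C_mul, mul_comm HSeries, xiLead]
  field_simp

theorem summable_mul_xiLead
    (he : ∀ j : ℕ, Summable fun n : ℕ => |e n| * Real.log (n + 1) ^ j / (n + 1)) (r : ℕ) :
    Summable fun n : ℕ => xiLead r (n + 1) * e n := by
  have hr : (r.factorial : ℝ) ≠ 0 := by exact_mod_cast r.factorial_ne_zero
  have h1 : Summable fun n => xiLead r (n + 1) * e n / r.factorial := by
    simp only [← xiLead_div_factorial, PowerSeries.coeff_mul, PowerSeries.coeff_mk]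
    exact summable_sum fun p _ => Summable.mul_left _
      (Summable.of_norm_bounded (he p.2) fun n => abs_mul_log_term_le p.2 n)
  simpa [hr] using h1.mul_right (r.factorial : ℝ)

theorem summable_xi_mul (he1 : ∀ n, |e n| ≤ 1)
    (he : ∀ j : ℕ, Summable fun n : ℕ => |e n| * Real.log (n + 1) ^ j / (n + 1)) (r : ℕ) :
    Summable fun n : ℕ => |xi r (n + 1) * e n| := by
  refine Summable.abs ?_
  refine ((summable_mul_xiLead he r).sub (summable_mul_eta he1 r).of_abs).congr fun n => ?_
  rw [xi_eq]; ring

theorem hasExpansion_logSum :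
    HasExpansion (fun s => ∑' K : ℕ, (1 / 2) ^ (K + 1) * (K + 1 : ℝ) ^ s)
      (PowerSeries.mk fun k => logSum k / k.factorial) := by
  have := HasExpansion.tsum_rpow (w := fun n => (1 / 2) ^ (n + 1)) (δ := 1) one_pos fun N => by
    refine (summable_geometric_mul_log_pow N le_rfl).congr fun n => ?_
    rw [abs_of_nonneg (by positivity)]
  have e1 : (fun k => logSum k / (k.factorial : ℝ)) = fun k =>
      ∑' n : ℕ, (1 / 2 : ℝ) ^ (n + 1) * (Real.log (n + 1) ^ k / k.factorial) := by
    funext k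
    rw [logSum, ← tsum_div_const]
    congr 1; ext n; ring
  rw [e1]
  exact this

theorem hasExpansion_integral_rpow {G : ℝ → ℝ} (h : IsSymmDist G)
    (he : ∀ j : ℕ, Summable fun n : ℕ =>
      |fsCoeff G h.mono (n + 1)| * Real.log (n + 1) ^ j / (n + 1)) :
    HasExpansion (fun s => ∫ x, x ^ s ∂halfLineMeasure h) (PowerSeries.mk fun r =>
      (A r - ∑' n : ℕ, xi r (n + 1) * fsCoeff G h.mono (n + 1)) / r.factorial) := by
  set e : ℕ → ℝ := fun n => fsCoeff G h.mono (n + 1) with hedef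
  have he1 : ∀ n, |e n| ≤ 1 := fun n => abs_fsCoeff_le_one h (n + 1)
  have hζ : HasExpansion (fun s => H s * (riemannZeta (1 + s)).re) (PowerSeries.mk fun r =>
      PowerSeries.coeff (r + 1) (HSeries * PowerSeries.mk zetaCoeff)) := by
    refine HasExpansion.of_id_mul ((hasExpansion_H.mul hasExpansion_zeta).congr'
      (.of_forall fun s => ?_)) ?_
    · ring
    · simp [PowerSeries.coeff_mul, coeff_zero_HSeries]
  have hall := ((((hasExpansion_logSum.const_mul (3 / 4)).add hζ).sub
    (hasExpansion_tsum_etaFun (e := fun _ => 1) (D := 1) (by simp))).sub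
    (hasExpansion_H.mul (hasExpansion_dirichlet he))).add (hasExpansion_tsum_etaFun he1)
  have hser : (PowerSeries.mk fun r => (A r - ∑' n : ℕ, xi r (n + 1) * e n) / r.factorial) =
      PowerSeries.C (3 / 4) * (PowerSeries.mk fun k => logSum k / k.factorial) +
      (PowerSeries.mk fun r => PowerSeries.coeff (r + 1) (HSeries * PowerSeries.mk zetaCoeff)) -
      (PowerSeries.mk fun r => ∑' n, (1 : ℝ) * (eta r (n + 1) / r.factorial)) -
      HSeries * (PowerSeries.mk fun k => ∑' n : ℕ, e n * (((n + 1 : ℕ) : ℝ)⁻¹ *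
        PowerSeries.coeff k (powSeries ((n + 1 : ℕ) : ℝ)⁻¹))) +
      (PowerSeries.mk fun r => ∑' n, e n * (eta r (n + 1) / r.factorial)) := by
    ext r
    have hr : (r.factorial : ℝ) ≠ 0 := by exact_mod_cast r.factorial_ne_zero
    have hx : ∑' n : ℕ, xi r (n + 1) * e n =
        ∑' n, xiLead r (n + 1) * e n - ∑' n, e n * eta r (n + 1) := by
      rw [← (summable_mul_xiLead he r).tsum_sub (summable_mul_eta he1 r).of_abs]
      congr 1; ext n; rw [xi_eq]; ring
    simp only [map_add, map_sub, PowerSeries.coeff_mk, PowerSeries.coeff_C_mul]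
    rw [coeff_mul_mk_tsum HSeries fun k => Summable.of_norm_bounded (he k) fun n =>
      abs_mul_log_term_le k n]
    simp only [xiLead_div_factorial, tsum_div_const, one_mul, ← mul_div_assoc]
    rw [A, A₀, hx]
    field_simp
    ring
  rw [hser]
  refine hall.congr' ?_
  filter_upwards [Ioc_mem_nhdsGT (show (0 : ℝ) < 1 / 2 by norm_num)] with s hs
  rw [(integral_rpow_halfLineMeasure h hs.1 hs.2).2]
  have s1 := summable_one_div_rpow hs.1
  have s2 : Summable fun n : ℕ => e n * (((n + 1 : ℕ) : ℝ)⁻¹ * ((n + 1 : ℕ) : ℝ)⁻¹ ^ s) :=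
    Summable.of_norm_bounded s1 fun n => by
      rw [norm_mul, Real.norm_of_nonneg (by positivity : 0 ≤ ((n + 1 : ℕ) : ℝ)⁻¹ *
        ((n + 1 : ℕ) : ℝ)⁻¹ ^ s)]
      exact mul_le_of_le_one_left (by positivity) (he1 n)
  have s3 := summable_mul_etaFun (e := fun _ => 1) (D := 1) (by simp) hs.1.le hs.2
  have s4 := summable_mul_etaFun he1 hs.1.le hs.2
  have e1 : ∑' n : ℕ, xiFun (n + 1) s * (1 - e n) =
      H s * ∑' n : ℕ, ((n + 1 : ℕ) : ℝ)⁻¹ * ((n + 1 : ℕ) : ℝ)⁻¹ ^ s - ∑' n, 1 * etaFun (n + 1) s -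
      H s * ∑' n, e n * (((n + 1 : ℕ) : ℝ)⁻¹ * ((n + 1 : ℕ) : ℝ)⁻¹ ^ s) +
      ∑' n, e n * etaFun (n + 1) s := by
    rw [← tsum_mul_left, ← tsum_mul_left, ← (s1.mul_left _).tsum_sub s3,
      ← ((s1.mul_left _).sub s3).tsum_sub (s2.mul_left _),
      ← (((s1.mul_left _).sub s3).sub (s2.mul_left _)).tsum_add s4]
    congr 1; ext n; rw [xiFun]; ring
  rw [e1, riemannZeta_re_eq_tsum hs.1]
  ring

end

/-! ### Mean square of the Fourier coefficients -/

/-- `|∑_{k < N} e^{2πikt}|²`. -/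
noncomputable def fejer (N : ℕ) (t : ℝ) : ℝ :=
  ∑ k ∈ Finset.range N, ∑ l ∈ Finset.range N, Real.cos (2 * Real.pi * (k - l : ℝ) * t)

theorem fejer_eq (N : ℕ) (t : ℝ) : fejer N t =
    ‖∑ k ∈ Finset.range N, Complex.exp ((2 * Real.pi * t : ℝ) * Complex.I) ^ k‖ ^ 2 := by
  rw [← Complex.normSq_eq_norm_sq, Complex.normSq_apply, Complex.re_sum, Complex.im_sum,
    Finset.sum_mul_sum, Finset.sum_mul_sum, ← Finset.sum_add_distrib, fejer]
  refine Finset.sum_congr rfl fun k _ => ?_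
  rw [← Finset.sum_add_distrib]
  refine Finset.sum_congr rfl fun l _ => ?_
  have e : ∀ j : ℕ, Complex.exp ((2 * Real.pi * t : ℝ) * Complex.I) ^ j =
      Complex.exp ((j * (2 * Real.pi * t) : ℝ) * Complex.I) := fun j => by
    rw [← Complex.exp_nat_mul]; congr 1; push_cast; ring
  rw [e, e, Complex.exp_ofReal_mul_I_re, Complex.exp_ofReal_mul_I_re, Complex.exp_ofReal_mul_I_im,
    Complex.exp_ofReal_mul_I_im, ← Real.cos_sub]
  congr 1
  ring

theorem fejer_le_sq (N : ℕ) (t : ℝ) : fejer N t ≤ N ^ 2 := by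
  rw [fejer_eq]
  refine pow_le_pow_left₀ (norm_nonneg _) ((norm_sum_le _ _).trans ?_) 2
  simp only [norm_pow, Complex.norm_exp_ofReal_mul_I, one_pow]
  simp

theorem fejer_le_of_sin {N : ℕ} {t τ : ℝ} (hτ : 0 < τ) (h : 2 * τ ≤ |Real.sin (Real.pi * t)|) :
    fejer N t ≤ 1 / (4 * τ ^ 2) := by
  set z := Complex.exp ((2 * Real.pi * t : ℝ) * Complex.I) with hz
  have hz1 : ‖z - 1‖ ^ 2 = 4 * Real.sin (Real.pi * t) ^ 2 := by
    rw [← Complex.normSq_eq_norm_sq, Complex.normSq_apply, hz, Complex.sub_re, Complex.sub_im,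
      Complex.exp_ofReal_mul_I_re, Complex.exp_ofReal_mul_I_im,
      show 2 * Real.pi * t = 2 * (Real.pi * t) by ring, Real.cos_two_mul, Real.sin_two_mul]
    simp only [Complex.one_re, Complex.one_im]
    nlinarith [Real.sin_sq_add_cos_sq (Real.pi * t)]
  have hN : ‖z ^ N - 1‖ ≤ 2 := by
    refine (norm_sub_le _ _).trans ?_
    rw [norm_pow, hz, Complex.norm_exp_ofReal_mul_I]; norm_num
  have h1 : ‖∑ k ∈ Finset.range N, z ^ k‖ ^ 2 * ‖z - 1‖ ^ 2 ≤ 4 := by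
    rw [← mul_pow, ← norm_mul, geom_sum_mul]
    nlinarith [norm_nonneg (z ^ N - 1)]
  have h2 : (2 * τ) ^ 2 ≤ Real.sin (Real.pi * t) ^ 2 := by
    rw [← sq_abs (Real.sin _)]
    exact pow_le_pow_left₀ (by positivity) h 2
  rw [fejer_eq, le_div_iff₀ (by positivity)]
  have h3 : 0 ≤ ‖∑ k ∈ Finset.range N, z ^ k‖ ^ 2 := by positivity
  rw [hz1] at h1
  nlinarith [mul_le_mul_of_nonneg_left h2 h3]

theorem two_mul_le_sin_pi_mul {τ u : ℝ} (hτ : 0 < τ) (h1 : τ ≤ u) (h2 : u ≤ 1 - τ) :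
    2 * τ ≤ Real.sin (Real.pi * u) := by
  have hπ := Real.pi_pos
  have key : ∀ v : ℝ, 0 ≤ v → v ≤ 1 / 2 → 2 * v ≤ Real.sin (Real.pi * v) := fun v h0 hv => by
    have := Real.mul_le_sin (x := Real.pi * v) (by positivity) (by nlinarith)
    calc 2 * v = 2 / Real.pi * (Real.pi * v) := by field_simp
      _ ≤ _ := this
  rcases le_total u (1 / 2) with h | h
  · linarith [key u (by linarith) h]
  · have := key (1 - u) (by linarith) (by linarith)
    rw [show Real.pi * (1 - u) = Real.pi - Real.pi * u by ring, Real.sin_pi_sub] at this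
    linarith

theorem clamped_question_sub_le (k : ℕ) {x y : ℝ} (hxy : x ≤ y) (h : y - x ≤ (1 / 4) ^ k) :
    clamped question y - clamped question x ≤ 2 * (1 / 2) ^ k := by
  refine question_sub_le k (clamp_mem x).1 ?_ (clamp_mem y).2 ?_
  · exact max_le_max le_rfl (min_le_min le_rfl hxy)
  · refine le_trans ?_ h
    rcases max_cases (0 : ℝ) (min 1 y) with ⟨h1, _⟩ | ⟨h1, _⟩ <;>
    rcases max_cases (0 : ℝ) (min 1 x) with ⟨h2, _⟩ | ⟨h2, _⟩ <;>
    rcases min_cases (1 : ℝ) y with ⟨h3, _⟩ | ⟨h3, _⟩ <;>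
    rcases min_cases (1 : ℝ) x with ⟨h4, _⟩ | ⟨h4, _⟩ <;> rw [h1, h2] <;> linarith

theorem real_unitMeasure_question_Ioc_le (l : ℕ) (c : ℝ) :
    (unitMeasure isSymmDist_question).real (Set.Ioc (c - (1 / 16) ^ l) (c + (1 / 16) ^ l)) ≤
      4 * (1 / 4) ^ l := by
  have h16 : (1 / 16 : ℝ) ^ l = (1 / 4) ^ (2 * l) := by rw [pow_mul]; norm_num
  have h4 : (1 / 4 : ℝ) ^ l = (1 / 2) ^ (2 * l) := by rw [pow_mul]; norm_num
  have hp : (0 : ℝ) ≤ (1 / 16) ^ l := by positivity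
  rw [measureReal_def, unitMeasure_Ioc]
  have h1 := clamped_question_sub_le (2 * l) (x := c - (1 / 16) ^ l) (y := c) (by linarith)
    (by rw [← h16]; linarith)
  have h2 := clamped_question_sub_le (2 * l) (x := c) (y := c + (1 / 16) ^ l) (by linarith)
    (by rw [← h16]; linarith)
  have h3 : clamped question (c - (1 / 16) ^ l) ≤ clamped question (c + (1 / 16) ^ l) :=
    monotone_clamp question_monotoneOn (by linarith)
  rw [ENNReal.toReal_ofReal (by linarith), h4]
  linarith

/-- The integral of `fejer (2 * 32 ^ l) (x - y)` against the square of `d?` is bounded below through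
the coefficients, and above by splitting according to whether `x - y` is within `16⁻ˡ` of an integer. -/
theorem sum_sq_fsCoeff_le {l : ℕ} :
    ∑ n ∈ Finset.range (32 ^ l), d n ^ 2 ≤ 49 * 8 ^ l := by
  set μ := unitMeasure isSymmDist_question with hμ
  set τ : ℝ := (1 / 16) ^ l with hτ
  set M : ℕ := 32 ^ l with hM
  have hτ0 : 0 < τ := by positivity
  set c : ℝ → ℝ := fun m => ∫ x, Real.cos (2 * Real.pi * m * x) ∂μ with hc
  set σ : ℝ → ℝ := fun m => ∫ x, Real.sin (2 * Real.pi * m * x) ∂μ with hσ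
  have hd : ∀ n : ℕ, d n = c n := fun n => fsCoeff_eq isSymmDist_question n
  have iB : ∀ f : ℝ → ℝ, Continuous f → (∀ x, |f x| ≤ 1) → Integrable f μ := fun f hf h1 =>
    (integrable_const (1 : ℝ)).mono' hf.measurable.aestronglyMeasurable (.of_forall h1)
  have icos : ∀ m a : ℝ, Integrable (fun x => Real.cos (2 * Real.pi * m * (a - x))) μ := fun m a =>
    iB _ (by fun_prop) fun x => Real.abs_cos_le_one _
  have hin : ∀ m x : ℝ, ∫ y, Real.cos (2 * Real.pi * m * (x - y)) ∂μ =
      Real.cos (2 * Real.pi * m * x) * c m + Real.sin (2 * Real.pi * m * x) * σ m := fun m x => by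
    have e : ∀ y, Real.cos (2 * Real.pi * m * (x - y)) =
        Real.cos (2 * Real.pi * m * x) * Real.cos (2 * Real.pi * m * y) +
        Real.sin (2 * Real.pi * m * x) * Real.sin (2 * Real.pi * m * y) := fun y => by
      rw [mul_sub, Real.cos_sub]
    simp only [e]
    rw [integral_add, integral_const_mul, integral_const_mul]
    · exact (iB _ (by fun_prop) fun x => Real.abs_cos_le_one _).const_mul _
    · exact (iB _ (by fun_prop) fun x => Real.abs_sin_le_one _).const_mul _
  have hout : ∀ m : ℝ, Integrable (fun x => ∫ y, Real.cos (2 * Real.pi * m * (x - y)) ∂μ) μ ∧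
      ∫ x, ∫ y, Real.cos (2 * Real.pi * m * (x - y)) ∂μ ∂μ = c m ^ 2 + σ m ^ 2 := fun m => by
    have i1 : Integrable (fun x => Real.cos (2 * Real.pi * m * x) * c m) μ :=
      (iB _ (by fun_prop) fun x => Real.abs_cos_le_one _).mul_const _
    have i2 : Integrable (fun x => Real.sin (2 * Real.pi * m * x) * σ m) μ :=
      (iB _ (by fun_prop) fun x => Real.abs_sin_le_one _).mul_const _
    simp only [hin]
    refine ⟨i1.add i2, ?_⟩
    rw [integral_add i1 i2, integral_mul_const, integral_mul_const]
    ring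
  have hinner : ∀ x, ∫ y, fejer (2 * M) (x - y) ∂μ = ∑ k ∈ Finset.range (2 * M),
      ∑ l ∈ Finset.range (2 * M), ∫ y, Real.cos (2 * Real.pi * (k - l : ℝ) * (x - y)) ∂μ :=
    fun x => by
      simp only [fejer]
      rw [integral_finsetSum _ fun k _ => integrable_finsetSum _ fun l _ => icos _ _]
      refine Finset.sum_congr rfl fun k _ => ?_
      rw [integral_finsetSum _ fun l _ => icos _ _]
  have hJi : Integrable (fun x => ∫ y, fejer (2 * M) (x - y) ∂μ) μ := by
    simp only [hinner]
    exact integrable_finsetSum _ fun k _ => integrable_finsetSum _ fun l _ => (hout _).1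
  have hJ : ∫ x, ∫ y, fejer (2 * M) (x - y) ∂μ ∂μ = ∑ k ∈ Finset.range (2 * M),
      ∑ l ∈ Finset.range (2 * M), (c (k - l) ^ 2 + σ (k - l) ^ 2) := by
    simp only [hinner]
    rw [integral_finsetSum _ fun k _ => integrable_finsetSum _ fun l _ => (hout _).1]
    refine Finset.sum_congr rfl fun k _ => ?_
    rw [integral_finsetSum _ fun l _ => (hout _).1]
    exact Finset.sum_congr rfl fun l _ => (hout _).2
  -- each difference `n < M` is attained by at least `M` pairs of indices
  have hlow : M * ∑ n ∈ Finset.range M, c n ^ 2 ≤ ∫ x, ∫ y, fejer (2 * M) (x - y) ∂μ ∂μ := by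
    rw [hJ, Finset.sum_comm]
    have h1 : ∀ l ∈ Finset.range M, ∑ n ∈ Finset.range M, c n ^ 2 ≤
        ∑ k ∈ Finset.range (2 * M), (c (k - l) ^ 2 + σ (k - l) ^ 2) := fun l hl => by
      have hl := Finset.mem_range.1 hl
      have e : ∑ n ∈ Finset.range M, c n ^ 2 = ∑ k ∈ Finset.Ico l (M + l), c (k - l) ^ 2 := by
        rw [Finset.sum_Ico_eq_sum_range, Nat.add_sub_cancel]
        refine Finset.sum_congr rfl fun n _ => ?_
        congr 2; push_cast; ring
      rw [e]
      refine (Finset.sum_le_sum fun k _ => ?_).trans (Finset.sum_le_sum_of_subset_of_nonneg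
        (f := fun k : ℕ => c (k - l) ^ 2 + σ (k - l) ^ 2) ?_ fun _ _ _ => by positivity)
      · nlinarith [sq_nonneg (σ (k - l))]
      · intro k hk
        rw [Finset.mem_Ico] at hk
        rw [Finset.mem_range]
        omega
    calc M * ∑ n ∈ Finset.range M, c n ^ 2
        = ∑ l ∈ Finset.range M, ∑ n ∈ Finset.range M, c n ^ 2 := by
          simp
      _ ≤ ∑ l ∈ Finset.range M, ∑ k ∈ Finset.range (2 * M), (c (k - l) ^ 2 + σ (k - l) ^ 2) :=
          Finset.sum_le_sum h1
      _ ≤ _ := Finset.sum_le_sum_of_subset_of_nonneg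
          (Finset.range_mono (by omega)) fun _ _ _ => Finset.sum_nonneg fun _ _ => by positivity
  have hup : ∫ x, ∫ y, fejer (2 * M) (x - y) ∂μ ∂μ ≤
      ((2 * M : ℕ) : ℝ) ^ 2 * (12 * (1 / 4) ^ l) + 1 / (4 * τ ^ 2) := by
    set R := ((2 * M : ℕ) : ℝ) ^ 2 * (12 * (1 / 4) ^ l) + 1 / (4 * τ ^ 2) with hR
    have hx : ∀ x ∈ Set.Icc (0 : ℝ) 1, ∫ y, fejer (2 * M) (x - y) ∂μ ≤ R := fun x hx => by
      have hm : ∀ a : ℝ, MeasurableSet (Set.Ioc (a - τ) (a + τ)) := fun a => measurableSet_Ioc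
      have hi : ∀ a : ℝ, Integrable
          ((Set.Ioc (a - τ) (a + τ)).indicator fun _ => ((2 * M : ℕ) : ℝ) ^ 2) μ :=
        fun a => (integrable_const _).indicator (hm a)
      have hp : ∀ a y : ℝ, 0 ≤
          (Set.Ioc (a - τ) (a + τ)).indicator (fun _ => ((2 * M : ℕ) : ℝ) ^ 2) y := fun a y =>
        Set.indicator_nonneg (fun _ _ => by positivity) _
      have hq : 0 ≤ 1 / (4 * τ ^ 2) := by positivity
      have hbd : ∀ y ∈ Set.Icc (0 : ℝ) 1, fejer (2 * M) (x - y) ≤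
          (Set.Ioc (x - τ) (x + τ)).indicator (fun _ => ((2 * M : ℕ) : ℝ) ^ 2) y +
          (Set.Ioc (0 - τ) (0 + τ)).indicator (fun _ => ((2 * M : ℕ) : ℝ) ^ 2) y +
          (Set.Ioc (1 - τ) (1 + τ)).indicator (fun _ => ((2 * M : ℕ) : ℝ) ^ 2) y +
          1 / (4 * τ ^ 2) := fun y hy => by
        have hN := fejer_le_sq (2 * M) (x - y)
        by_cases h1 : y ∈ Set.Ioc (x - τ) (x + τ)
        · have := Set.indicator_of_mem h1 fun _ : ℝ => ((2 * M : ℕ) : ℝ) ^ 2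
          linarith [hp 0 y, hp 1 y]
        by_cases h2 : y ∈ Set.Ioc (0 - τ) (0 + τ)
        · have := Set.indicator_of_mem h2 fun _ : ℝ => ((2 * M : ℕ) : ℝ) ^ 2
          linarith [hp x y, hp 1 y]
        by_cases h3 : y ∈ Set.Ioc (1 - τ) (1 + τ)
        · have := Set.indicator_of_mem h3 fun _ : ℝ => ((2 * M : ℕ) : ℝ) ^ 2
          linarith [hp x y, hp 0 y]
        have hfar : fejer (2 * M) (x - y) ≤ 1 / (4 * τ ^ 2) := by
          refine fejer_le_of_sin hτ0 ?_
          have h2' : τ < y := by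
            by_contra hcon
            exact h2 ⟨by linarith [hy.1], by linarith⟩
          have h3' : y ≤ 1 - τ := by
            by_contra hcon
            exact h3 ⟨by linarith, by linarith [hy.2]⟩
          rcases le_or_gt y (x - τ) with h4 | h4
          · exact (two_mul_le_sin_pi_mul hτ0 (by linarith) (by linarith [hx.2])).trans
              (le_abs_self _)
          · have h5 : x + τ < y := by
              by_contra hcon
              exact h1 ⟨h4, by linarith⟩
            rw [show Real.pi * (x - y) = -(Real.pi * (y - x)) by ring, Real.sin_neg, abs_neg]
            exact (two_mul_le_sin_pi_mul hτ0 (by linarith) (by linarith [hx.1])).trans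
              (le_abs_self _)
        linarith [hp x y, hp 0 y, hp 1 y]
      have hfi : Integrable (fun y => fejer (2 * M) (x - y)) μ := by
        simp only [fejer]
        exact integrable_finsetSum _ fun k _ => integrable_finsetSum _ fun l _ => icos _ _
      have hle := integral_mono_ae hfi
        ((((hi x).add (hi 0)).add (hi 1)).add (integrable_const (1 / (4 * τ ^ 2))))
        ((ae_mem_unitMeasure isSymmDist_question).mono fun y hy => hbd y hy)
      refine hle.trans ?_
      rw [integral_add' (((hi x).add (hi 0)).add (hi 1)) (integrable_const _),
        integral_add' ((hi x).add (hi 0)) (hi 1), integral_add' (hi x) (hi 0),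
        integral_indicator_const _ (hm x), integral_indicator_const _ (hm 0),
        integral_indicator_const _ (hm 1)]
      have hb := fun a => mul_le_mul_of_nonneg_right (real_unitMeasure_question_Ioc_le l a)
        (sq_nonneg (((2 * M : ℕ) : ℝ)))
      have b1 := hb x
      have b2 := hb 0
      have b3 := hb 1
      rw [hR]
      simp only [smul_eq_mul, integral_const, probReal_univ, one_mul]
      linarith
    calc _ ≤ ∫ _, R ∂μ := integral_mono_ae hJi (integrable_const _)
          ((ae_mem_unitMeasure isSymmDist_question).mono fun x hx' => hx x hx')
      _ = R := by simp
  simp only [hd]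
  have h := hlow.trans hup
  have e32 : (M : ℝ) = 32 ^ l := by rw [hM]; push_cast; rfl
  have e16 : 1 / (4 * τ ^ 2) = 1 / 4 * (8 : ℝ) ^ l * 32 ^ l := by
    have h256 : τ ^ 2 * (8 ^ l * 32 ^ l) = 1 := by
      rw [hτ, ← pow_mul, mul_comm l 2, pow_mul, ← mul_pow, ← mul_pow]
      norm_num
    rw [div_eq_iff (by positivity)]
    linear_combination -h256
  have e4 : (32 : ℝ) ^ l * (1 / 4) ^ l = 8 ^ l := by rw [← mul_pow]; norm_num
  rw [e16] at h
  push_cast at h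
  rw [e32] at h
  have hp : (0 : ℝ) < 32 ^ l := by positivity
  refine le_of_mul_le_mul_left (h.trans ?_) hp
  rw [show (2 * (32 : ℝ) ^ l) ^ 2 * (12 * (1 / 4) ^ l) =
    48 * 32 ^ l * (32 ^ l * (1 / 4) ^ l) by ring, e4]
  nlinarith [mul_pos hp (by positivity : (0 : ℝ) < 8 ^ l)]

/-- The squares of the coefficients with `n < 32 ^ l` add up to `O(8 ^ l)`. The ratio `1 / 11` of the
weights is chosen because `8 < 11`, which gives convergence, while `11 ≤ 32 ^ (7 / 10)` keeps the
inverse weights below `n ^ (7 / 10)`, up to a constant. -/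
theorem summable_weight_mul_sq :
    Summable fun n : ℕ => (1 / 11 : ℝ) ^ (Nat.log 32 n + 1) * d n ^ 2 := by
  refine summable_of_sum_range_le (c := 49 * (11 / 3)) (fun n => by positivity) fun N => ?_
  have h1 : ∀ n ∈ Finset.range N, (1 / 11 : ℝ) ^ (Nat.log 32 n + 1) * d n ^ 2 ≤
      ∑ l ∈ Finset.range (N + 1), if n < 32 ^ l then (1 / 11 : ℝ) ^ l * d n ^ 2 else 0 := by
    intro n hn
    have hlt : n < 32 ^ (Nat.log 32 n + 1) := Nat.lt_pow_succ_log_self (by norm_num) n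
    have h2 := Finset.single_le_sum (s := Finset.range (N + 1))
      (f := fun l => if n < 32 ^ l then (1 / 11 : ℝ) ^ l * d n ^ 2 else 0)
      (fun l _ => by positivity) (a := Nat.log 32 n + 1) (by
        have := Nat.log_le_self 32 n
        have := Finset.mem_range.1 hn
        rw [Finset.mem_range]; omega)
    simpa only [if_pos hlt] using h2
  refine (Finset.sum_le_sum h1).trans ?_
  rw [Finset.sum_comm]
  have h3 : ∀ l ∈ Finset.range (N + 1), (∑ n ∈ Finset.range N,
      if n < 32 ^ l then (1 / 11 : ℝ) ^ l * d n ^ 2 else 0) ≤ 49 * (8 / 11) ^ l := by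
    intro l _
    rw [← Finset.sum_filter]
    calc _ ≤ ∑ n ∈ Finset.range (32 ^ l), (1 / 11 : ℝ) ^ l * d n ^ 2 := by
          refine Finset.sum_le_sum_of_subset_of_nonneg (fun n hn => ?_) fun _ _ _ => by positivity
          exact Finset.mem_range.2 (Finset.mem_filter.1 hn).2
      _ ≤ (1 / 11 : ℝ) ^ l * (49 * 8 ^ l) := by
          rw [← Finset.mul_sum]
          exact mul_le_mul_of_nonneg_left sum_sq_fsCoeff_le (by positivity)
      _ = _ := by rw [div_pow, div_pow]; ring
  refine (Finset.sum_le_sum h3).trans ?_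
  rw [← Finset.mul_sum]
  refine mul_le_mul_of_nonneg_left ?_ (by norm_num)
  refine ((summable_geometric_of_lt_one (by norm_num) (by norm_num)).sum_le_tsum _
    fun _ _ => by positivity).trans ?_
  rw [tsum_geometric_of_lt_one (by norm_num) (by norm_num)]
  norm_num

theorem eleven_pow_log_le {m : ℕ} (hm : 1 ≤ m) :
    (11 : ℝ) ^ Nat.log 32 m ≤ (m : ℝ) ^ (7 / 10 : ℝ) := by
  have h1 : ((32 ^ Nat.log 32 m : ℕ) : ℝ) ≤ m := by exact_mod_cast Nat.pow_log_le_self 32 (by omega)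
  have h2 : (11 : ℝ) ≤ (32 : ℝ) ^ (7 / 10 : ℝ) := by
    rw [Real.le_rpow_iff_log_le (by norm_num) (by norm_num)]
    have h3 : Real.log ((11 : ℝ) ^ 10) ≤ Real.log ((32 : ℝ) ^ 7) :=
      Real.log_le_log (by norm_num) (by norm_num)
    rw [Real.log_pow, Real.log_pow] at h3
    push_cast at h3
    linarith
  calc (11 : ℝ) ^ Nat.log 32 m ≤ ((32 : ℝ) ^ (7 / 10 : ℝ)) ^ Nat.log 32 m := by gcongr
    _ = ((32 ^ Nat.log 32 m : ℕ) : ℝ) ^ (7 / 10 : ℝ) := by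
        rw [← Real.rpow_natCast, ← Real.rpow_mul (by norm_num), mul_comm,
          Real.rpow_mul (by norm_num)]
        push_cast
        rw [Real.rpow_natCast]
    _ ≤ _ := Real.rpow_le_rpow (Nat.cast_nonneg _) h1 (by norm_num)

/-- The mean square bound makes `∑ d_n (log n)^j / n` absolutely convergent. -/
theorem summable_abs_d_mul_log (j : ℕ) :
    Summable fun n : ℕ => |d (n + 1)| * Real.log (n + 1) ^ j / (n + 1) := by
  have h1 := (summable_nat_add_iff 1).2 summable_weight_mul_sq
  have h2 := ((summable_nat_add_iff 1).2 (Real.summable_nat_rpow.2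
    (by norm_num : (-21 / 20 : ℝ) < -1))).mul_left (11 * logBound (2 * j))
  refine Summable.of_nonneg_of_le (fun n => ?_) (fun n => ?_) (h1.add h2)
  · have : 0 ≤ Real.log ((n : ℝ) + 1) := Real.log_nonneg (by simp)
    positivity
  set m : ℕ := n + 1 with hm
  have hm1 : (1 : ℝ) ≤ m := by rw [hm]; exact_mod_cast Nat.succ_le_succ n.zero_le
  have hm0 : (0 : ℝ) < m := by linarith
  have hmc : (n : ℝ) + 1 = m := by rw [hm]; push_cast; rfl
  rw [hmc]
  have hl : 0 ≤ Real.log m := Real.log_nonneg hm1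
  set w : ℝ := (1 / 11) ^ (Nat.log 32 m + 1) with hw
  have hw0 : 0 < w := by positivity
  have hwi : w⁻¹ ≤ 11 * (m : ℝ) ^ (7 / 10 : ℝ) := by
    rw [hw, one_div, inv_pow, inv_inv, pow_succ, mul_comm]
    exact mul_le_mul_of_nonneg_left (eleven_pow_log_le (by omega)) (by norm_num)
  have hlog := log_pow_le (2 * j) hm1
  set b : ℝ := Real.log m ^ j / m with hb
  have hb0 : 0 ≤ b := by positivity
  have hb2 : b ^ 2 * w⁻¹ ≤ 11 * logBound (2 * j) * (m : ℝ) ^ (-21 / 20 : ℝ) := by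
    have e1 : b ^ 2 = Real.log m ^ (2 * j) * (m : ℝ) ^ (-2 : ℝ) := by
      rw [hb, div_pow, ← pow_mul, mul_comm j 2, Real.rpow_neg hm0.le, Real.rpow_two, div_eq_mul_inv]
    rw [e1]
    calc _ ≤ logBound (2 * j) * (m : ℝ) ^ (1 / 4 : ℝ) * (m : ℝ) ^ (-2 : ℝ) *
          (11 * (m : ℝ) ^ (7 / 10 : ℝ)) := by
          refine mul_le_mul ?_ hwi (by positivity) ?_
          · exact mul_le_mul_of_nonneg_right hlog (by positivity)
          · have := logBound_nonneg (2 * j); positivity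
      _ = 11 * logBound (2 * j) * ((m : ℝ) ^ (1 / 4 : ℝ) * (m : ℝ) ^ (-2 : ℝ) *
          (m : ℝ) ^ (7 / 10 : ℝ)) := by ring
      _ = _ := by rw [← Real.rpow_add hm0, ← Real.rpow_add hm0]; norm_num
  have hag : |d m| * b ≤ w * d m ^ 2 + b ^ 2 * w⁻¹ := by
    have h3 : 0 ≤ w⁻¹ * (w * |d m| - b) ^ 2 := by positivity
    have h4 : w⁻¹ * (w * |d m| - b) ^ 2 = w * |d m| ^ 2 - 2 * (|d m| * b) + b ^ 2 * w⁻¹ := by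
      field_simp
      ring
    rw [h4, sq_abs] at h3
    nlinarith [mul_nonneg (abs_nonneg (d m)) hb0]
  calc |d m| * Real.log m ^ j / m = |d m| * b := by rw [hb]; ring
    _ ≤ _ := hag.trans (by linarith)

section

/-! ### Moments from the expansion of a moment generating function -/

theorem abs_expRem_mul_le (N : ℕ) {s : ℝ} (hs : 0 ≤ s) (y : ℝ) :
    |expRem N (s * y)| ≤ (-1) ^ N * expRem N (s * y) +
      2 * (s ^ N * ((max y 0) ^ N * Real.exp (s * max y 0))) := by
  rcases le_total 0 y with hy | hy
  · obtain ⟨h1, h2⟩ := sign_mul_expRem_mem (σ := 1) (by norm_num) N (mul_nonneg hs hy)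
    rw [one_pow, one_mul, one_mul] at h1 h2
    rw [max_eq_left zero_le_one, one_mul, mul_pow, mul_assoc] at h2
    rw [max_eq_left hy, abs_of_nonneg h1]
    rcases neg_one_pow_eq_or ℝ N with h | h <;> rw [h] <;> linarith
  · obtain ⟨h1, -⟩ := sign_mul_expRem_mem (σ := -1) (by norm_num) N
      (u := s * -y) (mul_nonneg hs (by linarith))
    rw [show -1 * (s * -y) = s * y by ring] at h1
    have h2 : |expRem N (s * y)| = (-1) ^ N * expRem N (s * y) := by
      rw [← abs_of_nonneg h1, abs_mul]; simp
    rw [h2]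
    have : 0 ≤ 2 * (s ^ N * ((max y 0) ^ N * Real.exp (s * max y 0))) := by positivity
    linarith

theorem tendsto_expRem_mul_div (N : ℕ) (y : ℝ) :
    Tendsto (fun s => expRem N (s * y) / s ^ N) (𝓝[>] 0) (𝓝 (y ^ N / N.factorial)) := by
  have h := (HasExpansion.rpow (Real.exp_pos y)).tendsto N
  rw [coeff_powSeries, Real.log_exp] at h
  refine h.congr fun s => ?_
  rw [expRem, ← Real.exp_mul, mul_comm y s]
  congr 2
  refine Finset.sum_congr rfl fun k _ => ?_
  rw [coeff_powSeries, Real.log_exp, mul_pow]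
  ring

variable {ν : Measure ℝ} {Y : ℝ → ℝ}

theorem integrable_exp_mul_of_le [IsFiniteMeasure ν] (hY : Measurable Y) {s δ : ℝ} (hs : 0 ≤ s)
    (hsδ : s ≤ δ)
    (hi : Integrable (fun x => Real.exp (δ * Y x)) ν) :
    Integrable (fun x => Real.exp (s * Y x)) ν := by
  refine ((integrable_const 1).add hi).mono' (Measurable.aestronglyMeasurable (by fun_prop))
    (.of_forall fun x => ?_)
  rw [Real.norm_of_nonneg (Real.exp_pos _).le, Pi.add_apply]
  rcases le_total 0 (Y x) with h | h
  · have := Real.exp_le_exp.2 (mul_le_mul_of_nonneg_right hsδ h)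
    linarith
  · have := Real.exp_le_one_iff.2 (mul_nonpos_of_nonneg_of_nonpos hs h)
    linarith [Real.exp_pos (δ * Y x)]

theorem integrable_posPart_pow_mul_exp [IsFiniteMeasure ν] (hY : Measurable Y) {δ : ℝ} (hδ : 0 < δ)
    (hi : Integrable (fun x => Real.exp (δ * Y x)) ν) (N : ℕ) :
    Integrable (fun x => (max (Y x) 0) ^ N * Real.exp (δ / 2 * max (Y x) 0)) ν := by
  refine (((integrable_const 1).add hi).const_mul (N.factorial / (δ / 2) ^ N)).mono'
    (Measurable.aestronglyMeasurable (by fun_prop)) (.of_forall fun x => ?_)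
  rw [Real.norm_of_nonneg (by positivity)]
  set y := max (Y x) 0 with hy
  have hy0 : 0 ≤ y := le_max_right _ _
  have h1 := Real.pow_div_factorial_le_exp (δ / 2 * y) (by positivity) N
  have h2 : y ^ N ≤ N.factorial / (δ / 2) ^ N * Real.exp (δ / 2 * y) := by
    rw [div_le_iff₀ (by positivity), mul_pow] at h1
    rw [div_mul_eq_mul_div, le_div_iff₀ (by positivity)]
    linarith
  have h3 : Real.exp (δ * y) ≤ 1 + Real.exp (δ * Y x) := by
    rcases max_cases (Y x) 0 with ⟨h, _⟩ | ⟨h, _⟩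
    · rw [hy, h]; linarith
    · rw [hy, h, mul_zero, Real.exp_zero]; linarith [Real.exp_pos (δ * Y x)]
  calc y ^ N * Real.exp (δ / 2 * y)
      ≤ N.factorial / (δ / 2) ^ N * Real.exp (δ / 2 * y) * Real.exp (δ / 2 * y) := by gcongr
    _ = N.factorial / (δ / 2) ^ N * Real.exp (δ * y) := by
        rw [mul_assoc, ← Real.exp_add]; ring_nf
    _ ≤ _ := by rw [Pi.add_apply]; gcongr

/-- If the moment generating function has an asymptotic expansion at `0+`, then all moments exist
and are given by its coefficients, even though nothing is assumed on the negative tail. -/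
theorem integrable_pow_of_hasExpansion [IsFiniteMeasure ν] (hY : Measurable Y) {δ : ℝ} (hδ : 0 < δ)
    (hi : Integrable (fun x => Real.exp (δ * Y x)) ν) {p : PowerSeries ℝ}
    (hp : HasExpansion (fun s => ∫ x, Real.exp (s * Y x) ∂ν) p) (N : ℕ) :
    Integrable (fun x => Y x ^ N) ν ∧ ∫ x, Y x ^ N ∂ν = N.factorial * PowerSeries.coeff N p := by
  induction N using Nat.strong_induction_on with
  | _ N ih =>
  have hI : ∀ s, 0 ≤ s → s ≤ δ → Integrable (fun x => expRem N (s * Y x)) ν ∧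
      ∫ x, expRem N (s * Y x) ∂ν = ∫ x, Real.exp (s * Y x) ∂ν -
        ∑ k ∈ Finset.range N, PowerSeries.coeff k p * s ^ k := fun s h0 h1 => by
    have i1 := integrable_exp_mul_of_le hY h0 h1 hi
    have i2 : ∀ k ∈ Finset.range N, Integrable (fun x => (s * Y x) ^ k / k.factorial) ν :=
      fun k hk => by
        simp only [mul_pow]
        exact ((ih k (Finset.mem_range.1 hk)).1.const_mul _).div_const _
    simp only [expRem]
    refine ⟨i1.sub (integrable_finsetSum _ i2), ?_⟩
    rw [integral_sub i1 (integrable_finsetSum _ i2), integral_finsetSum _ i2]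
    congr 1
    refine Finset.sum_congr rfl fun k hk => ?_
    have hk0 : (k.factorial : ℝ) ≠ 0 := by exact_mod_cast k.factorial_ne_zero
    simp only [mul_pow]
    rw [integral_div, integral_const_mul, (ih k (Finset.mem_range.1 hk)).2]
    field_simp
  set C := ∫ x, (max (Y x) 0) ^ N * Real.exp (δ / 2 * max (Y x) 0) ∂ν with hC
  have hCi := integrable_posPart_pow_mul_exp hY hδ hi N
  set s : ℕ → ℝ := fun m => δ / 2 * (1 / ((m : ℝ) + 1)) with hs
  have hs0 : ∀ m, 0 < s m := fun m => by positivity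
  have hs1 : ∀ m, s m ≤ δ / 2 := fun m => by
    refine mul_le_of_le_one_right (by positivity) ?_
    rw [div_le_one (by positivity)]
    linarith [(Nat.cast_nonneg m : (0 : ℝ) ≤ m)]
  have hst : Tendsto s atTop (𝓝[>] 0) := by
    refine tendsto_nhdsWithin_iff.2 ⟨?_, .of_forall hs0⟩
    have := (tendsto_one_div_add_atTop_nhds_zero_nat (𝕜 := ℝ)).const_mul (δ / 2)
    rwa [mul_zero] at this
  set F : ℕ → ℝ → ℝ := fun m x => expRem N (s m * Y x) / s m ^ N with hF
  have hFi : ∀ m, Integrable (F m) ν := fun m =>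
    (hI (s m) (hs0 m).le ((hs1 m).trans (by linarith))).1.div_const _
  have hFlim : ∀ x, Tendsto (fun m => F m x) atTop (𝓝 (Y x ^ N / N.factorial)) := fun x =>
    (tendsto_expRem_mul_div N (Y x)).comp hst
  have hFint : Tendsto (fun m => ∫ x, F m x ∂ν) atTop (𝓝 (PowerSeries.coeff N p)) := by
    refine ((hp.tendsto N).comp hst).congr fun m => ?_
    rw [hF, Function.comp_apply, ← (hI (s m) (hs0 m).le ((hs1 m).trans (by linarith))).2,
      integral_div]
  have hFabs : ∀ m x, ‖F m x‖ ≤ (-1) ^ N * F m x +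
      2 * ((max (Y x) 0) ^ N * Real.exp (δ / 2 * max (Y x) 0)) := fun m x => by
    have h1 := abs_expRem_mul_le N (hs0 m).le (Y x)
    have hp0 : 0 < s m ^ N := pow_pos (hs0 m) N
    rw [hF, Real.norm_eq_abs, abs_div, abs_of_pos hp0, div_le_iff₀ hp0]
    refine h1.trans ?_
    have h2 : Real.exp (s m * max (Y x) 0) ≤ Real.exp (δ / 2 * max (Y x) 0) :=
      Real.exp_le_exp.2 (mul_le_mul_of_nonneg_right (hs1 m) (le_max_right _ _))
    have h3 : s m ^ N * ((max (Y x) 0) ^ N * Real.exp (s m * max (Y x) 0)) ≤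
        s m ^ N * ((max (Y x) 0) ^ N * Real.exp (δ / 2 * max (Y x) 0)) := by gcongr
    have e : ((-1) ^ N * (expRem N (s m * Y x) / s m ^ N) +
        2 * ((max (Y x) 0) ^ N * Real.exp (δ / 2 * max (Y x) 0))) * s m ^ N =
        (-1) ^ N * expRem N (s m * Y x) +
        2 * (s m ^ N * ((max (Y x) 0) ^ N * Real.exp (δ / 2 * max (Y x) 0))) := by
      field_simp
    rw [e]
    linarith
  -- by Fatou's lemma the limit of the `F m` is integrable
  have hint : Integrable (fun x => Y x ^ N / N.factorial) ν := by
    refine integrable_of_tendsto (.of_forall hFlim) (fun m => (hFi m).aestronglyMeasurable) ?_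
    obtain ⟨D, hD⟩ := (hFint.abs.bddAbove_range)
    have hle : ∀ m, ∫⁻ x, ‖F m x‖ₑ ∂ν ≤ ENNReal.ofReal (D + 2 * C) := fun m => by
      rw [← ofReal_integral_norm_eq_lintegral_enorm (hFi m)]
      refine ENNReal.ofReal_le_ofReal ?_
      have h1 := integral_mono (hFi m).norm (((hFi m).const_mul ((-1) ^ N)).add (hCi.const_mul 2))
        (hFabs m)
      refine h1.trans ?_
      rw [integral_add' ((hFi m).const_mul _) (hCi.const_mul 2), integral_const_mul,
        integral_const_mul, ← hC]
      have h2 : (-1) ^ N * ∫ x, F m x ∂ν ≤ |∫ x, F m x ∂ν| := by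
        refine (le_abs_self _).trans ?_
        rw [abs_mul]; simp
      have h3 : |∫ x, F m x ∂ν| ≤ D := hD ⟨m, rfl⟩
      linarith
    refine ne_top_of_le_ne_top (b := ENNReal.ofReal (D + 2 * C)) ENNReal.ofReal_ne_top
      ((liminf_le_liminf (.of_forall hle)).trans_eq (liminf_const _))
  have hf0 : (N.factorial : ℝ) ≠ 0 := by exact_mod_cast N.factorial_ne_zero
  have hYN : Integrable (fun x => Y x ^ N) ν := by
    refine (hint.mul_const (N.factorial : ℝ)).congr (.of_forall fun x => ?_)
    simp only
    field_simp
  refine ⟨hYN, ?_⟩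
  have hdom : Tendsto (fun m => ∫ x, F m x ∂ν) atTop (𝓝 (∫ x, Y x ^ N / N.factorial ∂ν)) := by
    refine tendsto_integral_of_dominated_convergence
      (fun x => |Y x ^ N| + (max (Y x) 0) ^ N * Real.exp (δ / 2 * max (Y x) 0))
      (fun m => (hFi m).aestronglyMeasurable) (hYN.abs.add hCi) (fun m => .of_forall fun x => ?_)
      (.of_forall hFlim)
    have hp0 : 0 < s m ^ N := pow_pos (hs0 m) N
    have h1 := abs_expRem_le N (s m * Y x)
    rw [hF, Real.norm_eq_abs, abs_div, abs_of_pos hp0, div_le_iff₀ hp0]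
    refine h1.trans ?_
    rw [abs_mul, abs_of_pos (hs0 m), mul_pow, mul_assoc, mul_comm]
    refine mul_le_mul_of_nonneg_right ?_ hp0.le
    rw [abs_pow]
    rcases le_total 0 (Y x) with h | h
    · rw [max_eq_left h, abs_of_nonneg h, max_eq_right (Real.one_le_exp (mul_nonneg (hs0 m).le h))]
      have h2 := Real.exp_le_exp.2 (mul_le_mul_of_nonneg_right (hs1 m) h)
      have h3 : Y x ^ N * Real.exp (s m * Y x) ≤ Y x ^ N * Real.exp (δ / 2 * Y x) := by gcongr
      have h4 : 0 ≤ Y x ^ N := pow_nonneg h N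
      linarith
    · rw [max_eq_left (Real.exp_le_one_iff.2 (mul_nonpos_of_nonneg_of_nonpos (hs0 m).le h)),
        mul_one]
      have : 0 ≤ (max (Y x) 0) ^ N * Real.exp (δ / 2 * max (Y x) 0) := by positivity
      linarith
  rw [← tendsto_nhds_unique hdom hFint, integral_div]
  field_simp

end

section

/-! ### Distributions with vanishing odd logarithmic moments -/

variable {ν : Measure ℝ} {Y : ℝ → ℝ}

theorem lintegral_sinh_mul [IsFiniteMeasure ν] {Z : ℝ → ℝ} (hZ : Measurable Z) (hZ0 : ∀ x, 0 ≤ Z x)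
    {t : ℝ} (ht : 0 ≤ t) : ∫⁻ x, ENNReal.ofReal (Real.sinh (t * Z x)) ∂ν =
      ∑' k : ℕ, ∫⁻ x, ENNReal.ofReal ((t * Z x) ^ (2 * k + 1) / (2 * k + 1).factorial) ∂ν := by
  rw [← lintegral_tsum fun k => by fun_prop]
  refine lintegral_congr fun x => ?_
  have h := Real.hasSum_sinh (t * Z x)
  rw [← h.tsum_eq, ENNReal.ofReal_tsum_of_nonneg (fun k => ?_) h.summable]
  have := hZ0 x
  positivity

/-- If all moments of odd order vanish, and the exponential moments of the positive part are
finite, then the law is symmetric: the positive and the negative part have the same odd moments,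
hence the same integrals of `sinh`, so the negative part has finite exponential moments as well and
the moment generating function is even. -/
theorem map_neg_eq_of_odd_moments [IsProbabilityMeasure ν] (hY : Measurable Y)
    (hexp : ∀ t : ℝ, 0 ≤ t → Integrable (fun x => Real.exp (t * Y x)) ν)
    (hmom : ∀ N : ℕ, Integrable (fun x => Y x ^ N) ν)
    (hodd : ∀ N : ℕ, Odd N → ∫ x, Y x ^ N ∂ν = 0) : ν.map (fun x => -Y x) = ν.map Y := by
  have hsinh : ∀ t : ℝ, 0 ≤ t →
      Integrable (fun x => Real.sinh (t * max (Y x) 0)) ν ∧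
      ∫⁻ x, ENNReal.ofReal (Real.sinh (t * max (-Y x) 0)) ∂ν =
        ∫⁻ x, ENNReal.ofReal (Real.sinh (t * max (Y x) 0)) ∂ν := fun t ht => by
    constructor
    · refine (hexp t ht).mono' (Measurable.aestronglyMeasurable (by fun_prop))
        (.of_forall fun x => ?_)
      rcases le_total 0 (Y x) with h | h
      · rw [max_eq_left h, Real.norm_of_nonneg (Real.sinh_nonneg_iff.2 (mul_nonneg ht h)),
          Real.sinh_eq]
        linarith [Real.exp_pos (t * Y x), Real.exp_pos (-(t * Y x))]
      · rw [max_eq_right h, mul_zero, Real.sinh_zero, norm_zero]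
        exact (Real.exp_pos _).le
    · rw [lintegral_sinh_mul (by fun_prop) (fun x => le_max_right _ _) ht,
        lintegral_sinh_mul (by fun_prop) (fun x => le_max_right _ _) ht]
      congr 1
      ext k
      have ho : Odd (2 * k + 1) := ⟨k, rfl⟩
      have key : ∀ Z : ℝ → ℝ, Measurable Z → (∀ x, |Z x| ≤ |Y x|) → (∀ x, 0 ≤ Z x) →
          Integrable (fun x => Z x ^ (2 * k + 1)) ν ∧
          ∫⁻ x, ENNReal.ofReal ((t * Z x) ^ (2 * k + 1) / (2 * k + 1).factorial) ∂ν =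
          ENNReal.ofReal (t ^ (2 * k + 1) / (2 * k + 1).factorial *
            ∫ x, Z x ^ (2 * k + 1) ∂ν) := fun Z hZ hle hZ0 => by
        have hi : Integrable (fun x => Z x ^ (2 * k + 1)) ν :=
          (hmom (2 * k + 1)).mono (by fun_prop) (.of_forall fun x => by
            rw [norm_pow, norm_pow]
            exact pow_le_pow_left₀ (norm_nonneg _) (hle x) _)
        refine ⟨hi, ?_⟩
        rw [← integral_const_mul, ofReal_integral_eq_lintegral_ofReal (hi.const_mul _)
          (.of_forall fun x => by have := hZ0 x; simp only [Pi.zero_apply]; positivity)]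
        refine lintegral_congr fun x => ?_
        congr 1
        rw [mul_pow]; ring
      have h1 := key (fun x => max (Y x) 0) (by fun_prop) (fun x => by
        rcases max_cases (Y x) 0 with ⟨h, _⟩ | ⟨h, _⟩ <;> simp [h]) fun x => le_max_right _ _
      have h2 := key (fun x => max (-Y x) 0) (by fun_prop) (fun x => by
        rcases max_cases (-Y x) 0 with ⟨h, _⟩ | ⟨h, _⟩ <;> simp [h]) fun x => le_max_right _ _
      rw [h1.2, h2.2]
      congr 2
      have h3 := hodd _ ho
      have e : ∀ x, Y x ^ (2 * k + 1) =
          (max (Y x) 0) ^ (2 * k + 1) - (max (-Y x) 0) ^ (2 * k + 1) := fun x => by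
        rcases le_total 0 (Y x) with h | h
        · rw [max_eq_left h, max_eq_right (by linarith), zero_pow (by omega), sub_zero]
        · rw [max_eq_right h, max_eq_left (by linarith), zero_pow (by omega), ho.neg_pow]; ring
      simp only [e] at h3
      rw [integral_sub h1.1 h2.1] at h3
      linarith
  have hsinh' : ∀ t : ℝ, 0 ≤ t → Integrable (fun x => Real.sinh (t * max (-Y x) 0)) ν :=
    fun t ht => by
      have h0 : ∀ Z : ℝ → ℝ, (∀ x, 0 ≤ Z x) → ∀ᵐ x ∂ν, 0 ≤ Real.sinh (t * Z x) := fun Z hZ =>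
        .of_forall fun x => Real.sinh_nonneg_iff.2 (mul_nonneg ht (hZ x))
      refine ⟨Measurable.aestronglyMeasurable (by fun_prop), ?_⟩
      rw [hasFiniteIntegral_iff_ofReal (h0 _ fun x => le_max_right _ _), (hsinh t ht).2,
        ← hasFiniteIntegral_iff_ofReal (h0 _ fun x => le_max_right _ _)]
      exact (hsinh t ht).1.2
  have hdec : ∀ t x, Real.sinh (t * Y x) =
      Real.sinh (t * max (Y x) 0) - Real.sinh (t * max (-Y x) 0) := fun t x => by
    rcases le_total 0 (Y x) with h | h
    · rw [max_eq_left h, max_eq_right (by linarith), mul_zero, Real.sinh_zero, sub_zero]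
    · rw [max_eq_right h, max_eq_left (by linarith), mul_neg, Real.sinh_neg]; simp
  have hpos : ∀ t : ℝ, 0 ≤ t → Integrable (fun x => Real.exp (-t * Y x)) ν ∧
      ∫ x, Real.exp (-t * Y x) ∂ν = ∫ x, Real.exp (t * Y x) ∂ν := fun t ht => by
    have hI : Integrable (fun x => Real.sinh (t * Y x)) ν := by
      simp only [hdec]; exact (hsinh t ht).1.sub (hsinh' t ht)
    have h0 : ∫ x, Real.sinh (t * Y x) ∂ν = 0 := by
      simp only [hdec]
      rw [integral_sub (hsinh t ht).1 (hsinh' t ht), sub_eq_zero,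
        integral_eq_lintegral_of_nonneg_ae, integral_eq_lintegral_of_nonneg_ae, (hsinh t ht).2]
      · exact .of_forall fun x => Real.sinh_nonneg_iff.2 (mul_nonneg ht (le_max_right _ _))
      · exact Measurable.aestronglyMeasurable (by fun_prop)
      · exact .of_forall fun x => Real.sinh_nonneg_iff.2 (mul_nonneg ht (le_max_right _ _))
      · exact Measurable.aestronglyMeasurable (by fun_prop)
    have e : ∀ x, Real.exp (-t * Y x) = Real.exp (t * Y x) - 2 * Real.sinh (t * Y x) := fun x => by
      rw [Real.sinh_eq, neg_mul]; ring
    simp only [e]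
    refine ⟨(hexp t ht).sub (hI.const_mul 2), ?_⟩
    rw [integral_sub (hexp t ht) (hI.const_mul 2), integral_const_mul, h0, mul_zero, sub_zero]
  have hall : ∀ t : ℝ, Integrable (fun x => Real.exp (t * Y x)) ν := fun t => by
    rcases le_total 0 t with h | h
    · exact hexp t h
    · simpa using (hpos (-t) (by linarith)).1
  have hmgf : ProbabilityTheory.mgf Y ν = ProbabilityTheory.mgf (fun x => -Y x) ν := by
    ext t
    simp only [ProbabilityTheory.mgf, mul_neg]
    rcases le_total 0 t with h | h
    · simpa using (hpos t h).2.symm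
    · simpa using (hpos (-t) (by linarith)).2
  have hset : ProbabilityTheory.integrableExpSet Y ν = Set.univ :=
    Set.eq_univ_of_forall fun t => hall t
  refine (Measure.ext_of_complexMGF_eq hY.aemeasurable hY.neg.aemeasurable ?_).symm
  ext z
  exact ProbabilityTheory.eqOn_complexMGF_of_mgf hmgf (by simp [hset])

variable {G : ℝ → ℝ} (h : IsSymmDist G)

theorem integrable_rpow_halfLineMeasure {s : ℝ} (hs : 0 ≤ s) :
    Integrable (fun x => x ^ s) (halfLineMeasure h) := by
  refine (integrable_halfLineMeasure h (f := fun x => x ^ s) (by fun_prop)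
    (fun K => (K + 1 : ℝ) ^ s) (fun K x hx => ?_) ?_).1
  · have h0 : 0 ≤ x + K := add_nonneg hx.1.le (Nat.cast_nonneg _)
    rw [abs_of_nonneg (Real.rpow_nonneg h0 _)]
    exact Real.rpow_le_rpow h0 (by linarith [hx.2]) hs
  · have h1 := (summable_nat_add_iff 1).2 (summable_pow_mul_geometric_of_norm_lt_one (R := ℝ)
      ⌈s⌉₊ (r := 1 / 2) (by norm_num))
    refine Summable.of_nonneg_of_le (fun K => by positivity) (fun K => ?_) h1
    rw [mul_comm]
    refine mul_le_mul_of_nonneg_right ?_ (by positivity)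
    rw [← Real.rpow_natCast]
    push_cast
    exact Real.rpow_le_rpow_of_exponent_le (by simp) (Nat.le_ceil s)

theorem exp_mul_log_ae (s : ℝ) :
    (fun x => Real.exp (s * Real.log x)) =ᵐ[halfLineMeasure h] fun x => x ^ s := by
  filter_upwards [ae_pos_halfLineMeasure h] with x hx
  rw [Real.rpow_def_of_pos hx, mul_comm]

theorem integrable_exp_mul_log {s : ℝ} (hs : 0 ≤ s) :
    Integrable (fun x => Real.exp (s * Real.log x)) (halfLineMeasure h) :=
  (integrable_rpow_halfLineMeasure h hs).congr (exp_mul_log_ae h s).symm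

/-- The logarithmic moments of the extended distribution. -/
theorem integrable_log_pow_halfLineMeasure
    (he : ∀ j : ℕ, Summable fun n : ℕ =>
      |fsCoeff G h.mono (n + 1)| * Real.log (n + 1) ^ j / (n + 1)) (r : ℕ) :
    Integrable (fun x => Real.log x ^ r) (halfLineMeasure h) ∧
    ∫ x, Real.log x ^ r ∂halfLineMeasure h =
      A r - ∑' n : ℕ, xi r (n + 1) * fsCoeff G h.mono (n + 1) := by
  have hx := (hasExpansion_integral_rpow h he).congr'
    (.of_forall fun s => (integral_congr_ae (exp_mul_log_ae h s)).symm)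
  have := integrable_pow_of_hasExpansion Real.measurable_log one_pos
    (integrable_exp_mul_log h zero_le_one) hx r
  refine ⟨this.1, ?_⟩
  have hr : (r.factorial : ℝ) ≠ 0 := by exact_mod_cast r.factorial_ne_zero
  rw [this.2, PowerSeries.coeff_mk]
  field_simp

theorem eqOn_question_of_odd_log_moments
    (hmom : ∀ N : ℕ, Integrable (fun x => Real.log x ^ N) (halfLineMeasure h))
    (hodd : ∀ N : ℕ, Odd N → ∫ x, Real.log x ^ N ∂halfLineMeasure h = 0) :
    Set.EqOn G question (Set.Icc 0 1) := by
  have hmap := map_neg_eq_of_odd_moments Real.measurable_log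
    (fun t ht => integrable_exp_mul_log h ht) hmom hodd
  refine eqOn_question_of_inv_invariant h fun x hx => ?_
  have h1 := congrArg (fun m => m (Set.Ici (-Real.log x))) hmap
  rw [Measure.map_apply (by fun_prop) measurableSet_Ici,
    Measure.map_apply Real.measurable_log measurableSet_Ici] at h1
  have e1 : halfLineMeasure h ((fun x => -Real.log x) ⁻¹' Set.Ici (-Real.log x)) =
      halfLineMeasure h (Set.Iic x) := by
    refine measure_congr ?_
    filter_upwards [ae_pos_halfLineMeasure h] with y hy
    refine propext (?_ : -Real.log x ≤ -Real.log y ↔ y ≤ x)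
    rw [neg_le_neg_iff, Real.log_le_log_iff hy hx]
  have e2 : halfLineMeasure h (Real.log ⁻¹' Set.Ici (-Real.log x)) =
      halfLineMeasure h (Set.Ici x⁻¹) := by
    refine measure_congr ?_
    filter_upwards [ae_pos_halfLineMeasure h] with y hy
    refine propext (?_ : -Real.log x ≤ Real.log y ↔ x⁻¹ ≤ y)
    rw [← Real.log_inv, Real.log_le_log_iff (by positivity) hy]
  rw [← e1, ← e2, h1]

end

/-! ### The odd logarithmic moments of `dF` -/

theorem map_inv_halfLineMeasure_question :
    (halfLineMeasure isSymmDist_question).map (fun x => x⁻¹) =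
      halfLineMeasure isSymmDist_question := by
  have : IsProbabilityMeasure ((halfLineMeasure isSymmDist_question).map (fun x : ℝ => x⁻¹)) :=
    Measure.isProbabilityMeasure_map (by fun_prop)
  refine Measure.ext_of_Iic _ _ fun x => ?_
  rw [Measure.map_apply measurable_inv measurableSet_Iic]
  have hpos := ae_pos_halfLineMeasure isSymmDist_question
  rcases le_or_gt x 0 with hx | hx
  · have e : ∀ s : Set ℝ, (∀ y > 0, y ∉ s) → halfLineMeasure isSymmDist_question s = 0 :=
      fun s hs => by
        refine measure_mono_null (fun y hy => ?_) hpos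
        exact fun hy0 => hs y hy0 hy
    rw [e _ fun y hy h => ?_, e _ fun y hy h => ?_]
    · have h1 : y ≤ x := h
      linarith
    · have h1 : y⁻¹ ≤ x := h
      have h2 : 0 < y⁻¹ := inv_pos.2 hy
      linarith
  · rw [halfLineMeasure_question_Iic hx]
    refine measure_congr ?_
    filter_upwards [hpos] with y hy
    exact propext (inv_le_comm₀ hy hx)

theorem integral_log_pow_question_of_odd {r : ℕ} (hr : Odd r) :
    ∫ x, Real.log x ^ r ∂halfLineMeasure isSymmDist_question = 0 := by
  have h1 : ∫ x, Real.log x ^ r ∂halfLineMeasure isSymmDist_question =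
      ∫ x, Real.log x⁻¹ ^ r ∂halfLineMeasure isSymmDist_question := by
    conv_lhs => rw [← map_inv_halfLineMeasure_question]
    rw [integral_map measurable_inv.aemeasurable (by fun_prop)]
  simp only [Real.log_inv, hr.neg_pow, integral_neg] at h1
  linarith

theorem integral_log_pow_question (r : ℕ) :
    Integrable (fun x => Real.log x ^ r) (halfLineMeasure isSymmDist_question) ∧
    ∫ x, Real.log x ^ r ∂halfLineMeasure isSymmDist_question =
      A r - ∑' n : ℕ, xi r (n + 1) * d (n + 1) :=
  integrable_log_pow_halfLineMeasure isSymmDist_question summable_abs_d_mul_log r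

theorem tsum_xi_mul_d {r : ℕ} (hr : Odd r) : ∑' n : ℕ, xi r (n + 1) * d (n + 1) = A r := by
  have := (integral_log_pow_question r).2
  rw [integral_log_pow_question_of_odd hr] at this
  linarith

/-! ### The coefficients of `H` of low order and the size of `xi` -/

theorem gammaCoeff_zero : gammaCoeff 0 = 1 := by simp [gammaCoeff]

theorem gammaCoeff_one : gammaCoeff 1 = -Real.eulerMascheroniConstant := by
  rw [gammaCoeff, iteratedDeriv_one, Real.eulerMascheroniConstant_eq_neg_deriv]
  simp

theorem coeff_one_mul (p q : PowerSeries ℝ) : PowerSeries.coeff 1 (p * q) =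
    PowerSeries.coeff 0 p * PowerSeries.coeff 1 q +
      PowerSeries.coeff 1 p * PowerSeries.coeff 0 q := by
  simp [PowerSeries.coeff_mul, Finset.Nat.antidiagonal_succ]

theorem coeff_two_mul (p q : PowerSeries ℝ) : PowerSeries.coeff 2 (p * q) =
    PowerSeries.coeff 0 p * PowerSeries.coeff 2 q +
      PowerSeries.coeff 1 p * PowerSeries.coeff 1 q +
      PowerSeries.coeff 2 p * PowerSeries.coeff 0 q := by
  simp [PowerSeries.coeff_mul, Finset.Nat.antidiagonal_succ, add_assoc]

theorem coeff_rescale_sin (c : ℝ) :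
    PowerSeries.coeff 0 (PowerSeries.rescale c (PowerSeries.sin ℝ)) = 0 ∧
    PowerSeries.coeff 1 (PowerSeries.rescale c (PowerSeries.sin ℝ)) = c ∧
    PowerSeries.coeff 2 (PowerSeries.rescale c (PowerSeries.sin ℝ)) = 0 := by
  simp [PowerSeries.coeff_rescale, PowerSeries.sin]

theorem coeff_powSeries_mul_gamma (c : ℝ) :
    PowerSeries.coeff 0 (powSeries c * PowerSeries.mk gammaCoeff) = 1 ∧
    PowerSeries.coeff 1 (powSeries c * PowerSeries.mk gammaCoeff) =
      Real.log c - Real.eulerMascheroniConstant := by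
  constructor
  · simp [PowerSeries.coeff_mul, coeff_powSeries, gammaCoeff_zero]
  · rw [coeff_one_mul]
    simp only [coeff_powSeries, PowerSeries.coeff_mk, gammaCoeff_zero, gammaCoeff_one]
    simp
    ring

theorem coeff_one_HSeries : PowerSeries.coeff 1 HSeries = 1 / 4 := by
  have hπ := Real.pi_ne_zero
  obtain ⟨h0, h1, -⟩ := coeff_rescale_sin (Real.pi / 2)
  rw [HSeries, mul_assoc, mul_assoc, PowerSeries.coeff_C_mul, ← mul_assoc, coeff_one_mul, h0, h1,
    (coeff_powSeries_mul_gamma _).1]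
  field_simp
  ring

theorem coeff_two_HSeries : PowerSeries.coeff 2 HSeries =
    -(1 / 4) * (Real.log (2 * Real.pi) + Real.eulerMascheroniConstant) := by
  have hπ := Real.pi_ne_zero
  obtain ⟨h0, h1, h2⟩ := coeff_rescale_sin (Real.pi / 2)
  rw [HSeries, mul_assoc, mul_assoc, PowerSeries.coeff_C_mul, ← mul_assoc, coeff_two_mul, h0, h1,
    h2, (coeff_powSeries_mul_gamma _).1, (coeff_powSeries_mul_gamma _).2, Real.log_inv]
  field_simp
  ring

/-- `n · xiLead r n` as a polynomial in `log n`. -/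
noncomputable def leadPoly (r : ℕ) : Polynomial ℝ :=
  ∑ i ∈ Finset.range r, Polynomial.C (r.factorial * ((-1) ^ i / i.factorial *
    PowerSeries.coeff (r - i) HSeries)) * Polynomial.X ^ i

theorem nat_mul_xiLead (r n : ℕ) (hn : 1 ≤ n) :
    n * xiLead r n = (leadPoly r).eval (Real.log n) := by
  have hn' : (n : ℝ) ≠ 0 := by positivity
  rw [xiLead, mul_assoc (PowerSeries.C _), PowerSeries.coeff_C_mul, PowerSeries.coeff_mul,
    Finset.Nat.sum_antidiagonal_eq_sum_range_succ
      (fun i k => PowerSeries.coeff i (powSeries (n : ℝ)⁻¹) * PowerSeries.coeff k HSeries),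
    Finset.sum_range_succ, Nat.sub_self, coeff_zero_HSeries, mul_zero, add_zero, leadPoly,
    Polynomial.eval_finsetSum]
  have e : ∀ S : ℝ, (n : ℝ) * (r.factorial * (1 / n * S)) = r.factorial * S := fun S => by
    field_simp
  rw [e, Finset.mul_sum]
  refine Finset.sum_congr rfl fun i _ => ?_
  simp only [Polynomial.eval_mul, Polynomial.eval_C, Polynomial.eval_pow, Polynomial.eval_X,
    coeff_powSeries, Real.log_inv]
  rw [neg_pow]
  ring

theorem le_degree_leadPoly (r : ℕ) : (r : WithBot ℕ) ≤ (leadPoly (r + 1)).degree := by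
  refine Polynomial.le_degree_of_ne_zero ?_
  have hf : (r.factorial : ℝ) ≠ 0 := by exact_mod_cast r.factorial_ne_zero
  have hf1 : ((r + 1).factorial : ℝ) ≠ 0 := by exact_mod_cast (r + 1).factorial_ne_zero
  simp only [leadPoly, Polynomial.finsetSum_coeff, Polynomial.coeff_C_mul, Polynomial.coeff_X_pow]
  rw [Finset.sum_eq_single r (fun i _ hi => by rw [if_neg hi.symm, mul_zero])
    (fun hr => absurd (Finset.mem_range.2 r.lt_succ_self) hr), if_pos rfl, Nat.add_sub_cancel_left,
    coeff_one_HSeries]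
  have : ((-1 : ℝ)) ^ r ≠ 0 := pow_ne_zero _ (by norm_num)
  positivity

/-- For `r = 2j + 3`, the coefficient `xi r n` is asymptotic to `(r / 4) (log n)^{r-1} / n`, because
`n * xiLead r n` is a polynomial of degree `r - 1` in `log n` and `eta r n = O(n⁻²)`. -/
theorem log_pow_div_isBigO_xi (j : ℕ) :
    (fun n : ℕ => Real.log n ^ j / n) =O[atTop] fun n : ℕ => xi (2 * (j + 1) + 1) n := by
  set r := 2 * (j + 1) + 1 with hr
  have hlog : Tendsto (fun n : ℕ => Real.log n) atTop atTop :=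
    Real.tendsto_log_atTop.comp tendsto_natCast_atTop_atTop
  have hdeg : ∀ k : ℕ, k ≤ 2 * (j + 1) → (fun n : ℕ => Real.log n ^ k) =O[atTop]
      fun n : ℕ => (leadPoly r).eval (Real.log n) := fun k hk => by
    have h1 := (Polynomial.isBigO_atTop_of_degree_le (Polynomial.X ^ k) (leadPoly r) (by
      rw [Polynomial.degree_X_pow]
      refine le_trans ?_ (le_degree_leadPoly (2 * (j + 1)))
      exact_mod_cast hk)).comp_tendsto hlog
    refine h1.congr_left fun n => by simp
  have hη : (fun n : ℕ => (n : ℝ) * eta r n) =o[atTop]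
      fun n : ℕ => (leadPoly r).eval (Real.log n) := by
    have h1 : (fun n : ℕ => (n : ℝ) * eta r n) =O[atTop] fun _ : ℕ => (1 : ℝ) := by
      obtain ⟨C, hC, h⟩ := exists_abs_eta_le r
      refine Asymptotics.IsBigO.of_bound C ?_
      filter_upwards [eventually_ge_atTop 1] with n hn
      have hn' : (1 : ℝ) ≤ n := by exact_mod_cast hn
      rw [norm_mul, Real.norm_of_nonneg (by linarith : (0 : ℝ) ≤ n), norm_one, mul_one]
      calc (n : ℝ) * ‖eta r n‖ ≤ n * (C / n ^ 2) := by gcongr; exact h n hn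
        _ = C / n := by field_simp
        _ ≤ C := div_le_self hC hn'
    have h2 : (fun _ : ℕ => (1 : ℝ)) =o[atTop] fun n : ℕ => Real.log n ^ 1 := by
      simp only [pow_one]
      exact Asymptotics.isLittleO_const_left.2 (Or.inr
        (tendsto_norm_atTop_atTop.comp hlog))
    exact h1.trans_isLittleO (h2.trans_isBigO (hdeg 1 (by omega)))
  have h3 := (hdeg j (by omega)).trans hη.right_isBigO_sub
  have h4 := h3.mul (Asymptotics.isBigO_refl (fun n : ℕ => (1 : ℝ) / n) atTop)
  refine h4.congr' (.of_forall fun n => mul_one_div _ _) ?_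
  filter_upwards [eventually_ge_atTop 1] with n hn
  have hn' : (n : ℝ) ≠ 0 := by positivity
  rw [← nat_mul_xiLead r n hn, xi_eq]
  field_simp

theorem summable_of_summable_xi_mul {e : ℕ → ℝ}
    (he : ∀ r : ℕ, Odd r → Summable fun n : ℕ => |xi r (n + 1) * e n|) (j : ℕ) :
    Summable fun n : ℕ => |e n| * Real.log (n + 1) ^ j / (n + 1) := by
  refine summable_of_isBigO_nat (he (2 * (j + 1) + 1) ⟨j + 1, rfl⟩) ?_
  have h1 := (log_pow_div_isBigO_xi j).comp_tendsto (tendsto_add_atTop_nat 1)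
  have h2 := (h1.mul (Asymptotics.isBigO_refl e atTop)).norm_left.norm_right
  refine (Asymptotics.IsBigO.congr_left h2 fun n => ?_).congr_right fun n => ?_
  · have : 0 ≤ Real.log ((n : ℝ) + 1) := Real.log_nonneg (by simp)
    simp only [Function.comp_apply]
    push_cast
    rw [norm_mul, Real.norm_of_nonneg (by positivity), Real.norm_eq_abs]
    ring
  · simp [abs_mul]

theorem eqOn_question_of_identities (G : ℝ → ℝ) (hG : MonotoneOn G (Set.Icc 0 1))
    (hc : ContinuousOn G (Set.Icc 0 1))
    (h0 : G 0 = 0) (hsymm : ∀ x ∈ Set.Icc (0 : ℝ) 1, G x + G (1 - x) = 1)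
    (hxi : ∀ r : ℕ, Odd r → (Summable fun n : ℕ => |xi r (n + 1) * fsCoeff G hG (n + 1)|) ∧
      ∑' n : ℕ, xi r (n + 1) * fsCoeff G hG (n + 1) = A r) :
    Set.EqOn G question (Set.Icc 0 1) ∧ ∀ n : ℕ, fsCoeff G hG n = d n := by
  have h : IsSymmDist G := ⟨hG, hc, h0, hsymm⟩
  have he := summable_of_summable_xi_mul (e := fun n => fsCoeff G h.mono (n + 1))
    fun r hr => (hxi r hr).1
  have hm := integrable_log_pow_halfLineMeasure h he
  have hEq := eqOn_question_of_odd_log_moments h (fun N => (hm N).1) fun N hN => by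
    rw [(hm N).2, (hxi N hN).2, sub_self]
  refine ⟨hEq, fun n => ?_⟩
  have hcl : clamped G = clamped question := funext fun x => hEq (clamp_mem x)
  have hμ : unitMeasure h = unitMeasure isSymmDist_question := by
    refine Measure.ext_of_Iic _ _ fun x => ?_
    rw [unitMeasure_Iic, unitMeasure_Iic, hcl]
  exact (fsCoeff_eq h n).trans ((by rw [hμ]) :
    _ = ∫ x, Real.cos (2 * Real.pi * n * x) ∂unitMeasure isSymmDist_question) |>.trans
      (fsCoeff_eq isSymmDist_question n).symm

/-! ### The even entire function -/

theorem integrable_exp_mul_log_question (t : ℝ) :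
    Integrable (fun x => Real.exp (t * Real.log x)) (halfLineMeasure isSymmDist_question) := by
  rcases le_total 0 t with h | h
  · exact integrable_exp_mul_log _ h
  · have h1 := integrable_exp_mul_log isSymmDist_question (s := -t) (by linarith)
    rw [← map_inv_halfLineMeasure_question,
      integrable_map_measure (by fun_prop) (by fun_prop)] at h1
    refine h1.congr (.of_forall fun x => ?_)
    simp [Real.log_inv]

theorem cpow_ae_eq (s : ℂ) : (fun x : ℝ => (x : ℂ) ^ s) =ᵐ[halfLineMeasure isSymmDist_question]
    fun x => Complex.exp (s * (Real.log x : ℝ)) := by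
  filter_upwards [ae_pos_halfLineMeasure isSymmDist_question] with x hx
  rw [Complex.cpow_def_of_ne_zero (by exact_mod_cast hx.ne'), Complex.ofReal_log hx.le, mul_comm]

theorem restrict_Ioi_extMeasure :
    extMeasure.restrict (Set.Ioi 0) = halfLineMeasure isSymmDist_question := by
  rw [extMeasure_eq]
  exact Measure.restrict_eq_self_of_ae_mem (ae_pos_halfLineMeasure isSymmDist_question)

theorem integrableOn_cpow_extMeasure (s : ℂ) :
    IntegrableOn (fun x : ℝ => (x : ℂ) ^ s) (Set.Ioi 0) extMeasure := by
  rw [IntegrableOn, restrict_Ioi_extMeasure]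
  refine Integrable.congr ?_ (cpow_ae_eq s).symm
  refine (integrable_exp_mul_log_question s.re).mono'
    (Measurable.aestronglyMeasurable (by fun_prop)) (.of_forall fun x => ?_)
  rw [Complex.norm_exp, Complex.re_mul_ofReal]

theorem zetaMGamma_eq : zetaMGamma =
    ProbabilityTheory.complexMGF Real.log (halfLineMeasure isSymmDist_question) := by
  ext s
  rw [zetaMGamma, restrict_Ioi_extMeasure, integral_congr_ae (cpow_ae_eq s)]
  rfl

theorem mem_interior_integrableExpSet (t : ℝ) : t ∈ interior
    (ProbabilityTheory.integrableExpSet Real.log (halfLineMeasure isSymmDist_question)) := by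
  have : ProbabilityTheory.integrableExpSet Real.log (halfLineMeasure isSymmDist_question) =
      Set.univ := Set.eq_univ_of_forall integrable_exp_mul_log_question
  simp [this]

theorem differentiable_zetaMGamma : Differentiable ℂ zetaMGamma := by
  rw [zetaMGamma_eq]
  exact fun z => (ProbabilityTheory.hasDerivAt_complexMGF
    (mem_interior_integrableExpSet z.re)).differentiableAt

theorem zetaMGamma_neg (s : ℂ) : zetaMGamma (-s) = zetaMGamma s := by
  rw [zetaMGamma_eq, ProbabilityTheory.complexMGF, ProbabilityTheory.complexMGF]
  conv_rhs => rw [← map_inv_halfLineMeasure_question]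
  rw [integral_map (by fun_prop) (Measurable.aestronglyMeasurable (by fun_prop))]
  simp [Real.log_inv]

theorem iteratedDeriv_zetaMGamma (r : ℕ) : iteratedDeriv r zetaMGamma 0 =
    ((A r - ∑' n : ℕ, xi r (n + 1) * d (n + 1) : ℝ) : ℂ) := by
  rw [zetaMGamma_eq, ProbabilityTheory.iteratedDeriv_complexMGF (mem_interior_integrableExpSet _),
    ← (integral_log_pow_question r).2, ← integral_complex_ofReal]
  simp

section

/-! ### The algebra of constants -/

section

variable {S : Subalgebra ℚ ℝ}

theorem ratCast_mem (q : ℚ) : (q : ℝ) ∈ S := by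
  simpa using S.algebraMap_mem q

theorem natCast_inv_mem (n : ℕ) : ((n : ℝ))⁻¹ ∈ S := by
  simpa using ratCast_mem (S := S) (n : ℚ)⁻¹

theorem coeff_mul_mem {p q : PowerSeries ℝ} (hp : ∀ k, PowerSeries.coeff k p ∈ S)
    (hq : ∀ k, PowerSeries.coeff k q ∈ S) (k : ℕ) : PowerSeries.coeff k (p * q) ∈ S := by
  rw [PowerSeries.coeff_mul]
  exact sum_mem fun i _ => mul_mem (hp _) (hq _)

theorem coeff_C_mem {c : ℝ} (hc : c ∈ S) (k : ℕ) :
    PowerSeries.coeff k (PowerSeries.C c) ∈ S := by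
  rw [PowerSeries.coeff_C]
  split_ifs
  exacts [hc, zero_mem _]

theorem coeff_X_mem (k : ℕ) : PowerSeries.coeff k (PowerSeries.X : PowerSeries ℝ) ∈ S := by
  rw [PowerSeries.coeff_X]
  split_ifs
  exacts [one_mem _, zero_mem _]

theorem coeff_powSeries_mem {c : ℝ} (hc : Real.log c ∈ S) (k : ℕ) :
    PowerSeries.coeff k (powSeries c) ∈ S := by
  rw [coeff_powSeries, div_eq_mul_inv]
  exact mul_mem (pow_mem hc k) (natCast_inv_mem _)

end

section

variable (r : ℕ)

theorem gammaCoeff_mem (k : ℕ) : gammaCoeff k ∈ constAlgebra r :=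
  Algebra.subset_adjoin (by simp)

theorem zetaCoeff_mem (k : ℕ) : zetaCoeff k ∈ constAlgebra r :=
  Algebra.subset_adjoin (by simp)

theorem pi_mem : Real.pi ∈ constAlgebra r := Algebra.subset_adjoin (by simp)

theorem one_div_pi_mem : 1 / Real.pi ∈ constAlgebra r := Algebra.subset_adjoin (by simp)

theorem log_pi_mem : Real.log Real.pi ∈ constAlgebra r := Algebra.subset_adjoin (by simp)

theorem log_nat_mem {n : ℕ} (hn : 1 ≤ n) : Real.log n ∈ constAlgebra r :=
  Algebra.subset_adjoin (Or.inl (Or.inl (Or.inr ⟨n, hn, rfl⟩)))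

theorem oscIntegral_mem {n : ℕ} (hn : 1 ≤ n) (i j : ℕ) : oscIntegral n i j ∈ constAlgebra r :=
  Algebra.subset_adjoin (Or.inl (Or.inr ⟨n, i, j, hn, rfl⟩))

theorem logSum_mem : logSum r ∈ constAlgebra r := Algebra.subset_adjoin (Or.inr rfl)

theorem one_div_two_pi_mul_mem (n : ℕ) : 1 / (2 * Real.pi * n) ∈ constAlgebra r := by
  have := mul_mem (mul_mem (natCast_inv_mem 2) (one_div_pi_mem r)) (natCast_inv_mem n)
  convert! this using 1
  rw [Nat.cast_ofNat, one_div, one_div, mul_inv, mul_inv]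

theorem log_nat_inv_mem {n : ℕ} (hn : 1 ≤ n) : Real.log (n : ℝ)⁻¹ ∈ constAlgebra r := by
  rw [Real.log_inv]
  exact neg_mem (log_nat_mem r hn)

theorem coeff_HSeries_mem (k : ℕ) : PowerSeries.coeff k HSeries ∈ constAlgebra r := by
  refine coeff_mul_mem (coeff_mul_mem (coeff_mul_mem (coeff_C_mem ?_)
    (coeff_powSeries_mem ?_)) fun k => ?_) (fun k => ?_) k
  · simpa using one_div_two_pi_mul_mem r 1
  · rw [Real.log_inv, Real.log_mul two_ne_zero Real.pi_ne_zero]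
    exact neg_mem (add_mem (by exact_mod_cast log_nat_mem r one_le_two) (log_pi_mem r))
  · rw [PowerSeries.coeff_mk]
    exact gammaCoeff_mem r k
  · rw [PowerSeries.coeff_rescale, PowerSeries.sin, PowerSeries.coeff_mk]
    refine mul_mem (pow_mem ?_ k) ?_
    · have := mul_mem (pi_mem r) (natCast_inv_mem 2)
      rwa [Nat.cast_ofNat, ← div_eq_mul_inv] at this
    · split_ifs
      exacts [zero_mem _, (constAlgebra r).algebraMap_mem _]

theorem eta_mem {n : ℕ} (hn : 1 ≤ n) : eta r n ∈ constAlgebra r := by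
  refine mul_mem (natCast_mem _ _) (coeff_mul_mem (coeff_mul_mem (coeff_mul_mem (coeff_C_mem ?_)
    coeff_X_mem) (coeff_powSeries_mem (log_nat_inv_mem r hn))) (fun k => ?_) r)
  · exact one_div_two_pi_mul_mem r n
  · rw [oscSeries, PowerSeries.coeff_mk]
    refine sum_mem fun p _ => ?_
    rw [div_eq_mul_inv]
    refine mul_mem (oscIntegral_mem r hn _ _) ?_
    rw [mul_inv]
    exact mul_mem (natCast_inv_mem _) (natCast_inv_mem _)

theorem xi_mem {n : ℕ} (hn : 1 ≤ n) : xi r n ∈ constAlgebra r := by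
  refine sub_mem (mul_mem (natCast_mem _ _) (coeff_mul_mem (coeff_mul_mem (coeff_C_mem ?_)
    (coeff_powSeries_mem (log_nat_inv_mem r hn))) (coeff_HSeries_mem r) r)) (eta_mem r hn)
  rw [one_div]
  exact natCast_inv_mem n

theorem A₀_mem : A₀ r ∈ constAlgebra r := by
  refine add_mem (mul_mem ?_ (logSum_mem r)) (mul_mem (natCast_mem _ _)
    (coeff_mul_mem (coeff_HSeries_mem r) (fun k => ?_) (r + 1)))
  · simpa using ratCast_mem (S := constAlgebra r) (3 / 4)
  · rw [PowerSeries.coeff_mk]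
    exact zetaCoeff_mem r k

end

end

/-! ### The first identity -/

/-- For `i = 0` the kernel is the imaginary part of a geometric series of ratio `e^{2πix} / 2`. -/
theorem oscKernel_zero (x : ℝ) : oscKernel 0 x =
    2 * (Real.sin (2 * Real.pi * x) / (5 - 4 * Real.cos (2 * Real.pi * x))) := by
  set θ := 2 * Real.pi * x with hθ
  set z : ℂ := Complex.exp (θ * Complex.I) with hz
  have hn : ‖z / 2‖ < 1 := by
    rw [norm_div, hz, Complex.norm_exp_ofReal_mul_I]; norm_num
  have h1 := (hasSum_geometric_of_norm_lt_one hn).mul_left (z / 2)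
  have h2 := Complex.hasSum_im h1
  have e : ∀ K : ℕ, (z / 2 * (z / 2) ^ K).im =
      (1 / 2) ^ (K + 1) * Real.log (K + 1) ^ 0 * Real.sin (2 * Real.pi * (K + 1) * x) := fun K => by
    rw [← pow_succ', div_pow, hz, ← Complex.exp_nat_mul,
      show ((K + 1 : ℕ) : ℂ) * (θ * Complex.I) =
          ((2 * Real.pi * (K + 1) * x : ℝ) : ℂ) * Complex.I by
        rw [hθ]; push_cast; ring,
      show (2 : ℂ) ^ (K + 1) = ((2 ^ (K + 1) : ℝ) : ℂ) by push_cast; rfl, Complex.div_ofReal_im,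
      Complex.exp_ofReal_mul_I_im, pow_zero, one_div, inv_pow]
    ring
  simp only [e] at h2
  rw [oscKernel, h2.tsum_eq]
  have hc : 0 < 5 - 4 * Real.cos θ := by linarith [Real.cos_le_one θ]
  have hzr : z = ⟨Real.cos θ, Real.sin θ⟩ := by
    apply Complex.ext <;> simp [hz, Complex.exp_ofReal_mul_I_re, Complex.exp_ofReal_mul_I_im]
  have hne : (1 - z / 2) ≠ 0 := fun h0 => by
    have : z / 2 = 1 := (sub_eq_zero.1 h0).symm
    rw [this] at hn; simp at hn
  have h3 : z / 2 * (1 - z / 2)⁻¹ = z / (2 - z) := by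
    have : 2 - z ≠ 0 := fun h0 => hne (by
      have : z = 2 := (sub_eq_zero.1 h0).symm
      rw [this]; norm_num)
    field_simp
  rw [h3, Complex.div_im, hzr, Complex.normSq_apply]
  simp only [Complex.sub_re, Complex.sub_im, Complex.re_ofNat, Complex.im_ofNat]
  have hd : (2 - Real.cos θ) * (2 - Real.cos θ) + (0 - Real.sin θ) * (0 - Real.sin θ) =
      5 - 4 * Real.cos θ := by nlinarith [Real.sin_sq_add_cos_sq θ]
  rw [hd]
  field_simp
  ring

theorem oscPartial_zero (n : ℕ) : oscPartial n 0 0 = fun R => 2 * relPartial n R := by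
  funext R
  rw [oscPartial, relPartial, ← intervalIntegral.integral_const_mul]
  congr 1
  ext x
  rw [oscKernel_zero, pow_zero]
  ring

theorem tendsto_relPartial (n : ℕ) (hn : 1 ≤ n) :
    Tendsto (relPartial n) atTop (𝓝 (relIntegral n)) ∧
      oscIntegral n 0 0 = 2 * relIntegral n := by
  have h1 := tendsto_oscPartial n hn 0 0
  rw [oscPartial_zero] at h1
  have h2 := h1.const_mul (1 / 2)
  have e : (fun R => 1 / 2 * (2 * relPartial n R)) = relPartial n := by funext R; ring
  rw [e] at h2
  have h3 : relIntegral n = 1 / 2 * oscIntegral n 0 0 := h2.limUnder_eq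
  rw [h3]
  exact ⟨h2, by ring⟩

theorem eta_one (n : ℕ) (hn : 1 ≤ n) : eta 1 n = 1 / (Real.pi * n) * relIntegral n := by
  have hπ := Real.pi_ne_zero
  have hn' : (n : ℝ) ≠ 0 := by positivity
  rw [eta, mul_assoc, mul_assoc, PowerSeries.coeff_C_mul, PowerSeries.coeff_succ_X_mul 0]
  simp [PowerSeries.coeff_mul, coeff_powSeries, oscSeries, (tendsto_relPartial n hn).2]
  field

theorem xiLead_one (n : ℕ) : xiLead 1 n = 1 / (4 * n) := by
  rw [xiLead, mul_assoc, PowerSeries.coeff_C_mul, coeff_one_mul, coeff_one_HSeries,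
    coeff_zero_HSeries, coeff_powSeries]
  simp

theorem xi_one (n : ℕ) (hn : 1 ≤ n) :
    xi 1 n = 1 / (4 * n) - 1 / (Real.pi * n) * relIntegral n := by
  rw [xi_eq, xiLead_one, eta_one n hn]

theorem zetaCoeff_zero : zetaCoeff 0 = 1 := by simp [zetaCoeff]

theorem zetaCoeff_one : zetaCoeff 1 = Real.eulerMascheroniConstant := by
  set F := Function.update (fun s : ℂ => (s - 1) * riemannZeta s) 1 1 with hF
  have h1 : Tendsto (slope F 1) (𝓝[≠] 1) (𝓝 (deriv F 1)) :=
    hasDerivAt_iff_tendsto_slope.1 analyticAt_zeta.differentiableAt.hasDerivAt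
  have h2 : Tendsto (slope F 1) (𝓝[≠] 1) (𝓝 (Real.eulerMascheroniConstant : ℂ)) := by
    refine tendsto_riemannZeta_sub_one_div.congr' ?_
    filter_upwards [self_mem_nhdsWithin] with s hs
    have hs' : s - 1 ≠ 0 := sub_ne_zero.2 hs
    rw [slope_def_field, hF, Function.update_self, Function.update_of_ne hs]
    field_simp
  rw [zetaCoeff, iteratedDeriv_one, tendsto_nhds_unique h1 h2]
  simp

theorem A₀_one : A₀ 1 = 3 / 4 * logSum 1 - 1 / 4 * Real.log (2 * Real.pi) := by
  rw [A₀, coeff_two_mul, coeff_zero_HSeries, coeff_one_HSeries, coeff_two_HSeries,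
    PowerSeries.coeff_mk, PowerSeries.coeff_mk, PowerSeries.coeff_mk, zetaCoeff_zero, zetaCoeff_one]
  simp
  ring

theorem A_one : A 1 = 3 / 4 * logSum 1 - 1 / 4 * Real.log (2 * Real.pi)
    - ∑' n : ℕ, 1 / (Real.pi * (n + 1)) * relIntegral (n + 1) := by
  rw [A, A₀_one]
  congr 2
  ext n
  rw [eta_one _ (by omega)]
  push_cast
  rfl

theorem summable_abs_d_div : Summable fun n : ℕ => |d (n + 1) / (4 * (n + 1))| := by
  refine ((summable_abs_d_mul_log 0).mul_left (1 / 4)).congr fun n => ?_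
  rw [abs_div, abs_of_nonneg (by positivity : (0 : ℝ) ≤ 4 * (n + 1)), pow_zero]
  field_simp

theorem summable_relIntegral : Summable fun n : ℕ =>
    |(1 - d (n + 1)) / (Real.pi * (n + 1)) * relIntegral (n + 1)| := by
  have h := summable_mul_eta (e := fun n => 1 - d (n + 1)) (D := 2) (fun n => by
    have := abs_le.1 (abs_fsCoeff_le_one isSymmDist_question (n + 1))
    change |1 - fsCoeff question isSymmDist_question.mono (n + 1)| ≤ 2
    rw [abs_le]; constructor <;> linarith) 1
  refine h.congr fun n => ?_
  rw [eta_one _ (by omega)]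
  push_cast
  congr 1
  ring

theorem first_identity : 3 / 4 * logSum 1 - 1 / 4 * Real.log (2 * Real.pi)
      - ∑' n : ℕ, d (n + 1) / (4 * (n + 1))
      - ∑' n : ℕ, (1 - d (n + 1)) / (Real.pi * (n + 1)) * relIntegral (n + 1) = 0 := by
  have h1 := tsum_xi_mul_d (r := 1) odd_one
  have hη := (summable_mul_eta (e := fun _ => 1) (D := 1) (by simp) 1).of_abs
  simp only [one_mul] at hη
  have hs1 := summable_abs_d_div.of_abs
  have hs2 := summable_relIntegral.of_abs
  rw [A, A₀_one] at h1
  have e : ∀ n : ℕ, xi 1 (n + 1) * d (n + 1) = d (n + 1) / (4 * (n + 1)) +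
      (1 - d (n + 1)) / (Real.pi * (n + 1)) * relIntegral (n + 1) - eta 1 (n + 1) := fun n => by
    have := Real.pi_ne_zero
    rw [xi_one _ (by omega), eta_one _ (by omega)]
    push_cast
    field_simp
    ring
  simp only [e] at h1
  rw [(hs1.add hs2).tsum_sub hη, hs1.tsum_add hs2] at h1
  linarith

end Minkowski

theorem proposition1 :
    -- the improper integrals converge, and so do the sums `∑ 2^{-n} (log n)^r`
    (∀ n i j : ℕ, 1 ≤ n → Tendsto (oscPartial n i j) atTop (𝓝 (oscIntegral n i j))) ∧
    (∀ n : ℕ, 1 ≤ n → Tendsto (relPartial n) atTop (𝓝 (relIntegral n))) ∧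
    (∀ r : ℕ, Summable fun n : ℕ => (1 / 2 : ℝ) ^ (n + 1) * Real.log (n + 1) ^ r) ∧
    -- the identities, their absolute convergence, and the nature of the constants
    (∀ r : ℕ, Odd r →
      (∀ n : ℕ, 1 ≤ n → xi r n ∈ constAlgebra r) ∧
      A₀ r ∈ constAlgebra r ∧
      (∀ n : ℕ, 1 ≤ n → eta r n ∈ constAlgebra r) ∧
      (Summable fun n : ℕ => |eta r (n + 1)|) ∧
      (Summable fun n : ℕ => |xi r (n + 1) * d (n + 1)|) ∧
      ∑' n : ℕ, xi r (n + 1) * d (n + 1) = A r) ∧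
    -- the case `r = 1`
    (∀ n : ℕ, 1 ≤ n →
      xi 1 n = 1 / (4 * n) - 1 / (Real.pi * n) * relIntegral n) ∧
    A 1 = 3 / 4 * logSum 1 - 1 / 4 * Real.log (2 * Real.pi)
      - ∑' n : ℕ, 1 / (Real.pi * (n + 1)) * relIntegral (n + 1) ∧
    (Summable fun n : ℕ => |d (n + 1) / (4 * (n + 1))|) ∧
    (Summable fun n : ℕ =>
      |(1 - d (n + 1)) / (Real.pi * (n + 1)) * relIntegral (n + 1)|) ∧
    3 / 4 * logSum 1 - 1 / 4 * Real.log (2 * Real.pi)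
      - ∑' n : ℕ, d (n + 1) / (4 * (n + 1))
      - ∑' n : ℕ, (1 - d (n + 1)) / (Real.pi * (n + 1)) * relIntegral (n + 1) = 0 ∧
    -- the identities express that the odd derivatives at `0` of an even entire function vanish
    (∀ s : ℂ, IntegrableOn (fun x : ℝ => (x : ℂ) ^ s) (Set.Ioi 0) extMeasure) ∧
    Differentiable ℂ zetaMGamma ∧
    (∀ s : ℂ, zetaMGamma (-s) = zetaMGamma s) ∧
    (∀ r : ℕ, Odd r →
      iteratedDeriv r zetaMGamma 0
        = ((A r - ∑' n : ℕ, xi r (n + 1) * d (n + 1) : ℝ) : ℂ) ∧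
      iteratedDeriv r zetaMGamma 0 = 0) ∧
    -- canonicity: the identities determine the coefficients `d n`
    (∀ (G : ℝ → ℝ) (hG : MonotoneOn G (Set.Icc 0 1)),
      ContinuousOn G (Set.Icc 0 1) → G 0 = 0 →
      (∀ x ∈ Set.Icc (0 : ℝ) 1, G x + G (1 - x) = 1) →
      (∀ r : ℕ, Odd r →
        (Summable fun n : ℕ => |xi r (n + 1) * fsCoeff G hG (n + 1)|) ∧
        ∑' n : ℕ, xi r (n + 1) * fsCoeff G hG (n + 1) = A r) →
      Set.EqOn G question (Set.Icc 0 1) ∧ ∀ n : ℕ, fsCoeff G hG n = d n) := by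
  refine ⟨fun n i j hn => tendsto_oscPartial n hn i j, fun n hn => (tendsto_relPartial n hn).1,
    summable_geometric_mul_log, fun r hr => ⟨fun n hn => xi_mem r hn, A₀_mem r,
      fun n hn => eta_mem r hn, ?_, ?_, tsum_xi_mul_d hr⟩, xi_one, A_one, summable_abs_d_div,
    summable_relIntegral, first_identity, integrableOn_cpow_extMeasure, differentiable_zetaMGamma,
    zetaMGamma_neg, fun r hr => ⟨iteratedDeriv_zetaMGamma r, ?_⟩, eqOn_question_of_identities⟩
  · simpa using summable_mul_eta (e := fun _ => 1) (D := 1) (by simp) r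
  · exact summable_xi_mul (fun n => abs_fsCoeff_le_one isSymmDist_question (n + 1))
      summable_abs_d_mul_log r
  · rw [iteratedDeriv_zetaMGamma, tsum_xi_mul_d hr, sub_self, Complex.ofReal_zero]
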